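/- \textbf{Setting.} Let $K$ be a field of characteristic $0$ and $W$ a finite set of variables. Fix a collection of kinds of internal vertices, each with a finite number of numbered half-edges and a positive internal degree in $\frac12\mathbb N$, finitely many kinds in each degree. A strutless diagram consists of finitely many vertices of these kinds, each of whose half-edges is either joined to another half-edge or is a leg labeled by an element of $W$; its internal degree is the sum of the degrees of its vertices. A strut is an (unoriented) line of degree $0$ with both ends labeled in $W$, and a diagram is the disjoint union of a strutless diagram and finitely many struts. Strutless diagrams are taken up to isomorphism and modulo an arbitrary further family of $K$-linear relations that preserve the internal degree and the number of legs with each label and are compatible with relabeling and gluing legs (the sums being over all legs with given labels). A formal sum is a possibly infinite $K$-linear combination of diagrams; it has a coefficient, in the space of strutless diagrams modulo relations, for each internal degree and each collection of struts. The product of a formal sum with struts is disjoint union. Let $X\subseteq W$. For a symmetric matrix $\Lambda=(l_{xy})_{x,y\in X}$ over $K$ put $Q=\sum_{x,y\in X}l_{xy}\,s_{xy}$, where $s_{xy}$ is the strut with ends $x,y$. A formal sum $G$ is a \emph{non-degenerate Gaussian with respect to $X$}, with covariance matrix $\Lambda$, if $G=P\cdot\exp(Q/2)$ where $\Lambda$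 is symmetric and invertible and no diagram of $P$ has a strut with both ends labeled in $X$. Its formal Gaussian integral is $$\int^{FG}G\,dX=\Big(\exp\Big(-\tfrac12\sum_{x,y\in X}l^{xy}\,\partial_x\partial_y\Big)P\Big)\Big|_{x=0\ \forall x\in X},\qquad (l^{xy})=\Lambda^{-1},$$ where $\partial_x\partial_y$ acts on a diagram by the sum of all ways of gluing the two ends of an additional strut to a leg labeled $x$ and to a different leg labeled $y$ (a strut glued to a leg of a vertex disappears and passes the label of its other end on to that leg; two struts glued together become one strut), products of such operators act by composition, and setting $x=0$ drops all diagrams with a leg labeled $x$. \textbf{Proposition.} Let $X,Y\subseteq W$ be disjoint, $Z=X\cup Y$, and let $G=P\exp(Q/2)$ be a non-degenerate Gaussian with respect to $Z$ with covariance matrix $$\Lambda=\begin{pmatrix}A&B\\B^T&C\end{pmatrix}$$ (variables in $X$ first). If $A$ is invertible, then $G$ is a non-degenerate Gaussian with respect to $X$, its integral $\int^{FG}G\,dX$ is a non-degenerate Gaussian with respect to $Y$, and $$\int^{FG}G\,dZ=\int^{FG}\Big(\int^{FG}G\,dX\Big)\,dY .$$ Here each of the three integrals is well defined: each of its coefficients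 is a finite computation, and the result does not depend on the presentation of the integrand as a Gaussian. -/

import Mathlib

namespace FormalGaussian

/-- The kinds of internal vertices from which diagrams are built. A vertex of kind `v` has
`arity v` numbered half-edges and contributes `degree v` to the doubled internal degree (internal
degrees are half-integers, so their doubles are natural numbers). There are no vertices of degree
zero and only finitely many kinds in each degree; so struts are the only nonempty connected
diagrams of degree zero, and there are only finitely many strutless diagrams of bounded degree with
labels in a finite set. Symmetries of the vertices (such as antisymmetry) are imposed by the
internal relations below. -/
structure VertexSignature where
  Kind : Type*
  arity : Kind → ℕ
  degree : Kind → ℕ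
  degree_pos : ∀ v, 0 < degree v
  finite_degree : ∀ d, {v | degree v = d}.Finite

/-- A diagram without strut components, with legs labeled by `W`. Every half-edge of an internal
vertex is either (the base of) a leg with a label in `W`, or it is joined to another half-edge to
form an internal edge. -/
structure StrutlessDiagram (σ : VertexSignature) (W : Type*) where
  n : ℕ
  kind : Fin n → σ.Kind
  att : (Σ i, Fin (σ.arity (kind i))) → W ⊕ (Σ i, Fin (σ.arity (kind i)))
  att_ne : ∀ h, att h ≠ Sum.inr h
  att_symm : ∀ h h', att h = Sum.inr h' → att h' = Sum.inr h

namespace StrutlessDiagram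

variable {σ : VertexSignature} {W : Type*}

/-- The half-edges of a diagram. -/
abbrev HalfEdge (Γ : StrutlessDiagram σ W) : Type := Σ i, Fin (σ.arity (Γ.kind i))

/-- Twice the internal degree. -/
def degree (Γ : StrutlessDiagram σ W) : ℕ := ∑ i, σ.degree (Γ.kind i)

/-- The number of legs labeled `w`. -/
noncomputable def legCount (Γ : StrutlessDiagram σ W) (w : W) : ℕ :=
  Nat.card {h : Γ.HalfEdge // Γ.att h = Sum.inl w}

/-- Isomorphism of diagrams: a renumbering of the vertices that respects kinds, the numbering of
the half-edges at each vertex, the internal edges and the labels of the legs. -/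
def Iso (Γ Γ' : StrutlessDiagram σ W) : Prop :=
  ∃ (e : Fin Γ.n ≃ Fin Γ'.n) (f : Γ.HalfEdge ≃ Γ'.HalfEdge),
    (∀ i, Γ'.kind (e i) = Γ.kind i) ∧
    (∀ h, (f h).1 = e h.1 ∧ ((f h).2 : ℕ) = h.2) ∧
    ∀ h, Γ'.att (f h) = Sum.map id f (Γ.att h)

/-- The legs `h` and `h'` are glued to each other and become an internal edge. -/
def glue (Γ : StrutlessDiagram σ W) (x y : W) (h h' : Γ.HalfEdge)
    (hx : Γ.att h = Sum.inl x) (hy : Γ.att h' = Sum.inl y) (hne : h ≠ h') :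
    StrutlessDiagram σ W where
  n := Γ.n
  kind := Γ.kind
  att := Function.update (Function.update Γ.att h (Sum.inr h')) h' (Sum.inr h)
  att_ne := by
    intro a
    have := Γ.att_ne a
    have hne2 := hne.symm
    simp only [Function.update_apply]
    split_ifs <;> simp_all
  att_symm := by
    intro a b
    have h1 := Γ.att_symm a b
    have hne2 := hne.symm
    simp only [Function.update_apply]
    split_ifs <;> simp_all
    all_goals exact fun hab => absurd hab.symm (by assumption)

/-- The leg `h` gets the new label `w`. -/
def relabel (Γ : StrutlessDiagram σ W) (x w : W) (h : Γ.HalfEdge)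
    (hx : Γ.att h = Sum.inl x) : StrutlessDiagram σ W where
  n := Γ.n
  kind := Γ.kind
  att := Function.update Γ.att h (Sum.inl w)
  att_ne := by
    intro a
    have := Γ.att_ne a
    simp only [Function.update_apply]
    split_ifs <;> simp_all
  att_symm := by
    intro a b
    have h1 := Γ.att_symm a b
    simp only [Function.update_apply]
    split_ifs <;> simp_all

end StrutlessDiagram

/-- Strutless diagrams of doubled internal degree `d`. -/
abbrev GradedDiagram (σ : VertexSignature) (W : Type*) (d : ℕ) : Type _ :=
  {Γ : StrutlessDiagram σ W // Γ.degree = d}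

section Operations

variable (K : Type*) [Field K] {σ : VertexSignature} {W : Type*} {d : ℕ}

open Classical in
/-- The sum of all ways of gluing a leg labeled `x` to another leg labeled `y`. -/
noncomputable def glueLegs (x y : W) :
    (GradedDiagram σ W d →₀ K) →ₗ[K] (GradedDiagram σ W d →₀ K) :=
  Finsupp.linearCombination K fun Γ =>
    ∑ p : {p : Γ.1.HalfEdge × Γ.1.HalfEdge //
        Γ.1.att p.1 = Sum.inl x ∧ Γ.1.att p.2 = Sum.inl y ∧ p.1 ≠ p.2},
      Finsupp.single
        (⟨Γ.1.glue x y p.1.1 p.1.2 p.2.1 p.2.2.1 p.2.2.2, Γ.2⟩ : GradedDiagram σ W d) (1 : K)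

open Classical in
/-- The sum of all ways of replacing the label of one leg labeled `x` by `w`. -/
noncomputable def relabelLeg (x w : W) :
    (GradedDiagram σ W d →₀ K) →ₗ[K] (GradedDiagram σ W d →₀ K) :=
  Finsupp.linearCombination K fun Γ =>
    ∑ h : {h : Γ.1.HalfEdge // Γ.1.att h = Sum.inl x},
      Finsupp.single (⟨Γ.1.relabel x w h.1 h.2, Γ.2⟩ : GradedDiagram σ W d) (1 : K)

open Classical in
/-- Setting the variables in `X` to zero: diagrams with a leg labeled in `X` are dropped. -/
noncomputable def killLegs (X : Finset W) :
    (GradedDiagram σ W d →₀ K) →ₗ[K] (GradedDiagram σ W d →₀ K) :=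
  Finsupp.linearCombination K fun Γ =>
    if ∀ x ∈ X, Γ.1.legCount x = 0 then Finsupp.single Γ (1 : K) else 0

end Operations

open Classical in
/-- The relations modulo which diagrams are considered: isomorphic diagrams are identified, and
beyond that there may be arbitrary linear relations between strutless diagrams. They preserve the
internal degree and the numbers of legs with each label, and they are compatible with the
operations on legs. -/
structure InternalRelations (K : Type*) [Field K] (σ : VertexSignature) (W : Type*) where
  rel : ∀ d, Submodule K (GradedDiagram σ W d →₀ K)
  iso_mem : ∀ d (Γ Γ' : GradedDiagram σ W d), Γ.1.Iso Γ'.1 →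
    Finsupp.single Γ (1 : K) - Finsupp.single Γ' (1 : K) ∈ rel d
  legs_mem : ∀ d (μ : W → ℕ), ∀ r ∈ rel d, r.filter (fun Γ => Γ.1.legCount = μ) ∈ rel d
  glue_mem : ∀ d (x y : W), ∀ r ∈ rel d, glueLegs K x y r ∈ rel d
  relabel_mem : ∀ d (x w : W), ∀ r ∈ rel d, relabelLeg K x w r ∈ rel d

namespace InternalRelations

variable {K : Type*} [Field K] {σ : VertexSignature} {W : Type*}

theorem kill_mem (R : InternalRelations K σ W) (d : ℕ) (X : Finset W)
    (r : GradedDiagram σ W d →₀ K) (hr : r ∈ R.rel d) : killLegs K X r ∈ R.rel d := by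
  classical
  let p : (W → ℕ) → Prop := fun μ => ∀ x ∈ X, μ x = 0
  let S : Finset (W → ℕ) := (r.support.image fun Γ => Γ.1.legCount).filter p
  have key : killLegs K X r = ∑ μ ∈ S, r.filter (fun Γ => Γ.1.legCount = μ) := by
    have h1 : killLegs K X r = r.filter (fun Γ => p Γ.1.legCount) := by
      rw [killLegs, Finsupp.linearCombination_apply, ← Finsupp.sum_single (Finsupp.filter _ r),
        Finsupp.sum_filter_index, Finsupp.sum, Finsupp.support_filter, Finset.sum_filter]
      refine Finset.sum_congr rfl fun Γ _ => ?_
      simp only [p]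
      split_ifs <;> simp
    rw [h1]
    ext Γ
    rw [Finsupp.finsetSum_apply]
    simp only [Finsupp.filter_apply]
    rw [Finset.sum_ite_eq]
    by_cases hΓ : r Γ = 0
    · simp [hΓ]
    · have : (Γ.1.legCount ∈ S) ↔ p Γ.1.legCount := by
        simp only [S, Finset.mem_filter, Finset.mem_image, Finsupp.mem_support_iff]
        exact ⟨fun h => h.2, fun h => ⟨⟨Γ, hΓ, rfl⟩, h⟩⟩
      simp only [this]
  rw [key]
  exact Submodule.sum_mem _ fun μ _ => R.legs_mem d μ r hr

variable (R : InternalRelations K σ W)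

/-- The space of strutless diagrams of doubled internal degree `d`, modulo the relations. -/
abbrev Space (d : ℕ) : Type _ := (GradedDiagram σ W d →₀ K) ⧸ R.rel d

/-- The sum of all ways of gluing a leg labeled `x` to another leg labeled `y`. -/
noncomputable def glue (d : ℕ) (x y : W) : R.Space d →ₗ[K] R.Space d :=
  (R.rel d).mapQ (R.rel d) (glueLegs K x y) (R.glue_mem d x y)

/-- The sum of all ways of replacing the label of one leg labeled `x` by `w`. -/
noncomputable def relabel (d : ℕ) (x w : W) : R.Space d →ₗ[K] R.Space d :=
  (R.rel d).mapQ (R.rel d) (relabelLeg K x w) (R.relabel_mem d x w)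

/-- Setting the variables in `X` to zero. -/
noncomputable def kill (d : ℕ) (X : Finset W) : R.Space d →ₗ[K] R.Space d :=
  (R.rel d).mapQ (R.rel d) (killLegs K X) (R.kill_mem d X)

/-- Finite linear combinations, in doubled internal degree `d`, of general diagrams. A diagram is
the disjoint union of a strutless diagram and of struts; the exponent vector `m` says that there
are `m s(x, y)` struts with ends labeled `x` and `y`. -/
abbrev FiniteSum (d : ℕ) : Type _ := (Sym2 W →₀ ℕ) →₀ R.Space d

/-- Infinite weighted sums of diagrams: a coefficient in the space of strutless diagrams for each
doubled internal degree `d` and each collection `m` of struts. -/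
abbrev FormalSum : Type _ := ∀ d, (Sym2 W →₀ ℕ) → R.Space d

end InternalRelations

/-- The number of ways to pick, in a collection `m` of struts, an end labeled `x` of a strut whose
other end is labeled `w`. -/
def strutEnds {W : Type*} [DecidableEq W] (m : Sym2 W →₀ ℕ) (x w : W) : ℕ :=
  if x = w then 2 * m s(x, x) else m s(x, w)

namespace InternalRelations

variable {K : Type*} [Field K] {σ : VertexSignature} {W : Type*} [Fintype W] [DecidableEq W]
variable (R : InternalRelations K σ W)

/-- The action of a strut with ends labeled by the dual variables of `x` and `y`: the sum of all
ways of gluing its first end to a leg labeled `x` and its second end to a different leg labeled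
`y`. The four summands are the gluings in which both these legs are on the strutless part; the
first one is on the strutless part and the second one on a strut (whose other end passes its label
on to the first leg); vice versa; and the legs are on two different struts (which merge into one).
The gluing to both ends of one strut would create a closed circle, which is not a diagram; it never
occurs below, since struts with both ends labeled by integrated variables are excluded. -/
noncomputable def strutAct (d : ℕ) (x y : W) : R.FiniteSum d →ₗ[K] R.FiniteSum d :=
  Finsupp.lsum K fun m : Sym2 W →₀ ℕ =>
    (Finsupp.lsingle m ∘ₗ R.glue d x y
    + ∑ w : W, strutEnds m y w •
        (Finsupp.lsingle (m - Finsupp.single s(y, w) 1) ∘ₗ R.relabel d x w)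
    + ∑ w : W, strutEnds m x w •
        (Finsupp.lsingle (m - Finsupp.single s(x, w) 1) ∘ₗ R.relabel d y w)
    + ∑ w : W, ∑ w' : W,
        (strutEnds m x w * strutEnds (m - Finsupp.single s(x, w) 1) y w') •
          Finsupp.lsingle (m - Finsupp.single s(x, w) 1 - Finsupp.single s(y, w') 1
            + Finsupp.single s(w, w') 1) :
      R.Space d →ₗ[K] R.FiniteSum d)

open Classical in
/-- Setting the variables in `X` to zero: diagrams with a leg labeled in `X` are dropped. -/
noncomputable def evalZero (d : ℕ) (X : Finset W) : R.FiniteSum d →ₗ[K] R.FiniteSum d :=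
  Finsupp.lsum K fun m : Sym2 W →₀ ℕ =>
    if ∀ x ∈ X, ∀ w : W, m s(x, w) = 0 then Finsupp.lsingle m ∘ₗ R.kill d X else 0

/-- The differential operator `-Q⁻¹/2`, for the quadratic `Q` in the variables `X` with matrix
`L`. -/
noncomputable def negHalfInverse (d : ℕ) {X : Finset W} (L : Matrix X X K) :
    Module.End K (R.FiniteSum d) :=
  (-(1 / 2) : K) • ∑ x : X, ∑ y : X, L⁻¹ x y • R.strutAct d x.1 y.1

/-- The contribution, to the coefficient of the struts `m` in `⟨exp (-Q⁻¹/2), P⟩`, of the `k`-th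
term of the exponential series and of the part of `P` with struts `m'`. Products of constant
coefficient operators act by composition. -/
noncomputable def pairingTerm {X : Finset W} (L : Matrix X X K) (P : R.FormalSum) (d : ℕ)
    (m : Sym2 W →₀ ℕ) (k : ℕ) (m' : Sym2 W →₀ ℕ) : R.Space d :=
  (k.factorial : K)⁻¹ •
    R.evalZero d X ((R.negHalfInverse d L ^ k) (Finsupp.single m' (P d m'))) m

/-- `I` is the pairing `⟨exp (-Q⁻¹/2), P⟩`; in particular the computation of each coefficient of
the pairing is finite. -/
def IsPairing {X : Finset W} (L : Matrix X X K) (P I : R.FormalSum) : Prop :=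
  ∀ (d : ℕ) (m : Sym2 W →₀ ℕ),
    {p : ℕ × (Sym2 W →₀ ℕ) | R.pairingTerm L P d m p.1 p.2 ≠ 0}.Finite ∧
    I d m = ∑ᶠ p : ℕ × (Sym2 W →₀ ℕ), R.pairingTerm L P d m p.1 p.2

end InternalRelations

/-- The quadratic with matrix `L`, as a power series in the struts (the product being the disjoint
union). -/
noncomputable def quadratic {K : Type*} [Field K] {W : Type*} {X : Finset W} (L : Matrix X X K) :
    MvPowerSeries (Sym2 W) K :=
  ∑ x : X, ∑ y : X, L x y • MvPowerSeries.X s(x.1, y.1)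

/-- `exp (Q/2)`, by substitution into the exponential power series. -/
noncomputable def expHalf {K : Type*} [Field K] [CharZero K] {W : Type*} {X : Finset W}
    (L : Matrix X X K) : MvPowerSeries (Sym2 W) K :=
  (PowerSeries.exp K).subst ((1 / 2 : K) • quadratic L)

namespace InternalRelations

variable {K : Type*} [Field K] [CharZero K] {σ : VertexSignature} {W : Type*} [Fintype W]
  [DecidableEq W]
variable (R : InternalRelations K σ W)

/-- `P · exp (Q/2)`, where `Q` is the quadratic with matrix `L`. -/
noncomputable def mulExp {X : Finset W} (P : R.FormalSum) (L : Matrix X X K) : R.FormalSum :=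
  fun d m => ∑ p ∈ Finset.HasAntidiagonal.antidiagonal m, MvPowerSeries.coeff p.2 (expHalf L) • P d p.1

/-- `P` is `X`-substantial: it has no strut components with both ends labeled in `X`. -/
def IsSubstantial (X : Finset W) (P : R.FormalSum) : Prop :=
  ∀ (d : ℕ) (m : Sym2 W →₀ ℕ), (∃ x ∈ X, ∃ y ∈ X, m s(x, y) ≠ 0) → P d m = 0

/-- `G = P · exp (Q/2)` presents `G` as a non-degenerate Gaussian with respect to `X`, with
covariance matrix `L`. -/
def IsNondegenerateGaussianWith (X : Finset W) (G P : R.FormalSum) (L : Matrix X X K) : Prop :=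
  L.IsSymm ∧ IsUnit L ∧ R.IsSubstantial X P ∧ G = R.mulExp P L

/-- `G` is a non-degenerate Gaussian with respect to `X`. -/
def IsNondegenerateGaussian (X : Finset W) (G : R.FormalSum) : Prop :=
  ∃ (P : R.FormalSum) (L : Matrix X X K), R.IsNondegenerateGaussianWith X G P L

/-- `I` is a value of the formal Gaussian integral of `G` with respect to `X`. -/
def IsFGIntegral (X : Finset W) (G I : R.FormalSum) : Prop :=
  ∃ (P : R.FormalSum) (L : Matrix X X K),
    R.IsNondegenerateGaussianWith X G P L ∧ R.IsPairing L P I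

end InternalRelations

end FormalGaussian

namespace FormalGaussian

set_option linter.unusedSectionVars false
set_option linter.unusedSimpArgs false

/-! Write `G = P exp(½ xᵀAx + xᵀBy + ½ yᵀCy)`. Completing the square in `x` shows that integrating
out `X` leaves `exp(½ yᵀSy)`, with the Schur complement `S = C - BᵀA⁻¹B`, times a series obtained
from `P` by substituting `x - A⁻¹By` for `x`, pairing with the Gaussian of `A⁻¹` and setting `x =
0`. Integrating over `Y` then applies the second order operator of `S⁻¹`. Moved through the
substitution, the operators of `A⁻¹` and `S⁻¹` combine into that of `L⁻¹`, which is the block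
formula `exists_block_inverse`; the substitution that remains only creates legs labeled in `Y`, and
these are set to zero.

All of this is an identity between operators on sums of diagrams, deduced from commutators alone.
Multiplication by a strut (`mulStrut`), relabeling a leg (`moveLeg`) and gluing two legs (`join`)
satisfy the commutation relations of a symplectic Lie algebra, with struts as quadratic monomials
and gluings as second order derivatives; no constants occur because closed circles are excluded.
Hence conjugation by the relevant exponentials stops after at most two commutators.
`mul_dpow_hermite` is the completion of the square, and `gaussPairing_mul_gaussPairing` is the
composition of the two integrals.

Analysis is replaced by gradings. Counting legs with labels in a set is a diagonalizable operator
with natural eigenvalues. Operators that lower such a count are locally nilpotent, so their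
exponentials make sense; evaluation at zero is the projection to count zero. Operators that
integrate over `X` preserve the count of legs labeled outside `X`. A strutless diagram of given
degree has boundedly many legs, and every strut of a substantial term has an end outside `X`; so
each coefficient of the result involves only finitely many terms. This gives well-definedness
(`isPairing_iff`) and lets operator identities pass from finite to infinite sums (`extend_psmul`,
`extend_extend`). Independence of the presentation follows by comparing coefficients of struts
inside `X` (`IsNondegenerateGaussianWith.unique`). -/

/-- The Kronecker delta. -/
def delta (K : Type*) [Field K] {W : Type*} [DecidableEq W] (a b : W) : K := if a = b then 1 else 0

/-! ### Gluing and relabeling on functions from the half-edges -/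

section Site

variable (K : Type*) [Field K] {H A : Type*} [DecidableEq H] [DecidableEq A]

/-- The operator replacing the value `a` at the site `h` by `b`, and killing the functions with
another value at `h`. -/
noncomputable def siteMap (h : H) (a b : A) : Module.End K ((H → A) →₀ K) :=
  Finsupp.linearCombination K fun f =>
    if f h = a then Finsupp.single (Function.update f h b) (1 : K) else 0

theorem siteMap_single (h : H) (a b : A) (f : H → A) :
    siteMap K h a b (Finsupp.single f 1) =
      if f h = a then Finsupp.single (Function.update f h b) (1 : K) else 0 := by
  simp [siteMap]

/-- For finitely many sites the functions `H → A` index a basis of a tensor product with one factor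
per site, and `siteMap K h a b` is a matrix unit in the factor `h`. This is the product rule of
matrix units. -/
theorem siteMap_mul_self (h : H) (a b a' b' : A) :
    siteMap K h a b * siteMap K h a' b' = delta K a b' • siteMap K h a' b := by
  refine Finsupp.lhom_ext' fun f => LinearMap.ext_ring ?_
  simp only [LinearMap.comp_apply, Finsupp.lsingle_apply, Module.End.mul_apply, siteMap_single,
    LinearMap.smul_apply, delta]
  split_ifs <;> simp_all [siteMap_single, eq_comm]

theorem siteMap_mul_self_of_ne (h : H) {a b' : A} (b a' : A) (hab : a ≠ b') :
    siteMap K h a b * siteMap K h a' b' = 0 := by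
  simp [siteMap_mul_self, delta, hab]

theorem siteMap_commute {h h' : H} (hh : h ≠ h') (a b a' b' : A) :
    Commute (siteMap K h a b) (siteMap K h' a' b') := by
  refine Finsupp.lhom_ext' fun f => LinearMap.ext_ring ?_
  simp only [LinearMap.comp_apply, Finsupp.lsingle_apply, Module.End.mul_apply, siteMap_single]
  split_ifs <;> simp_all [siteMap_single, Function.update_of_ne, hh.symm]
  rw [Function.update_comm hh]

end Site

section Semiring

variable {K R : Type*} [Field K] [Semiring R] [Algebra K R] {H W : Type*} [DecidableEq H]
  [DecidableEq W] [Fintype H]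

theorem mul_mul_eq_add {a b c s t : R} (hb : b * c = c * b + s) (ha : a * c = c * a + t) :
    a * b * c = c * (a * b) + (a * s + t * b) := by
  rw [mul_assoc, hb, mul_add, ← mul_assoc, ha, add_mul, mul_assoc, add_right_comm, add_assoc]

/-- Terms at different sites commute and cancel, so only the product rule at a single site
contributes. The commutator is written without subtraction because the coefficients form a semiring.
-/
theorem sum_relabel_mul (u : H → W → W → R)
    (hu : ∀ h a b a' b', u h a b * u h a' b' = delta K a b' • u h a' b)
    (hc : ∀ h h', h ≠ h' → ∀ a b a' b', Commute (u h a b) (u h' a' b')) (x w a b : W) :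
    (∑ h, u h x w) * (∑ h, u h a b) + delta K w a • ∑ h, u h x b =
      (∑ h, u h a b) * (∑ h, u h x w) + delta K x b • ∑ h, u h a w := by
  have h1 : (∑ h, u h a b) * (∑ h, u h x w) = ∑ h, ∑ h', u h' a b * u h x w := by
    rw [Finset.sum_mul_sum, Finset.sum_comm]
  rw [h1, Finset.sum_mul_sum, Finset.smul_sum, Finset.smul_sum, ← Finset.sum_add_distrib,
    ← Finset.sum_add_distrib]
  refine Finset.sum_congr rfl fun h _ => ?_
  rw [← Finset.add_sum_erase _ _ (Finset.mem_univ h),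
    ← Finset.add_sum_erase _ (fun h' => u h' a b * u h x w) (Finset.mem_univ h),
    Finset.sum_congr rfl fun h' hh' => (hc h h' (Finset.ne_of_mem_erase hh').symm x w a b).eq,
    hu, hu, add_right_comm, add_right_comm (delta K a w • _),
    add_comm (delta K x b • _), show delta K w a = delta K a w by simp only [delta, eq_comm]]

/-- Only the summand at `h` itself fails to commute with `v h`, and there one of the two orders
gives zero: a half-edge that has just been joined has no label left to change. -/
theorem site_mul_sum (v : H → R) (u : H → W → W → R) (h : H) (x t b : W) (v' : R)
    (hv : v h * u h t b = delta K x b • v') (hv0 : u h t b * v h = 0)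
    (hc : ∀ h', h ≠ h' → Commute (v h) (u h' t b)) :
    v h * (∑ k, u k t b) = (∑ k, u k t b) * v h + delta K x b • v' := by
  rw [Finset.mul_sum, Finset.sum_mul, ← Finset.add_sum_erase _ _ (Finset.mem_univ h),
    ← Finset.add_sum_erase _ (fun k => u k t b * v h) (Finset.mem_univ h), hv, hv0, zero_add,
    Finset.sum_congr rfl fun h' hh' => (hc h' (Finset.ne_of_mem_erase hh').symm).eq, add_comm]

theorem sum_join_mul (g : W → W → H → H → R) (r : R) (x y t b : W)
    (hg : ∀ h h', g x y h h' * r = r * g x y h h' +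
      (delta K x b • g t y h h' + delta K y b • g x t h h')) :
    (∑ h, ∑ h', g x y h h') * r = r * (∑ h, ∑ h', g x y h h') +
      (delta K x b • (∑ h, ∑ h', g t y h h') + delta K y b • ∑ h, ∑ h', g x t h h') := by
  simp only [Finset.sum_mul, Finset.mul_sum, Finset.smul_sum, hg, Finset.sum_add_distrib]

end Semiring

theorem comp_mul_of_comp {K M N : Type*} [Field K] [AddCommMonoid M] [Module K M] [AddCommMonoid N]
    [Module K N] {j : M →ₗ[K] N} {t u : Module.End K M} {T U : Module.End K N}
    (h : T ∘ₗ j = j ∘ₗ t) (h' : U ∘ₗ j = j ∘ₗ u) : (T * U) ∘ₗ j = j ∘ₗ (t * u) := by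
  rw [Module.End.mul_eq_comp, LinearMap.comp_assoc, h', ← LinearMap.comp_assoc, h,
    LinearMap.comp_assoc, Module.End.mul_eq_comp]

section Raw

variable (K : Type*) [Field K] {H W : Type*} [DecidableEq H] [DecidableEq W] [Fintype H]

/-- Relabeling one leg, on functions from the half-edges. -/
noncomputable def rawRelabel (x w : W) : Module.End K ((H → W ⊕ H) →₀ K) :=
  ∑ h : H, siteMap K h (Sum.inl x) (Sum.inl w)

/-- Gluing a given pair of legs, on functions from the half-edges. -/
noncomputable def rawJoin (x y : W) (h h' : H) : Module.End K ((H → W ⊕ H) →₀ K) :=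
  if h ≠ h' then
    siteMap K h' (Sum.inl y) (Sum.inr h) * siteMap K h (Sum.inl x) (Sum.inr h') else 0

/-- Gluing two legs, on functions from the half-edges. -/
noncomputable def rawGlue (x y : W) : Module.End K ((H → W ⊕ H) →₀ K) :=
  ∑ h : H, ∑ h' : H, rawJoin K x y h h'

theorem rawRelabel_mul_rawRelabel (x w a b : W) :
    rawRelabel K (H := H) x w * rawRelabel K a b + delta K w a • rawRelabel K x b =
      rawRelabel K a b * rawRelabel K x w + delta K x b • rawRelabel K a w :=
  sum_relabel_mul (fun (h : H) (a b : W) => siteMap K h (Sum.inl a : W ⊕ H) (Sum.inl b))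
    (fun h a b a' b' => by simp only [siteMap_mul_self, delta, Sum.inl.injEq])
    (fun h h' hh a b a' b' => siteMap_commute K hh _ _ _ _) x w a b

theorem siteMap_mul_rawRelabel (h h' : H) (x t b : W) :
    siteMap K h (Sum.inl x) (Sum.inr h') * rawRelabel K t b =
      rawRelabel K t b * siteMap K h (Sum.inl x) (Sum.inr h') +
        delta K x b • siteMap K h (Sum.inl t) (Sum.inr h') :=
  site_mul_sum (fun h => siteMap K h (Sum.inl x : W ⊕ H) (Sum.inr h'))
    (fun (h : H) (a b : W) => siteMap K h (Sum.inl a : W ⊕ H) (Sum.inl b)) h x t b _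
    (by simp only [siteMap_mul_self, delta, Sum.inl.injEq])
    (siteMap_mul_self_of_ne K h _ _ (by simp)) (fun k hk => siteMap_commute K hk _ _ _ _)

theorem rawJoin_mul_rawRelabel (x y t b : W) (h h' : H) :
    rawJoin K x y h h' * rawRelabel K t b = rawRelabel K t b * rawJoin K x y h h' +
      (delta K x b • rawJoin K t y h h' + delta K y b • rawJoin K x t h h') := by
  unfold rawJoin
  split_ifs with hh
  · rw [mul_mul_eq_add (siteMap_mul_rawRelabel K h h' x t b) (siteMap_mul_rawRelabel K h' h y t b),
      mul_smul_comm, smul_mul_assoc]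
  · simp

theorem rawGlue_mul_rawRelabel (x y t b : W) :
    rawGlue K (H := H) x y * rawRelabel K t b = rawRelabel K t b * rawGlue K x y +
      (delta K x b • rawGlue K t y + delta K y b • rawGlue K x t) :=
  sum_join_mul (rawJoin K) _ x y t b fun h h' => rawJoin_mul_rawRelabel K x y t b h h'

/-- Factors at different sites commute, and two factors at the same site have product zero in either
order, since a joined half-edge carries no label. -/
theorem rawJoin_commute (x y z t : W) (h h' k k' : H) :
    Commute (rawJoin K x y h h') (rawJoin K z t k k') := by
  unfold rawJoin
  split_ifs with h1 h2
  · have key : ∀ (l l' : H) (a b : W) (p p' : H), l ≠ l' →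
        Commute (siteMap K l (Sum.inl a : W ⊕ H) (Sum.inr p))
          (siteMap K l' (Sum.inl b) (Sum.inr p')) := fun l l' a b p p' hl =>
      siteMap_commute K hl _ _ _ _
    have zero : ∀ (l : H) (a b : W) (p p' : H),
        Commute (siteMap K l (Sum.inl a : W ⊕ H) (Sum.inr p))
          (siteMap K l (Sum.inl b) (Sum.inr p')) := fun l a b p p' => by
      rw [Commute, SemiconjBy, siteMap_mul_self_of_ne K l _ _ (by simp),
        siteMap_mul_self_of_ne K l _ _ (by simp)]
    have all : ∀ (l l' : H) (a b : W) (p p' : H),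
        Commute (siteMap K l (Sum.inl a : W ⊕ H) (Sum.inr p))
          (siteMap K l' (Sum.inl b) (Sum.inr p')) := fun l l' a b p p' => by
      by_cases hl : l = l'
      · subst hl; exact zero _ _ _ _ _
      · exact key _ _ _ _ _ _ hl
    exact ((all _ _ _ _ _ _).mul_right (all _ _ _ _ _ _)).mul_left
      ((all _ _ _ _ _ _).mul_right (all _ _ _ _ _ _))
  all_goals simp

theorem rawGlue_commute (x y z t : W) :
    Commute (rawGlue K (H := H) x y) (rawGlue K z t) :=
  Commute.sum_left _ _ _ fun _ _ => Commute.sum_left _ _ _ fun _ _ =>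
    Commute.sum_right _ _ _ fun _ _ => Commute.sum_right _ _ _ fun _ _ => rawJoin_commute K _ _ _ _ _ _ _ _

theorem rawGlue_comm (x y : W) : rawGlue K (H := H) x y = rawGlue K y x := by
  rw [rawGlue, rawGlue, Finset.sum_comm]
  refine Finset.sum_congr rfl fun h _ => Finset.sum_congr rfl fun h' _ => ?_
  unfold rawJoin
  by_cases hh : h = h'
  · simp [hh]
  · rw [if_pos (Ne.symm hh), if_pos hh, (siteMap_commute K hh _ _ _ _).eq]

theorem rawJoin_single (x y : W) (h h' : H) (f : H → W ⊕ H) :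
    rawJoin K x y h h' (Finsupp.single f 1) =
      if f h = Sum.inl x ∧ f h' = Sum.inl y ∧ h ≠ h' then
        Finsupp.single (Function.update (Function.update f h (Sum.inr h')) h' (Sum.inr h)) (1 : K)
      else 0 := by
  unfold rawJoin
  by_cases hh : h = h'
  · simp [hh]
  · simp only [ne_eq, hh, not_false_eq_true, if_true, Module.End.mul_apply, siteMap_single]
    split_ifs <;> simp_all [siteMap_single, Function.update_of_ne, Ne.symm hh]

end Raw

theorem sum_eq_card_nsmul_of_forall_eq {T M : Type*} {_ : Fintype T} [AddCommMonoid M] {F : T → M}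
    {c : M} (h : ∀ t, F t = c) : ∑ t, F t = Nat.card T • c := by
  rw [Finset.sum_congr rfl fun t _ => h t, Finset.sum_const, Finset.card_univ,
    Nat.card_eq_fintype_card]

/-! ### Transfer of the commutation relations to diagrams -/

section Realize

variable (K : Type*) [Field K] {σ : VertexSignature} {W : Type*} [DecidableEq W] {d : ℕ}

/-- The condition on a function from the half-edges to describe a diagram. -/
def IsAttachment {H : Type*} (f : H → W ⊕ H) : Prop :=
  (∀ h, f h ≠ Sum.inr h) ∧ ∀ h h', f h = Sum.inr h' → f h' = Sum.inr h

/-- Both directions are needed here and in `isAttachment_join_iff`: `realize` sends functions that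
describe no diagram to zero, so it intertwines the operators only if invalid functions remain
invalid. -/
theorem isAttachment_update_iff {H : Type*} [DecidableEq H] {f : H → W ⊕ H} {h : H} {x : W}
    (hx : f h = Sum.inl x) (w : W) :
    IsAttachment (Function.update f h (Sum.inl w)) ↔ IsAttachment f := by
  constructor
  · rintro ⟨h1, h2⟩
    refine ⟨fun a => ?_, fun a b hab => ?_⟩
    · have := h1 a
      rw [Function.update_apply] at this
      split_ifs at this <;> simp_all
    · have := h2 a b
      simp only [Function.update_apply] at this
      split_ifs at this <;> simp_all
  · rintro ⟨h1, h2⟩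
    refine ⟨fun a => ?_, fun a b => ?_⟩
    · have := h1 a
      rw [Function.update_apply]
      split_ifs <;> simp_all
    · have := h2 a b
      simp only [Function.update_apply]
      split_ifs <;> simp_all

theorem isAttachment_join_iff {H : Type*} [DecidableEq H] {f : H → W ⊕ H} {h h' : H} {x y : W}
    (hx : f h = Sum.inl x) (hy : f h' = Sum.inl y) (hne : h ≠ h') :
    IsAttachment (Function.update (Function.update f h (Sum.inr h')) h' (Sum.inr h)) ↔
      IsAttachment f := by
  have hne' := hne.symm
  constructor
  · rintro ⟨h1, h2⟩
    refine ⟨fun a => ?_, fun a b hab => ?_⟩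
    · have := h1 a
      simp only [Function.update_apply] at this
      split_ifs at this <;> simp_all
    · have h3 := h2 a b
      simp only [Function.update_apply] at h3
      by_cases ha : a = h
      · simp_all
      by_cases ha' : a = h'
      · simp_all
      rw [if_neg ha', if_neg ha] at h3
      have h4 := h3 hab
      split_ifs at h4 <;> simp_all
  · rintro ⟨h1, h2⟩
    refine ⟨fun a => ?_, fun a b => ?_⟩
    · have := h1 a
      simp only [Function.update_apply]
      split_ifs <;> simp_all
    · have := h2 a b
      simp only [Function.update_apply]
      split_ifs <;> simp_all
      all_goals exact fun hab => absurd hab.symm (by assumption)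

variable (n : ℕ) (kind : Fin n → σ.Kind) (hd : ∑ i, σ.degree (kind i) = d)

open Classical in
/-- The diagrams with given vertices, from functions on the half-edges. -/
noncomputable def realize :
    (((Σ i, Fin (σ.arity (kind i))) → W ⊕ (Σ i, Fin (σ.arity (kind i)))) →₀ K) →ₗ[K]
      (GradedDiagram σ W d →₀ K) :=
  Finsupp.linearCombination K fun f =>
    if hf : IsAttachment f then
      Finsupp.single (⟨⟨n, kind, f, hf.1, hf.2⟩, hd⟩ : GradedDiagram σ W d) (1 : K) else 0

theorem realize_single (f : (Σ i, Fin (σ.arity (kind i))) → W ⊕ (Σ i, Fin (σ.arity (kind i)))) :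
    realize K n kind hd (Finsupp.single f 1) = open Classical in
      if hf : IsAttachment f then
        Finsupp.single (⟨⟨n, kind, f, hf.1, hf.2⟩, hd⟩ : GradedDiagram σ W d) (1 : K) else 0 := by
  simp [realize]

theorem relabelLeg_realize (x w : W) :
    relabelLeg K x w ∘ₗ realize K n kind hd = realize K n kind hd ∘ₗ rawRelabel K x w := by
  classical
  refine Finsupp.lhom_ext' fun f => LinearMap.ext_ring ?_
  simp only [LinearMap.comp_apply, Finsupp.lsingle_apply, rawRelabel, LinearMap.sum_apply,
    map_sum, siteMap_single]
  rw [realize_single]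
  by_cases hf : IsAttachment f
  · rw [dif_pos hf, relabelLeg, Finsupp.linearCombination_single, one_smul]
    rw [← Finset.sum_filter_add_sum_filter_not Finset.univ (fun h => f h = Sum.inl x),
      Finset.sum_eq_zero (s := Finset.univ.filter fun h => ¬ f h = Sum.inl x), add_zero,
      Finset.sum_subtype (p := fun h => f h = Sum.inl x) _ (by simp)]
    · refine Finset.sum_congr rfl fun h _ => ?_
      rw [if_pos h.2, realize_single, dif_pos ((isAttachment_update_iff h.2 w).2 hf)]
      rfl
    · intro h hh
      rw [if_neg (by simpa using hh), map_zero]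
  · rw [dif_neg hf, map_zero]
    refine (Finset.sum_eq_zero fun h _ => ?_).symm
    split_ifs with hx
    · rw [realize_single, dif_neg (fun h1 => hf ((isAttachment_update_iff hx w).1 h1))]
    · simp

theorem glueLegs_realize (x y : W) :
    glueLegs K x y ∘ₗ realize K n kind hd = realize K n kind hd ∘ₗ rawGlue K x y := by
  classical
  refine Finsupp.lhom_ext' fun f => LinearMap.ext_ring ?_
  simp only [LinearMap.comp_apply, Finsupp.lsingle_apply, rawGlue, LinearMap.sum_apply,
    map_sum, rawJoin_single]
  rw [realize_single, ← Finset.sum_product' (f := fun h h' => realize K n kind hd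
    (if f h = Sum.inl x ∧ f h' = Sum.inl y ∧ h ≠ h' then Finsupp.single
      (Function.update (Function.update f h (Sum.inr h')) h' (Sum.inr h)) (1 : K) else 0))]
  by_cases hf : IsAttachment f
  · rw [dif_pos hf, glueLegs, Finsupp.linearCombination_single, one_smul]
    rw [← Finset.sum_filter_add_sum_filter_not (Finset.univ ×ˢ Finset.univ)
        (fun p : (Σ i, Fin (σ.arity (kind i))) × (Σ i, Fin (σ.arity (kind i))) =>
          f p.1 = Sum.inl x ∧ f p.2 = Sum.inl y ∧ p.1 ≠ p.2),
      Finset.sum_eq_zero (s := Finset.filter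
        (fun p : (Σ i, Fin (σ.arity (kind i))) × (Σ i, Fin (σ.arity (kind i))) => ¬ (f p.1 = Sum.inl x ∧ f p.2 = Sum.inl y ∧ p.1 ≠ p.2)) _), add_zero,
      Finset.sum_subtype (p := fun p : (Σ i, Fin (σ.arity (kind i))) × (Σ i, Fin (σ.arity (kind i))) =>
          f p.1 = Sum.inl x ∧ f p.2 = Sum.inl y ∧ p.1 ≠ p.2) _
        (by simp)]
    · refine Finset.sum_congr rfl fun p _ => ?_
      rw [if_pos p.2, realize_single,
        dif_pos ((isAttachment_join_iff p.2.1 p.2.2.1 p.2.2.2).2 hf)]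
      rfl
    · intro p hp
      rw [if_neg (Finset.mem_filter.1 hp).2, map_zero]
  · rw [dif_neg hf, map_zero]
    refine (Finset.sum_eq_zero fun p _ => ?_).symm
    split_ifs with hx
    · rw [realize_single, dif_neg (fun h1 => hf ((isAttachment_join_iff hx.1 hx.2.1 hx.2.2).1 h1))]
    · simp

theorem realize_att (Γ : GradedDiagram σ W d) :
    realize K Γ.1.n Γ.1.kind Γ.2 (Finsupp.single Γ.1.att 1) = Finsupp.single Γ 1 := by
  refine (realize_single K Γ.1.n Γ.1.kind Γ.2 Γ.1.att).trans ?_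
  rw [dif_pos (show IsAttachment Γ.1.att from ⟨Γ.1.att_ne, Γ.1.att_symm⟩)]

variable {K}

/-- Every diagram is realized by its own attachment function, so the images of the maps `realize`
span. -/
theorem eq_of_comp_realize {T U : (GradedDiagram σ W d →₀ K) →ₗ[K] (GradedDiagram σ W d →₀ K)}
    (h : ∀ (n : ℕ) (kind : Fin n → σ.Kind) (hd : ∑ i, σ.degree (kind i) = d),
      T ∘ₗ realize K n kind hd = U ∘ₗ realize K n kind hd) : T = U := by
  refine Finsupp.lhom_ext' fun Γ => LinearMap.ext_ring ?_
  simpa [realize_att] using LinearMap.congr_fun (h Γ.1.n Γ.1.kind Γ.2) (Finsupp.single Γ.1.att 1)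

variable (K)

theorem relabelLeg_mul_relabelLeg (x w a b : W) :
    (relabelLeg K x w * relabelLeg K a b + delta K w a • relabelLeg K x b :
        Module.End K (GradedDiagram σ W d →₀ K)) =
      relabelLeg K a b * relabelLeg K x w + delta K x b • relabelLeg K a w := by
  refine eq_of_comp_realize fun n kind hd => ?_
  rw [LinearMap.add_comp, LinearMap.add_comp, LinearMap.smul_comp, LinearMap.smul_comp,
    comp_mul_of_comp (relabelLeg_realize K n kind hd x w) (relabelLeg_realize K n kind hd a b),
    comp_mul_of_comp (relabelLeg_realize K n kind hd a b) (relabelLeg_realize K n kind hd x w),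
    relabelLeg_realize, relabelLeg_realize, ← LinearMap.comp_smul, ← LinearMap.comp_add,
    ← LinearMap.comp_smul, ← LinearMap.comp_add, rawRelabel_mul_rawRelabel]

theorem glueLegs_mul_relabelLeg (x y t b : W) :
    (glueLegs K x y * relabelLeg K t b : Module.End K (GradedDiagram σ W d →₀ K)) =
      relabelLeg K t b * glueLegs K x y +
        (delta K x b • glueLegs K t y + delta K y b • glueLegs K x t) := by
  refine eq_of_comp_realize fun n kind hd => ?_
  rw [LinearMap.add_comp, LinearMap.add_comp, LinearMap.smul_comp, LinearMap.smul_comp,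
    comp_mul_of_comp (glueLegs_realize K n kind hd x y) (relabelLeg_realize K n kind hd t b),
    comp_mul_of_comp (relabelLeg_realize K n kind hd t b) (glueLegs_realize K n kind hd x y),
    glueLegs_realize, glueLegs_realize, rawGlue_mul_rawRelabel, LinearMap.comp_add,
    LinearMap.comp_add, LinearMap.comp_smul, LinearMap.comp_smul]

theorem glueLegs_commute (x y z t : W) :
    Commute (glueLegs K x y : Module.End K (GradedDiagram σ W d →₀ K)) (glueLegs K z t) := by
  refine eq_of_comp_realize fun n kind hd => ?_
  rw [comp_mul_of_comp (glueLegs_realize K n kind hd x y) (glueLegs_realize K n kind hd z t),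
    comp_mul_of_comp (glueLegs_realize K n kind hd z t) (glueLegs_realize K n kind hd x y),
    (rawGlue_commute K x y z t).eq]

theorem glueLegs_comm (x y : W) :
    (glueLegs K x y : Module.End K (GradedDiagram σ W d →₀ K)) = glueLegs K y x := by
  refine eq_of_comp_realize fun n kind hd => ?_
  rw [glueLegs_realize, glueLegs_realize, rawGlue_comm]

/-- Relabeling `x` by `x` counts legs; all the gradings used for finiteness and nilpotency come from
this. -/
theorem relabelLeg_self_single (x : W) (Γ : GradedDiagram σ W d) :
    relabelLeg K x x (Finsupp.single Γ 1) = (Γ.1.legCount x : K) • Finsupp.single Γ 1 := by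
  classical
  have h : ∀ h : {h : Γ.1.HalfEdge // Γ.1.att h = Sum.inl x},
      (⟨Γ.1.relabel x x h.1 h.2, Γ.2⟩ : GradedDiagram σ W d) = Γ := by
    rintro ⟨h, hx⟩
    apply Subtype.ext
    obtain ⟨⟨n, kind, att, h1, h2⟩, h3⟩ := Γ
    simp only [StrutlessDiagram.relabel, StrutlessDiagram.mk.injEq, heq_eq_eq, true_and]
    exact Function.update_eq_self_iff.2 hx.symm
  rw [relabelLeg, Finsupp.linearCombination_single, one_smul]
  rw [StrutlessDiagram.legCount, Nat.cast_smul_eq_nsmul]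
  exact sum_eq_card_nsmul_of_forall_eq fun k => by rw [h k]

end Realize

theorem delta_comm {K : Type*} [Field K] {W : Type*} [DecidableEq W] (a b : W) :
    delta K a b = delta K b a := by
  simp only [delta, eq_comm]

/-! ### Commutators, and the algebra of struts -/

section Bracket

variable {K R ι : Type*} [Field K] [Ring R] [Algebra K R]

/-- The commutator of two elements of a ring. -/
def bracket (a b : R) : R := a * b - b * a

theorem mul_eq_add_bracket (a b : R) : a * b = b * a + bracket a b := by
  simp [bracket]

theorem bracket_eq_zero_iff {a b : R} : bracket a b = 0 ↔ Commute a b := sub_eq_zero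

theorem bracket_add (a b c : R) : bracket a (b + c) = bracket a b + bracket a c := by
  simp only [bracket]; noncomm_ring

theorem add_bracket (a b c : R) : bracket (a + b) c = bracket a c + bracket b c := by
  simp only [bracket]; noncomm_ring

theorem sub_bracket (a b c : R) : bracket (a - b) c = bracket a c - bracket b c := by
  simp only [bracket]; noncomm_ring

theorem bracket_smul (k : K) (a b : R) : bracket a (k • b) = k • bracket a b := by
  simp only [bracket, mul_smul_comm, smul_mul_assoc, smul_sub]

theorem smul_bracket (k : K) (a b : R) : bracket (k • a) b = k • bracket a b := by
  simp only [bracket, mul_smul_comm, smul_mul_assoc, smul_sub]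

theorem bracket_sum (s : Finset ι) (a : R) (f : ι → R) :
    bracket a (∑ i ∈ s, f i) = ∑ i ∈ s, bracket a (f i) := by
  simp only [bracket, Finset.mul_sum, Finset.sum_mul, Finset.sum_sub_distrib]

theorem sum_bracket (s : Finset ι) (a : R) (f : ι → R) :
    bracket (∑ i ∈ s, f i) a = ∑ i ∈ s, bracket (f i) a := by
  simp only [bracket, Finset.mul_sum, Finset.sum_mul, Finset.sum_sub_distrib]

theorem mul_bracket (a b c : R) : bracket (a * b) c = a * bracket b c + bracket a c * b := by
  simp only [bracket]; noncomm_ring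

theorem bracket_mul (a b c : R) : bracket a (b * c) = bracket a b * c + b * bracket a c := by
  simp only [bracket]; noncomm_ring

theorem bracket_bracket (a b c : R) :
    bracket (bracket a b) c = bracket a (bracket b c) - bracket b (bracket a c) := by
  simp only [bracket]; noncomm_ring

end Bracket

/-- Operators on a vector space behaving like the gluing and the relabeling of legs. -/
structure LegAction (K W V : Type*) [Field K] [DecidableEq W] [AddCommGroup V] [Module K V] where
  glue : W → W → Module.End K V
  relabel : W → W → Module.End K V
  relabel_bracket_relabel : ∀ x w a b, bracket (relabel x w) (relabel a b) =
    delta K x b • relabel a w - delta K w a • relabel x b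
  glue_bracket_relabel : ∀ x y t b, bracket (glue x y) (relabel t b) =
    delta K x b • glue t y + delta K y b • glue x t
  glue_bracket_glue : ∀ x y z t, bracket (glue x y) (glue z t) = 0
  glue_comm : ∀ x y, glue x y = glue y x

section Struts

variable {K W V : Type*} [Field K] [DecidableEq W] [AddCommGroup V] [Module K V]

/-- Apply an operator to all coefficients. -/
noncomputable def coeffwise (T : Module.End K V) : Module.End K ((Sym2 W →₀ ℕ) →₀ V) :=
  Finsupp.mapRange.linearMap T

/-- Multiplication by a collection of struts. -/
noncomputable def mulStruts (K : Type*) {W V : Type*} [Field K] [AddCommGroup V]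
    [Module K V] (n : Sym2 W →₀ ℕ) : Module.End K ((Sym2 W →₀ ℕ) →₀ V) :=
  Finsupp.lmapDomain V K (· + n)

/-- Multiplication by the strut with ends `a` and `b`. -/
noncomputable def mulStrut (K : Type*) {W V : Type*} [Field K] [AddCommGroup V]
    [Module K V] (a b : W) : Module.End K ((Sym2 W →₀ ℕ) →₀ V) :=
  mulStruts K (Finsupp.single s(a, b) 1)

/-- The sum of all ways of removing a strut with a chosen end `x` and other end `w`. -/
noncomputable def removeStrut (K : Type*) {W V : Type*} [Field K] [DecidableEq W] [AddCommGroup V]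
    [Module K V] (x w : W) : Module.End K ((Sym2 W →₀ ℕ) →₀ V) :=
  Finsupp.lsum K fun m : Sym2 W →₀ ℕ =>
    strutEnds m x w • Finsupp.lsingle (m - Finsupp.single s(x, w) 1)

@[simp] theorem coeffwise_single (T : Module.End K V) (m : Sym2 W →₀ ℕ) (u : V) :
    coeffwise T (Finsupp.single m u) = Finsupp.single m (T u) := by
  simp [coeffwise]

@[simp] theorem mulStruts_single (n m : Sym2 W →₀ ℕ) (u : V) :
    mulStruts K n (Finsupp.single m u) = Finsupp.single (m + n) u := by
  simp [mulStruts]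

@[simp] theorem mulStrut_single (a b : W) (m : Sym2 W →₀ ℕ) (u : V) :
    mulStrut K a b (Finsupp.single m u) = Finsupp.single (m + Finsupp.single s(a, b) 1) u := by
  simp [mulStrut]

@[simp] theorem removeStrut_single (x w : W) (m : Sym2 W →₀ ℕ) (u : V) :
    removeStrut K x w (Finsupp.single m u) =
      strutEnds m x w • Finsupp.single (m - Finsupp.single s(x, w) 1) u := by
  simp [removeStrut]

theorem end_ext {T U : Module.End K ((Sym2 W →₀ ℕ) →₀ V)}
    (h : ∀ m u, T (Finsupp.single m u) = U (Finsupp.single m u)) : T = U :=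
  Finsupp.lhom_ext h

theorem mulStruts_add (n n' : Sym2 W →₀ ℕ) :
    mulStruts K (V := V) (n + n') = mulStruts K n * mulStruts K n' :=
  end_ext fun m u => by simp [add_comm n n', add_assoc]

theorem mulStruts_zero : mulStruts K (W := W) (V := V) 0 = 1 :=
  end_ext fun m u => by simp

theorem mulStrut_comm (a b : W) : mulStrut K (V := V) a b = mulStrut K b a := by
  rw [mulStrut, mulStrut, Sym2.eq_swap]

theorem mulStruts_bracket_mulStruts (n n' : Sym2 W →₀ ℕ) :
    bracket (mulStruts K (V := V) n) (mulStruts K (V := V) n') = 0 := by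
  rw [bracket, ← mulStruts_add, ← mulStruts_add, add_comm, sub_self]

theorem mulStrut_bracket_mulStrut (a b c d : W) :
    bracket (mulStrut K (V := V) a b) (mulStrut K (V := V) c d) = 0 :=
  mulStruts_bracket_mulStruts _ _

theorem coeffwise_bracket_mulStruts (T : Module.End K V) (n : Sym2 W →₀ ℕ) :
    bracket (coeffwise (W := W) T) (mulStruts K (V := V) n) = 0 := by
  rw [bracket, sub_eq_zero]
  exact end_ext fun m u => by simp

theorem coeffwise_bracket_mulStrut (T : Module.End K V) (a b : W) :
    bracket (coeffwise (W := W) T) (mulStrut K (V := V) a b) = 0 :=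
  coeffwise_bracket_mulStruts _ _

/-- If all four labels agree, both products are one, in accordance with the two ends of the strut
`s(x, x)`. -/
theorem strutEnds_add_single (m : Sym2 W →₀ ℕ) (x w a b : W) :
    strutEnds (m + Finsupp.single s(a, b) 1) x w =
      strutEnds m x w + ((if x = a then 1 else 0) * (if w = b then 1 else 0) +
        (if x = b then 1 else 0) * (if w = a then 1 else 0)) := by
  simp only [strutEnds, Finsupp.add_apply, Finsupp.single_apply, Sym2.eq_iff]
  by_cases h1 : x = w
  · subst h1
    by_cases h2 : x = a <;> by_cases h3 : x = b <;> simp_all [eq_comm]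
    ring
  · by_cases h2 : x = a <;> by_cases h3 : x = b <;> by_cases h4 : w = a <;>
      by_cases h5 : w = b <;> simp_all [eq_comm]

theorem strutEnds_eq_zero {m : Sym2 W →₀ ℕ} {x w : W} (h : m s(x, w) = 0) :
    strutEnds m x w = 0 := by
  unfold strutEnds
  split_ifs with hx
  · subst hx; simp [h]
  · exact h

theorem le_strutEnds (m : Sym2 W →₀ ℕ) (x w : W) : m s(x, w) ≤ strutEnds m x w := by
  unfold strutEnds
  split_ifs with hx
  · subst hx; omega
  · exact le_rfl

/-- The canonical commutation relation: the struts are polynomial variables and `removeStrut` is the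
partial derivative, doubled for a strut with equal ends. -/
theorem removeStrut_bracket_mulStrut (x w a b : W) :
    bracket (removeStrut K (V := V) x w) (mulStrut K (V := V) a b) =
      (delta K x a * delta K w b + delta K x b * delta K w a) • 1 := by
  refine end_ext fun m u => ?_
  rw [bracket]
  simp only [LinearMap.sub_apply, Module.End.mul_apply, mulStrut_single, removeStrut_single,
    map_nsmul, LinearMap.smul_apply, Module.End.one_apply, strutEnds_add_single]
  -- The truncated subtraction of exponents is harmless, since the factor `strutEnds m x w` vanishes
  -- when there is no strut to remove.
  have h1 : strutEnds m x w • Finsupp.single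
        (m + Finsupp.single s(a, b) 1 - Finsupp.single s(x, w) 1) u =
      strutEnds m x w • Finsupp.single
        (m - Finsupp.single s(x, w) 1 + Finsupp.single s(a, b) 1) u := by
    by_cases h : m s(x, w) = 0
    · rw [strutEnds_eq_zero h, zero_smul, zero_smul]
    · rw [tsub_add_eq_add_tsub (Finsupp.single_le_iff.2 (Nat.one_le_iff_ne_zero.2 h))]
  rw [add_smul, h1, add_sub_cancel_left]
  by_cases h : s(x, w) = s(a, b)
  · rw [h, add_tsub_cancel_right, ← Nat.cast_smul_eq_nsmul K]
    congr 1
    simp only [delta]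
    push_cast
    rfl
  · have h' : ¬ (x = a ∧ w = b) ∧ ¬ (x = b ∧ w = a) := by
      rw [← not_or]; exact fun hh => h (Sym2.eq_iff.2 hh)
    have h2 : ((if x = a then 1 else 0) * (if w = b then 1 else 0) +
        (if x = b then 1 else 0) * (if w = a then 1 else 0)) = (0 : ℕ) := by
      obtain ⟨h3, h4⟩ := h'
      split_ifs <;> simp_all
    have h3 : delta K x a * delta K w b + delta K x b * delta K w a = 0 := by
      obtain ⟨h3, h4⟩ := h'
      simp only [delta]
      split_ifs <;> simp_all
    rw [h2, h3, zero_smul, zero_smul]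

/-- Multiplication by struts produces all diagrams from the strutless ones, so an operator commuting
with it is determined by its values on the latter. This reduces every identity between `join` and
`moveLeg` to one about legs of strutless diagrams. -/
theorem eq_zero_of_bracket_mulStrut {C : Module.End K ((Sym2 W →₀ ℕ) →₀ V)}
    (h : ∀ a b, bracket C (mulStrut K (V := V) a b) = 0) (h0 : ∀ u, C (Finsupp.single 0 u) = 0) : C = 0 := by
  have key : ∀ n : Sym2 W →₀ ℕ, Commute C (mulStruts K n) := fun n => by
    induction n using Finsupp.induction_linear with
    | zero => rw [mulStruts_zero]; exact Commute.one_right C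
    | add f g hf hg => rw [mulStruts_add]; exact hf.mul_right hg
    | single e k =>
      induction k with
      | zero => rw [Finsupp.single_zero, mulStruts_zero]; exact Commute.one_right C
      | succ k ih =>
        rw [Finsupp.single_add, mulStruts_add]
        refine ih.mul_right ?_
        induction e using Sym2.ind with
        | _ a b => exact sub_eq_zero.1 (h a b)
  refine end_ext fun m u => ?_
  have h1 := LinearMap.congr_fun (key m).eq (Finsupp.single 0 u)
  simpa [h0] using h1

end Struts

/-! ### Gluing and relabeling in the presence of struts -/

namespace LegAction

variable {K W V : Type*} [Field K] [Fintype W] [DecidableEq W] [AddCommGroup V] [Module K V]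
  (ρ : LegAction K W V)

/-- The sum of all ways of replacing the label `x` of one leg or end of a strut by `w`. -/
noncomputable def moveLeg (x w : W) : Module.End K ((Sym2 W →₀ ℕ) →₀ V) :=
  coeffwise (ρ.relabel x w) + ∑ w' : W, mulStrut K w w' * removeStrut K x w'

/-- The sum of all ways of gluing a leg or end of a strut labeled `x` to another one labeled
`y`. -/
noncomputable def join (x y : W) : Module.End K ((Sym2 W →₀ ℕ) →₀ V) :=
  coeffwise (ρ.glue x y) + ∑ w : W, coeffwise (ρ.relabel x w) * removeStrut K y w +
    ∑ w : W, coeffwise (ρ.relabel y w) * removeStrut K x w +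
    ∑ w : W, ∑ w' : W, mulStrut K w w' * (removeStrut K y w' * removeStrut K x w)

theorem moveLeg_bracket_mulStrut (x w a b : W) :
    bracket (ρ.moveLeg x w) (mulStrut K (V := V) a b) = delta K x a • mulStrut K w b + delta K x b • mulStrut K w a := by
  simp only [moveLeg, add_bracket, sum_bracket, coeffwise_bracket_mulStrut, mul_bracket,
    removeStrut_bracket_mulStrut, mulStrut_bracket_mulStrut, zero_add, zero_mul, add_zero]
  simp only [delta, mul_smul_comm, mul_one, add_smul, Finset.sum_add_distrib, mul_ite, ite_smul,
    mul_add, one_smul, zero_smul, mul_zero, Finset.sum_ite_irrel, Finset.sum_const_zero,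
    Finset.sum_ite_eq', Finset.mem_univ, if_true]

/-- A second order operator has a first order commutator with a strut. The double contraction, which
would give a constant, is absent because gluing both ends of a single strut is not allowed. -/
theorem join_bracket_mulStrut (x y a b : W) :
    bracket (ρ.join x y) (mulStrut K a b) = delta K x a • ρ.moveLeg y b + delta K x b • ρ.moveLeg y a +
      (delta K y a • ρ.moveLeg x b + delta K y b • ρ.moveLeg x a) := by
  simp only [join, moveLeg, add_bracket, sum_bracket, coeffwise_bracket_mulStrut, mul_bracket,
    removeStrut_bracket_mulStrut, mulStrut_bracket_mulStrut, zero_add, zero_mul, add_zero]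
  simp only [delta, mul_smul_comm, smul_mul_assoc, one_mul, mul_one, add_smul,
    Finset.sum_add_distrib, mul_ite, ite_mul, Finset.sum_ite_irrel, Finset.sum_const_zero,
    ite_smul, zero_smul, one_smul, mul_zero, zero_mul, Finset.sum_ite_eq', Finset.mem_univ, if_true, mul_add,
    add_mul]
  simp only [mulStrut_comm (K := K) (V := V) _ b, mulStrut_comm (K := K) (V := V) _ a,
    Finset.sum_add_distrib, Finset.sum_ite_irrel, Finset.sum_const_zero, Finset.sum_ite_eq', Finset.mem_univ, if_true]
  split_ifs <;> abel

theorem moveLeg_single_zero (x w : W) (u : V) :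
    ρ.moveLeg x w (Finsupp.single 0 u) = Finsupp.single 0 (ρ.relabel x w u) := by
  simp [moveLeg, strutEnds]

theorem join_single_zero (x y : W) (u : V) :
    ρ.join x y (Finsupp.single 0 u) = Finsupp.single 0 (ρ.glue x y u) := by
  simp [join, strutEnds]

theorem join_comm (x y : W) : ρ.join x y = ρ.join y x := by
  rw [← sub_eq_zero]
  refine eq_zero_of_bracket_mulStrut (fun a b => ?_) fun u => ?_
  · rw [sub_bracket, join_bracket_mulStrut, join_bracket_mulStrut]
    abel
  · rw [LinearMap.sub_apply, join_single_zero, join_single_zero, ρ.glue_comm, sub_self]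

/-- By the Jacobi identity, the bracket of both sides with a strut only involves brackets already
known; on strutless diagrams the claim is an axiom of `LegAction`. The relations for `join` below
follow in the same way. -/
theorem moveLeg_bracket_moveLeg (x w a b : W) :
    bracket (ρ.moveLeg x w) (ρ.moveLeg a b) =
      delta K x b • ρ.moveLeg a w - delta K w a • ρ.moveLeg x b := by
  rw [← sub_eq_zero]
  refine eq_zero_of_bracket_mulStrut (fun c d => ?_) fun u => ?_
  · simp only [sub_bracket, smul_bracket, bracket_bracket, moveLeg_bracket_mulStrut, bracket_add,
      bracket_smul]
    simp only [mulStrut_comm (K := K) (V := V) c, mulStrut_comm (K := K) (V := V) d,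
      mulStrut_comm (K := K) (V := V) b w]
    simp only [delta_comm (K := K)]
    module
  · have h := LinearMap.congr_fun (ρ.relabel_bracket_relabel x w a b) u
    simp only [bracket, LinearMap.sub_apply, Module.End.mul_apply, LinearMap.smul_apply,
      moveLeg_single_zero] at h ⊢
    simp only [Finsupp.smul_single, ← Finsupp.single_sub, h, sub_self, Finsupp.single_zero]

theorem join_bracket_moveLeg (x y t b : W) :
    bracket (ρ.join x y) (ρ.moveLeg t b) =
      delta K x b • ρ.join t y + delta K y b • ρ.join x t := by
  rw [← sub_eq_zero]
  refine eq_zero_of_bracket_mulStrut (fun c d => ?_) fun u => ?_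
  · simp only [sub_bracket, add_bracket, smul_bracket, bracket_bracket, moveLeg_bracket_mulStrut,
      bracket_add, bracket_smul, join_bracket_mulStrut, moveLeg_bracket_moveLeg]
    simp only [delta_comm (K := K)]
    module
  · have h := LinearMap.congr_fun (ρ.glue_bracket_relabel x y t b) u
    simp only [bracket, LinearMap.sub_apply, LinearMap.add_apply, Module.End.mul_apply,
      LinearMap.smul_apply, moveLeg_single_zero, join_single_zero] at h ⊢
    simp only [Finsupp.smul_single, ← Finsupp.single_sub, ← Finsupp.single_add, h, sub_self,
      Finsupp.single_zero]

theorem join_bracket_join (x y z t : W) : bracket (ρ.join x y) (ρ.join z t) = 0 := by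
  refine eq_zero_of_bracket_mulStrut (fun c d => ?_) fun u => ?_
  · simp only [bracket_bracket, bracket_add, bracket_smul, join_bracket_mulStrut,
      join_bracket_moveLeg]
    simp only [delta_comm (K := K), ρ.join_comm t y, ρ.join_comm z y,
      ρ.join_comm z x, ρ.join_comm t x]
    module
  · have h := LinearMap.congr_fun (ρ.glue_bracket_glue x y z t) u
    simp only [bracket, LinearMap.sub_apply, Module.End.mul_apply, join_single_zero] at h ⊢
    rw [← Finsupp.single_sub, h, LinearMap.zero_apply, Finsupp.single_zero]

end LegAction

/-! ### The leg action on diagrams modulo relations -/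

namespace InternalRelations

variable {K : Type*} [Field K] {σ : VertexSignature} {W : Type*} [DecidableEq W]
  (R : InternalRelations K σ W)

theorem space_end_ext {d : ℕ} {T U : Module.End K (R.Space d)}
    (h : ∀ Γ : GradedDiagram σ W d, T (Submodule.Quotient.mk (Finsupp.single Γ 1)) =
      U (Submodule.Quotient.mk (Finsupp.single Γ 1))) : T = U :=
  Submodule.linearMap_qext _ (Finsupp.lhom_ext' fun Γ => LinearMap.ext_ring (h Γ))

theorem relabel_mk (d : ℕ) (x w : W) (r : GradedDiagram σ W d →₀ K) :
    R.relabel d x w (Submodule.Quotient.mk r) = Submodule.Quotient.mk (relabelLeg K x w r) :=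
  Submodule.mapQ_apply ..

theorem glue_mk (d : ℕ) (x w : W) (r : GradedDiagram σ W d →₀ K) :
    R.glue d x w (Submodule.Quotient.mk r) = Submodule.Quotient.mk (glueLegs K x w r) :=
  Submodule.mapQ_apply ..

theorem kill_mk (d : ℕ) (X : Finset W) (r : GradedDiagram σ W d →₀ K) :
    R.kill d X (Submodule.Quotient.mk r) = Submodule.Quotient.mk (killLegs K X r) :=
  Submodule.mapQ_apply ..

/-- Gluing and relabeling legs of strutless diagrams. -/
noncomputable def legAction (d : ℕ) : LegAction K W (R.Space d) where
  glue := R.glue d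
  relabel := R.relabel d
  relabel_bracket_relabel x w a b := R.space_end_ext fun Γ => by
    have h := congrArg (Submodule.Quotient.mk (p := R.rel d)) (LinearMap.congr_fun
      (relabelLeg_mul_relabelLeg K (σ := σ) (d := d) x w a b) (Finsupp.single Γ 1))
    simp only [LinearMap.add_apply, Module.End.mul_apply, LinearMap.smul_apply,
      Submodule.Quotient.mk_add, Submodule.Quotient.mk_smul, ← relabel_mk] at h
    simp only [bracket, LinearMap.sub_apply, Module.End.mul_apply, LinearMap.smul_apply]
    rw [sub_eq_sub_iff_add_eq_add, h, add_comm]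
  glue_bracket_relabel x y t b := R.space_end_ext fun Γ => by
    have h := congrArg (Submodule.Quotient.mk (p := R.rel d)) (LinearMap.congr_fun
      (glueLegs_mul_relabelLeg K (σ := σ) (d := d) x y t b) (Finsupp.single Γ 1))
    simp only [LinearMap.add_apply, Module.End.mul_apply, LinearMap.smul_apply,
      Submodule.Quotient.mk_add, Submodule.Quotient.mk_smul, ← relabel_mk, ← glue_mk] at h
    simp only [bracket, LinearMap.sub_apply, Module.End.mul_apply, LinearMap.smul_apply,
      LinearMap.add_apply]
    rw [h, add_sub_cancel_left]
  glue_bracket_glue x y z t := R.space_end_ext fun Γ => by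
    have h := congrArg (Submodule.Quotient.mk (p := R.rel d)) (LinearMap.congr_fun
      (glueLegs_commute K (σ := σ) (d := d) x y z t).eq (Finsupp.single Γ 1))
    simp only [Module.End.mul_apply, ← glue_mk] at h
    simp only [bracket, LinearMap.sub_apply, Module.End.mul_apply, LinearMap.zero_apply]
    rw [h, sub_self]
  glue_comm x y := by
    refine R.space_end_ext fun Γ => ?_
    rw [glue_mk, glue_mk, glueLegs_comm]

/-- Two consecutive removals pick two different struts, which accounts for the decreased exponent in
the last coefficient of `strutAct`. From here on only `join` is used. -/
theorem strutAct_eq_join [Fintype W] (d : ℕ) (x y : W) :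
    R.strutAct d x y = (R.legAction d).join x y := by
  refine end_ext fun m u => ?_
  have h1 : ∀ w w' : W, mulStrut K w w' (removeStrut K y w' (removeStrut K x w
      (Finsupp.single m u))) = (strutEnds m x w * strutEnds (m - Finsupp.single s(x, w) 1) y w') •
        Finsupp.single (m - Finsupp.single s(x, w) 1 - Finsupp.single s(y, w') 1
          + Finsupp.single s(w, w') 1) u := fun w w' => by
    simp only [removeStrut_single, map_nsmul, mulStrut_single, mul_smul]
  simp only [strutAct, Finsupp.coe_lsum, LegAction.join, LinearMap.add_apply, LinearMap.sum_apply,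
    Module.End.mul_apply, h1]
  simp [legAction, LinearMap.sum_apply]

end InternalRelations

/-! ### Exponentials of locally nilpotent operators -/

section LocallyNilpotent

variable {K M N : Type*} [Field K] [CharZero K] [AddCommGroup M] [Module K M] [AddCommGroup N]
  [Module K N]

/-- Every vector is killed by a power of the operator. -/
def IsLocNil (T : Module.End K M) : Prop := ∀ f, ∃ n : ℕ, (T ^ n) f = 0

/-- The divided powers of an operator. -/
noncomputable def dpow (T : Module.End K M) (k : ℕ) : Module.End K M := (k.factorial : K)⁻¹ • T ^ k

theorem dpow_zero (T : Module.End K M) : dpow T 0 = 1 := by simp [dpow]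

theorem mul_dpow (T : Module.End K M) (k : ℕ) : T * dpow T k = ((k : K) + 1) • dpow T (k + 1) := by
  rw [dpow, dpow, mul_smul_comm, ← pow_succ', smul_smul, Nat.factorial_succ]
  congr 1
  have : (k.factorial : K) ≠ 0 := Nat.cast_ne_zero.2 k.factorial_ne_zero
  have : (k : K) + 1 ≠ 0 := Nat.cast_add_one_ne_zero k
  push_cast
  field_simp

theorem dpow_mul (T : Module.End K M) (k : ℕ) : dpow T k * T = ((k : K) + 1) • dpow T (k + 1) := by
  rw [← mul_dpow, dpow, smul_mul_assoc, mul_smul_comm, ← pow_succ, ← pow_succ']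

theorem pow_apply_eq_zero_of_le {T : Module.End K M} {f : M} {n k : ℕ} (h : (T ^ n) f = 0)
    (hk : n ≤ k) : (T ^ k) f = 0 := by
  obtain ⟨l, rfl⟩ := Nat.exists_eq_add_of_le' hk
  rw [pow_add, Module.End.mul_apply, h, map_zero]

theorem dpow_apply_eq_zero_of_le {T : Module.End K M} {f : M} {n k : ℕ} (h : (T ^ n) f = 0)
    (hk : n ≤ k) : dpow T k f = 0 := by
  rw [dpow, LinearMap.smul_apply, pow_apply_eq_zero_of_le h hk, smul_zero]

theorem finsum_dpow_eq_sum {T : Module.End K M} {f : M} {n : ℕ} (h : (T ^ n) f = 0) :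
    ∑ᶠ k, dpow T k f = ∑ k ∈ Finset.range n, dpow T k f := by
  refine finsum_eq_sum_of_support_subset _ fun k hk => ?_
  by_contra hn
  exact hk (dpow_apply_eq_zero_of_le h (by simpa using hn))

theorem IsLocNil.exists_pow_eq_zero {T : Module.End K M} (hT : IsLocNil T) (s : Finset M) :
    ∃ n : ℕ, ∀ f ∈ s, (T ^ n) f = 0 := by
  choose n hn using hT
  exact ⟨s.sup n, fun f hf => pow_apply_eq_zero_of_le (hn f) (Finset.le_sup hf)⟩

open Classical in
/-- The exponential of a locally nilpotent operator. -/
noncomputable def lexp (T : Module.End K M) : Module.End K M :=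
  if hT : IsLocNil T then
    { toFun := fun f => ∑ᶠ k, dpow T k f
      map_add' := fun f g => by
        obtain ⟨n, hn⟩ := hT.exists_pow_eq_zero {f, g, f + g}
        rw [finsum_dpow_eq_sum (hn f (by simp)), finsum_dpow_eq_sum (hn g (by simp)),
          finsum_dpow_eq_sum (hn (f + g) (by simp)), ← Finset.sum_add_distrib]
        exact Finset.sum_congr rfl fun k _ => map_add _ _ _
      map_smul' := fun c f => by
        obtain ⟨n, hn⟩ := hT f
        have hn' : (T ^ n) (c • f) = 0 := by rw [map_smul, hn, smul_zero]
        rw [finsum_dpow_eq_sum hn, finsum_dpow_eq_sum hn', RingHom.id_apply, Finset.smul_sum]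
        exact Finset.sum_congr rfl fun k _ => map_smul _ _ _ }
  else 0

theorem lexp_apply {T : Module.End K M} (hT : IsLocNil T) (f : M) :
    lexp T f = ∑ᶠ k, dpow T k f := by
  rw [lexp, dif_pos hT]; rfl

theorem lexp_apply_eq_sum {T : Module.End K M} (hT : IsLocNil T) {f : M} {n : ℕ}
    (h : (T ^ n) f = 0) : lexp T f = ∑ k ∈ Finset.range n, dpow T k f := by
  rw [lexp_apply hT, finsum_dpow_eq_sum h]

theorem comp_lexp {T : Module.End K M} {U : Module.End K N} (hT : IsLocNil T) (hU : IsLocNil U)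
    {A : M →ₗ[K] N} (h : A ∘ₗ T = U ∘ₗ A) : A ∘ₗ lexp T = lexp U ∘ₗ A := by
  have hp : ∀ k f, A ((T ^ k) f) = (U ^ k) (A f) := fun k => by
    induction k with
    | zero => simp
    | succ k ih =>
      intro f
      rw [pow_succ, Module.End.mul_apply, ih, pow_succ, Module.End.mul_apply]
      exact congrArg _ (LinearMap.congr_fun h f)
  ext f
  obtain ⟨n, hn⟩ := hT f
  rw [LinearMap.comp_apply, LinearMap.comp_apply, lexp_apply_eq_sum hT hn,
    lexp_apply_eq_sum hU (f := A f) (n := n) (by rw [← hp, hn, map_zero]), map_sum]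
  refine Finset.sum_congr rfl fun k _ => ?_
  rw [dpow, dpow, LinearMap.smul_apply, LinearMap.smul_apply, map_smul, hp]

theorem commute_lexp {T A : Module.End K M} (hT : IsLocNil T) (h : Commute A T) :
    Commute A (lexp T) := comp_lexp hT hT h.eq

/-- The iterated commutators with `T` stop after two steps, so `exp(-T) a₀ exp(T) = a₀ + a₁ + a₂/2`.
This is the homogeneous part of that formula, which needs no convergence. -/
theorem mul_dpow_of_second_order {T a₀ a₁ a₂ : Module.End K M} (h₀ : a₀ * T = T * a₀ + a₁)
    (h₁ : a₁ * T = T * a₁ + a₂) (h₂ : a₂ * T = T * a₂) (k : ℕ) :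
    a₀ * dpow T (k + 2) = dpow T (k + 2) * a₀ + dpow T (k + 1) * a₁ +
      (2 : K)⁻¹ • (dpow T k * a₂) := by
  have c₂ : ∀ k : ℕ, a₂ * T ^ k = T ^ k * a₂ := fun k => (Commute.pow_right (h₂ : Commute a₂ T) k).eq
  have c₁ : ∀ k : ℕ, a₁ * T ^ (k + 1) = T ^ (k + 1) * a₁ + ((k : K) + 1) • (T ^ k * a₂) := fun k => by
    induction k with
    | zero => simp [h₁]
    | succ k ih =>
      rw [pow_succ T (k + 1), ← mul_assoc, ih, add_mul, mul_assoc, h₁, smul_mul_assoc, mul_assoc,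
        h₂, mul_add, ← mul_assoc, ← mul_assoc, ← pow_succ, ← pow_succ]
      push_cast
      module
  have c₀ : ∀ k : ℕ, a₀ * T ^ (k + 2) = T ^ (k + 2) * a₀ + ((k : K) + 2) • (T ^ (k + 1) * a₁) +
      (((k : K) + 2) * ((k : K) + 1) / 2) • (T ^ k * a₂) := fun k => by
    induction k with
    | zero =>
      rw [pow_succ, ← mul_assoc, zero_add, pow_one, h₀, add_mul, mul_assoc, h₀, h₁, mul_add,
        ← mul_assoc]
      simp only [pow_zero, one_mul, Nat.cast_zero]
      module
    | succ k ih =>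
      rw [pow_succ T (k + 2), ← mul_assoc, ih, add_mul, add_mul, mul_assoc, h₀, smul_mul_assoc,
        mul_assoc, h₁, smul_mul_assoc, mul_assoc, h₂, mul_add, mul_add, ← mul_assoc, ← mul_assoc,
        ← mul_assoc, ← pow_succ, ← pow_succ, ← pow_succ]
      push_cast
      module
  have hk : (k.factorial : K) ≠ 0 := Nat.cast_ne_zero.2 k.factorial_ne_zero
  have hk1 : (k : K) + 1 ≠ 0 := Nat.cast_add_one_ne_zero k
  have hk2 : (k : K) + 1 + 1 ≠ 0 := by
    have := Nat.cast_add_one_ne_zero (R := K) (k + 1)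
    push_cast at this
    exact this
  simp only [dpow, mul_smul_comm, smul_mul_assoc, c₀, smul_add, smul_smul, Nat.factorial_succ]
  push_cast
  refine congrArg₂ _ (congrArg₂ _ rfl (congrArg (· • _) ?_)) (congrArg (· • _) ?_)
  · field_simp
    ring
  · field_simp
    ring

theorem mul_lexp_of_second_order {T a₀ a₁ a₂ : Module.End K M} (hT : IsLocNil T)
    (h₀ : a₀ * T = T * a₀ + a₁) (h₁ : a₁ * T = T * a₁ + a₂) (h₂ : a₂ * T = T * a₂) :
    a₀ * lexp T = lexp T * (a₀ + a₁ + (2 : K)⁻¹ • a₂) := by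
  classical
  ext f
  obtain ⟨n, hn⟩ := hT.exists_pow_eq_zero {f, a₀ f, a₁ f, a₂ f}
  have e : ∀ g ∈ ({f, a₀ f, a₁ f, a₂ f} : Set M), ∀ k, n ≤ k →
      lexp T g = ∑ i ∈ Finset.range k, dpow T i g := fun g hg k hk =>
    lexp_apply_eq_sum hT (pow_apply_eq_zero_of_le (hn g (by simpa using hg)) hk)
  simp only [Module.End.mul_apply, LinearMap.add_apply, LinearMap.smul_apply, map_add, map_smul]
  -- The truncations `n + 2`, `n + 1` and `n` are chosen so that, once the lowest terms are split
  -- off, all sums run over the same range.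
  rw [e f (by simp) (n + 2) (by omega), e (a₀ f) (by simp) (n + 2) (by omega),
    e (a₁ f) (by simp) (n + 1) (by omega), e (a₂ f) (by simp) n le_rfl, map_sum,
    Finset.sum_range_succ', Finset.sum_range_succ', Finset.sum_range_succ',
    Finset.sum_range_succ', Finset.sum_range_succ']
  have hs : ∀ k, a₀ (dpow T (k + 1 + 1) f) = dpow T (k + 1 + 1) (a₀ f) + dpow T (k + 1) (a₁ f) +
      (2 : K)⁻¹ • dpow T k (a₂ f) := fun k => by
    simpa using LinearMap.congr_fun (mul_dpow_of_second_order h₀ h₁ h₂ k) f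
  have h1 : a₀ (dpow T (0 + 1) f) = dpow T (0 + 1) (a₀ f) + a₁ f := by
    simpa [dpow] using LinearMap.congr_fun h₀ f
  simp only [hs, h1, Finset.sum_add_distrib, ← Finset.smul_sum, dpow_zero, Module.End.one_apply]
  abel

/-- This is `exp(T) q exp(-T) = q + r`, written without inverses; the second commutator already
vanishes. -/
theorem lexp_mul_of_bracket {T q r : Module.End K M} (hT : IsLocNil T) (h : bracket T q = r)
    (hr : Commute T r) : lexp T * q = (q + r) * lexp T := by
  have h₀ : q * T = T * q + -r := by rw [← h, bracket]; abel
  have h₁ : -r * T = T * -r + 0 := by rw [neg_mul, mul_neg, hr.eq, add_zero]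
  have key := mul_lexp_of_second_order hT h₀ h₁ (by simp)
  rw [smul_zero, add_zero, mul_add, mul_neg] at key
  rw [add_mul, key, (commute_lexp hT hr.symm).eq]
  abel

theorem dpow_add {T U : Module.End K M} (h : Commute T U) (n : ℕ) :
    dpow (T + U) n = ∑ p ∈ Finset.HasAntidiagonal.antidiagonal n, dpow T p.1 * dpow U p.2 := by
  rw [dpow, h.add_pow', Finset.smul_sum]
  refine Finset.sum_congr rfl fun p hp => ?_
  rw [← Finset.HasAntidiagonal.mem_antidiagonal.1 hp, dpow, dpow, smul_mul_smul_comm, ← Nat.cast_smul_eq_nsmul K,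
    smul_smul]
  congr 1
  have h1 : (p.1.factorial : K) ≠ 0 := Nat.cast_ne_zero.2 (Nat.factorial_ne_zero _)
  have h2 : (p.2.factorial : K) ≠ 0 := Nat.cast_ne_zero.2 (Nat.factorial_ne_zero _)
  have h3 : ((p.1 + p.2).factorial : K) ≠ 0 := Nat.cast_ne_zero.2 (Nat.factorial_ne_zero _)
  have h4 := congrArg (Nat.cast (R := K)) (Nat.add_choose_mul_factorial_mul_factorial p.1 p.2)
  rw [← Nat.choose_symm_add] at h4
  push_cast at h4
  field_simp
  linear_combination h4

theorem lexp_add {T U : Module.End K M} (hT : IsLocNil T) (hU : IsLocNil U)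
    (hTU : IsLocNil (T + U)) (h : Commute T U) : lexp (T + U) = lexp T * lexp U := by
  classical
  ext f
  obtain ⟨n, hn⟩ := hU f
  -- One exponent that works for all the nonzero `dpow U j f` confines the double sum to a finite
  -- rectangle.
  obtain ⟨l, hl⟩ := hT.exists_pow_eq_zero ((Finset.range n).image fun j => dpow U j f)
  obtain ⟨p, hp⟩ := hTU f
  have hl' : ∀ j i, l ≤ i → dpow T i (dpow U j f) = 0 := fun j i hi => by
    by_cases hj : j < n
    · exact dpow_apply_eq_zero_of_le
        (hl _ (Finset.mem_image_of_mem _ (Finset.mem_range.2 hj))) hi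
    · rw [dpow_apply_eq_zero_of_le hn (not_lt.1 hj), map_zero]
  have hn' : ∀ j i, n ≤ j → dpow T i (dpow U j f) = 0 := fun j i hj => by
    rw [dpow_apply_eq_zero_of_le hn hj, map_zero]
  rw [lexp_apply_eq_sum hTU (pow_apply_eq_zero_of_le hp (le_max_left p (l + n))),
    Module.End.mul_apply, lexp_apply_eq_sum hU hn, map_sum]
  have e : ∀ j ∈ Finset.range n, lexp T (dpow U j f) =
      ∑ i ∈ Finset.range l, dpow T i (dpow U j f) := fun j hj =>
    lexp_apply_eq_sum hT (hl _ (Finset.mem_image_of_mem _ hj))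
  rw [Finset.sum_congr rfl e, ← Finset.sum_product' (f := fun j i => dpow T i (dpow U j f))]
  simp only [dpow_add h, LinearMap.sum_apply, Module.End.mul_apply]
  rw [Finset.sum_sigma']
  symm
  refine Finset.sum_of_injOn (fun x => ⟨x.1 + x.2, (x.2, x.1)⟩) ?_ ?_ ?_ ?_
  · rintro ⟨a, b⟩ _ ⟨a', b'⟩ _ hab
    simp only [Sigma.mk.injEq] at hab
    have := eq_of_heq hab.2
    simp_all
  · rintro ⟨a, b⟩ hab
    simp only [Finset.coe_product, Finset.coe_range, Set.mem_prod, Set.mem_Iio, Finset.coe_sigma,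
      Set.mem_sigma_iff, Finset.mem_coe, Finset.HasAntidiagonal.mem_antidiagonal] at hab ⊢
    exact ⟨lt_of_lt_of_le (by omega) (le_max_right p (l + n)), add_comm _ _⟩
  · rintro ⟨c, a, b⟩ hab hnot
    by_contra hne
    refine hnot ⟨(b, a), ?_, ?_⟩
    · simp only [Finset.coe_product, Finset.coe_range, Set.mem_prod, Set.mem_Iio]
      constructor
      · by_contra hb; exact hne (hn' _ _ (not_lt.1 hb))
      · by_contra ha; exact hne (hl' _ _ (not_lt.1 ha))
    · have := (Finset.HasAntidiagonal.mem_antidiagonal.1 (Finset.mem_sigma.1 hab).2)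
      simp only at this ⊢
      subst this
      rw [add_comm]
  · rintro ⟨a, b⟩ _
    rfl

end LocallyNilpotent

/-! ### Gradings by natural numbers -/

section NatDiagonal

variable {K M N : Type*} [Field K] [CharZero K] [AddCommGroup M] [Module K M] [AddCommGroup N]
  [Module K N]

/-- The operator is diagonalizable with eigenvalues in the set `s` of natural numbers. -/
def IsNatDiag (s : Set ℕ) (D : Module.End K M) : Prop :=
  ⨆ n ∈ s, Module.End.eigenspace D (n : K) = ⊤

theorem IsNatDiag.of_span {s : Set ℕ} {D : Module.End K M} {b : Set M}
    (hb : Submodule.span K b = ⊤) (h : ∀ f ∈ b, ∃ n ∈ s, D f = (n : K) • f) : IsNatDiag s D := by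
  rw [IsNatDiag, ← top_le_iff, ← hb, Submodule.span_le]
  intro f hf
  obtain ⟨n, hn, hf⟩ := h f hf
  exact Submodule.mem_iSup_of_mem n (Submodule.mem_iSup_of_mem hn (Module.End.mem_eigenspace_iff.2 hf))

theorem IsNatDiag.ext {s : Set ℕ} {D : Module.End K M} (hD : IsNatDiag s D) {A B : M →ₗ[K] N}
    (h : ∀ n ∈ s, ∀ f, D f = (n : K) • f → A f = B f) : A = B := by
  rw [← LinearMap.eqLocus_eq_top, ← top_le_iff, ← hD]
  refine iSup₂_le fun n hn f hf => h n hn f (Module.End.mem_eigenspace_iff.1 hf)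

/-- Eigenspaces are independent, and those with eigenvalue in `s` already fill the space. -/
theorem IsNatDiag.eq_zero {s : Set ℕ} {D : Module.End K M} (hD : IsNatDiag s D) {c : K}
    (hc : ∀ n ∈ s, (n : K) ≠ c) {f : M} (hf : D f = c • f) : f = 0 := by
  have h := Module.End.eigenspaces_iSupIndep D c
  have h1 : (⊤ : Submodule K M) ≤ ⨆ (j) (_ : j ≠ c), Module.End.eigenspace D j := by
    rw [← hD]
    exact iSup₂_le fun n hn => le_iSup₂_of_le (n : K) (hc n hn) le_rfl
  rw [top_le_iff.1 h1, disjoint_top] at h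
  simpa [h] using Module.End.mem_eigenspace_iff.2 hf

/-- `T` lowers the degree by `j`, and no vector except zero has negative degree. -/
theorem IsNatDiag.isLocNil {D T : Module.End K M} (hD : IsNatDiag Set.univ D) {j : ℕ} (hj : j ≠ 0)
    (h : bracket D T = -(j : K) • T) : IsLocNil T := by
  have hk : ∀ k : ℕ, bracket D (T ^ k) = -((k * j : ℕ) : K) • T ^ k := fun k => by
    induction k with
    | zero => simp [bracket]
    | succ k ih =>
      rw [pow_succ, bracket_mul, ih, h, smul_mul_assoc, mul_smul_comm, ← add_smul]
      congr 1
      push_cast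
      ring
  -- The vectors killed by some power of `T` form a submodule, so it suffices to treat eigenvectors
  -- of `D`.
  have key : ⊤ ≤ Module.End.maxGenEigenspace T (0 : K) := by
    rw [← hD]
    refine iSup₂_le fun n _ f hf => ?_
    rw [Module.End.mem_maxGenEigenspace]
    refine ⟨n + 1, ?_⟩
    rw [zero_smul, sub_zero]
    rw [Module.End.mem_eigenspace_iff] at hf
    refine hD.eq_zero (c := (n : K) - ((n + 1) * j : ℕ)) (fun p _ hp => ?_) ?_
    · rw [eq_sub_iff_add_eq, ← Nat.cast_add, Nat.cast_inj] at hp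
      have := Nat.le_mul_of_pos_right (n + 1) (Nat.pos_of_ne_zero hj)
      omega
    · have h1 := LinearMap.congr_fun (hk (n + 1)) f
      simp only [bracket, LinearMap.sub_apply, Module.End.mul_apply, LinearMap.smul_apply, hf,
        map_smul] at h1
      rw [sub_eq_iff_eq_add] at h1
      rw [h1]
      module
  intro f
  have := key (Submodule.mem_top (x := f))
  rw [Module.End.mem_maxGenEigenspace] at this
  simpa using this

/-- The operator is the projection to the kernel of a diagonalizable operator. -/
def IsKernelProj (D P : Module.End K M) : Prop :=
  ∀ (n : ℕ) (f : M), D f = (n : K) • f → P f = if n = 0 then f else 0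

/-- The definition concerns all eigenvectors, not just those in `b`. On the span, `P * D = D * P =
0`, and `1 - P` maps into the sum of the nonzero eigenspaces; so for `f` in the kernel, `f - P f`
lies in two independent subspaces. -/
theorem IsKernelProj.of_span {D P : Module.End K M} {b : Set M}
    (hb : Submodule.span K b = ⊤)
    (h : ∀ f ∈ b, ∃ n : ℕ, D f = (n : K) • f ∧ P f = if n = 0 then f else 0) :
    IsKernelProj D P := by
  have h1 : P * D = 0 := LinearMap.ext_on hb fun f hf => by
    obtain ⟨n, h1, h2⟩ := h f hf
    rw [Module.End.mul_apply, h1, map_smul, h2]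
    split_ifs with hn <;> simp [hn]
  have h2 : D * P = 0 := LinearMap.ext_on hb fun f hf => by
    obtain ⟨n, h1, h2⟩ := h f hf
    rw [Module.End.mul_apply, h2]
    split_ifs with hn <;> simp [h1, hn]
  have h3 : ∀ f, f - P f ∈ ⨆ (j : K) (_ : j ≠ 0), Module.End.eigenspace D j := by
    have : LinearMap.range (1 - P) ≤ ⨆ (j : K) (_ : j ≠ 0), Module.End.eigenspace D j := by
      rw [LinearMap.range_eq_map, ← hb, Submodule.map_span_le]
      intro f hf
      obtain ⟨n, h1, h2⟩ := h f hf
      rw [LinearMap.sub_apply, Module.End.one_apply, h2]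
      split_ifs with hn
      · simp
      · rw [sub_zero]
        exact Submodule.mem_iSup_of_mem (n : K) (Submodule.mem_iSup_of_mem (Nat.cast_ne_zero.2 hn)
          (Module.End.mem_eigenspace_iff.2 h1))
    exact fun f => this ⟨f, rfl⟩
  intro n f hf
  split_ifs with hn
  · have h4 : f - P f ∈ Module.End.eigenspace D (0 : K) := by
      rw [Module.End.mem_eigenspace_iff, map_sub, hf, hn, Nat.cast_zero, zero_smul, zero_smul,
        zero_sub, ← Module.End.mul_apply, h2, LinearMap.zero_apply, neg_zero]
    have h5 := (Module.End.eigenspaces_iSupIndep D 0).le_bot ⟨h4, h3 f⟩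
    exact (sub_eq_zero.1 ((Submodule.mem_bot K).1 h5)).symm
  · have h4 := LinearMap.congr_fun h1 f
    rw [Module.End.mul_apply, hf, map_smul, LinearMap.zero_apply] at h4
    exact (smul_eq_zero.1 h4).resolve_left (Nat.cast_ne_zero.2 hn)

theorem IsKernelProj.commute {D P A : Module.End K M} (hP : IsKernelProj D P)
    (hD : IsNatDiag Set.univ D) (h : Commute D A) : Commute P A := by
  refine hD.ext fun n _ f hf => ?_
  have h1 : D (A f) = (n : K) • A f := by
    rw [← Module.End.mul_apply, h.eq, Module.End.mul_apply, hf, map_smul]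
  rw [Module.End.mul_apply, Module.End.mul_apply, hP n _ h1, hP n _ hf]
  split_ifs <;> simp

/-- `A` raises the degree, so nothing of its image has degree zero. -/
theorem IsKernelProj.mul_eq_zero {D P A : Module.End K M} (hP : IsKernelProj D P)
    (hD : IsNatDiag Set.univ D) {j : ℕ} (hj : j ≠ 0) (h : bracket D A = (j : K) • A) :
    P * A = 0 := by
  refine hD.ext fun n _ f hf => ?_
  have h1 : D (A f) = ((n + j : ℕ) : K) • A f := by
    have h2 := LinearMap.congr_fun h f
    simp only [bracket, LinearMap.sub_apply, Module.End.mul_apply, LinearMap.smul_apply, hf,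
      map_smul] at h2
    rw [sub_eq_iff_eq_add] at h2
    rw [h2]
    push_cast
    module
  rw [Module.End.mul_apply, hP _ _ h1, if_neg (by omega), LinearMap.zero_apply]

end NatDiagonal

/-! ### Counting legs, and finiteness of each coefficient -/

namespace LegAction

variable {K W V : Type*} [Field K] [CharZero K] [Fintype W] [DecidableEq W] [AddCommGroup V]
  [Module K V] (ρ : LegAction K W V)

/-- The operator multiplying a diagram by its number of legs and ends of struts labeled in `A`. -/
noncomputable def countLegs (A : Finset W) : Module.End K ((Sym2 W →₀ ℕ) →₀ V) :=
  ∑ a ∈ A, ρ.moveLeg a a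

/-- The numbers of legs with labels in given sets are diagonalizable and bounded. -/
def IsBounded : Prop :=
  ∀ A : Finset W, ∃ b : ℕ, IsNatDiag {n | n ≤ b} (∑ a ∈ A, ρ.relabel a a)

/-- The number of ends labeled in `A` in a collection of struts. -/
def strutLegs (A : Finset W) (m : Sym2 W →₀ ℕ) : ℕ := ∑ a ∈ A, ∑ w : W, strutEnds m a w

theorem countLegs_single (A : Finset W) (m : Sym2 W →₀ ℕ) (u : V) :
    ρ.countLegs A (Finsupp.single m u) =
      Finsupp.single m ((∑ a ∈ A, ρ.relabel a a) u + (strutLegs A m : K) • u) := by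
  have h : ∀ a w, mulStrut K a w (removeStrut K a w (Finsupp.single m u)) =
      Finsupp.single m ((strutEnds m a w : K) • u) := fun a w => by
    rw [removeStrut_single, map_nsmul, mulStrut_single, Nat.cast_smul_eq_nsmul]
    by_cases h : m s(a, w) = 0
    · rw [strutEnds_eq_zero h, zero_smul, zero_smul, Finsupp.single_zero]
    · rw [tsub_add_cancel_of_le (Finsupp.single_le_iff.2 (Nat.one_le_iff_ne_zero.2 h)),
        Finsupp.smul_single]
  simp only [countLegs, moveLeg, LinearMap.sum_apply, LinearMap.add_apply, coeffwise_single,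
    Module.End.mul_apply, h, Finset.sum_add_distrib, strutLegs, Nat.cast_sum, Finset.sum_smul,
    Finsupp.single_add, Finsupp.single_finsetSum]

theorem countLegs_apply (A : Finset W) (f : (Sym2 W →₀ ℕ) →₀ V) (m : Sym2 W →₀ ℕ) :
    ρ.countLegs A f m = (∑ a ∈ A, ρ.relabel a a) (f m) + (strutLegs A m : K) • f m := by
  induction f using Finsupp.induction_linear with
  | zero => simp
  | add f g hf hg => rw [map_add, Finsupp.add_apply, hf, hg, Finsupp.add_apply, map_add]; module
  | single m' u =>
    rw [countLegs_single]
    by_cases h : m' = m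
    · subst h; simp
    · simp [Finsupp.single_apply, h]

variable {ρ}

theorem IsBounded.countLegs (hρ : ρ.IsBounded) (A : Finset W) :
    IsNatDiag Set.univ (ρ.countLegs A) := by
  obtain ⟨b, hb⟩ := hρ A
  refine IsNatDiag.of_span
    (b := {f | ∃ n : ℕ, ρ.countLegs A f = (n : K) • f}) ?_ fun f ⟨n, hn⟩ => ⟨n, trivial, hn⟩
  rw [← top_le_iff]
  intro f _
  induction f using Finsupp.induction_linear with
  | zero => exact zero_mem _
  | add f g hf hg => exact add_mem (hf trivial) (hg trivial)
  | single m u =>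
    have h : ⊤ ≤ (Submodule.span K {f | ∃ n : ℕ, ρ.countLegs A f = (n : K) • f}).comap
        (Finsupp.lsingle m : V →ₗ[K] _) := by
      rw [← hb]
      refine iSup₂_le fun n _ u hu => Submodule.subset_span ⟨n + strutLegs A m, ?_⟩
      rw [Finsupp.lsingle_apply, countLegs_single, Module.End.mem_eigenspace_iff.1 hu, ← add_smul,
        Finsupp.smul_single, Nat.cast_add]
    exact h (Submodule.mem_top (x := u))

/-- Conservation of legs: the argument has at least `strutLegs A m'` legs labeled in `A`, while a
term of the value with struts `m` has at most `strutLegs A m + b`. The bound does not depend on `T`.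
-/
theorem IsBounded.apply_single_eq_zero (hρ : ρ.IsBounded) (A : Finset W) : ∃ b : ℕ,
    ∀ T : Module.End K ((Sym2 W →₀ ℕ) →₀ V), Commute T (ρ.countLegs A) →
      ∀ m m' : Sym2 W →₀ ℕ, strutLegs A m + b < strutLegs A m' →
        ∀ u, T (Finsupp.single m' u) m = 0 := by
  obtain ⟨b, hb⟩ := hρ A
  refine ⟨b, fun T hT m m' hm u => ?_⟩
  have key : Finsupp.lapply m ∘ₗ T ∘ₗ Finsupp.lsingle m' = (0 : V →ₗ[K] V) := by
    refine hb.ext fun n hn u hu => ?_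
    rw [LinearMap.zero_apply]
    refine hb.eq_zero (c := (n : K) + strutLegs A m' - strutLegs A m) (fun k hk h => ?_) ?_
    · rw [eq_sub_iff_add_eq] at h
      have h' : k + strutLegs A m = n + strutLegs A m' := by exact_mod_cast h
      have : k ≤ b := hk
      omega
    · have h1 := DFunLike.congr_fun (LinearMap.congr_fun hT.eq (Finsupp.single m' u)) m
      rw [Module.End.mul_apply, Module.End.mul_apply, countLegs_apply, countLegs_single, hu,
        ← add_smul, ← Finsupp.smul_single, map_smul, Finsupp.smul_apply] at h1
      simp only [LinearMap.comp_apply, Finsupp.lsingle_apply, Finsupp.lapply_apply]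
      rw [sub_smul, h1, add_sub_cancel_right]
  exact LinearMap.congr_fun key u

/-- No strut has both ends labeled in `X`. -/
def IsSubstantialExponent (X : Finset W) (m : Sym2 W →₀ ℕ) : Prop :=
  ∀ x ∈ X, ∀ y ∈ X, m s(x, y) = 0

/-- Each strut has an end outside `X`, so the conserved count bounds all multiplicities. -/
theorem le_strutLegs_compl {X : Finset W} {m : Sym2 W →₀ ℕ} (hm : IsSubstantialExponent X m)
    (e : Sym2 W) : m e ≤ strutLegs Xᶜ m := by
  have key : ∀ a w, a ∉ X → m s(a, w) ≤ strutLegs Xᶜ m := fun a w ha =>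
    (le_strutEnds m a w).trans <|
      (Finset.single_le_sum (f := fun w => strutEnds m a w) (fun _ _ => Nat.zero_le _)
        (Finset.mem_univ w)).trans <|
      Finset.single_le_sum (f := fun a => ∑ w : W, strutEnds m a w) (fun _ _ => Nat.zero_le _)
        (Finset.mem_compl.2 ha)
  induction e using Sym2.ind with
  | _ a w =>
    by_cases ha : a ∈ X
    · by_cases hw : w ∈ X
      · rw [hm a ha w hw]; exact Nat.zero_le _
      · rw [Sym2.eq_swap]; exact key w a hw
    · exact key a w ha

/-- The source of all finiteness statements: the legs labeled outside `X` are conserved, and they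
bound the number of struts in a substantial diagram. The finite set serves all such `T` at once. -/
theorem IsBounded.exists_finset (hρ : ρ.IsBounded) (X : Finset W) (m : Sym2 W →₀ ℕ) :
    ∃ s : Finset (Sym2 W →₀ ℕ), ∀ T : Module.End K ((Sym2 W →₀ ℕ) →₀ V),
      Commute T (ρ.countLegs Xᶜ) → ∀ m', IsSubstantialExponent X m' → ∀ u,
        T (Finsupp.single m' u) m ≠ 0 → m' ∈ s := by
  classical
  obtain ⟨b, hb⟩ := hρ.apply_single_eq_zero Xᶜ
  refine ⟨Finset.Iic (Finsupp.equivFunOnFinite.symm fun _ => strutLegs Xᶜ m + b),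
    fun T hT m' hm' u hu => ?_⟩
  rw [Finset.mem_Iic]
  intro e
  refine (le_strutLegs_compl hm' e).trans ?_
  by_contra h
  exact hu (hb T hT m m' (by simpa using h) u)

end LegAction

/-! ### Bounds on legs of diagrams, and evaluation at zero as a projection -/

namespace VertexSignature

theorem exists_arity_le (σ : VertexSignature) (d : ℕ) :
    ∃ a : ℕ, ∀ v : σ.Kind, σ.degree v ≤ d → σ.arity v ≤ a := by
  have hf : {v | σ.degree v ≤ d}.Finite := by
    have : {v | σ.degree v ≤ d} = ⋃ i ∈ Set.Iic d, {v | σ.degree v = i} := by ext; simp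
    rw [this]
    exact (Set.finite_Iic d).biUnion fun i _ => σ.finite_degree i
  obtain ⟨a, ha⟩ := (hf.image σ.arity).bddAbove
  exact ⟨a, fun v hv => ha ⟨v, hv, rfl⟩⟩

end VertexSignature

namespace InternalRelations

variable {K : Type*} [Field K] [CharZero K] {σ : VertexSignature} {W : Type*} [DecidableEq W]
  (R : InternalRelations K σ W)

/-- Positivity of the degrees bounds the number of vertices by `d`, and finiteness of the kinds in
each degree bounds their arities. -/
theorem exists_card_halfEdge_le (σ : VertexSignature) (W : Type*) (d : ℕ) :
    ∃ b : ℕ, ∀ Γ : GradedDiagram σ W d, Fintype.card Γ.1.HalfEdge ≤ b := by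
  obtain ⟨a, ha⟩ := σ.exists_arity_le d
  refine ⟨d * a, fun Γ => ?_⟩
  have hd : ∑ i, σ.degree (Γ.1.kind i) = d := Γ.2
  rw [Fintype.card_sigma]
  have h1 : Γ.1.n ≤ d := by
    refine le_trans ?_ hd.le
    simpa using Finset.card_nsmul_le_sum Finset.univ (fun i => σ.degree (Γ.1.kind i)) 1
      fun i _ => σ.degree_pos _
  have h2 : ∀ i, σ.degree (Γ.1.kind i) ≤ d := fun i => by
    refine le_trans ?_ hd.le
    exact Finset.single_le_sum (f := fun i => σ.degree (Γ.1.kind i)) (fun _ _ => Nat.zero_le _)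
      (Finset.mem_univ i)
  calc ∑ i, Fintype.card (Fin (σ.arity (Γ.1.kind i))) ≤ ∑ _i : Fin Γ.1.n, a :=
        Finset.sum_le_sum fun i _ => by rw [Fintype.card_fin]; exact ha _ (h2 i)
    _ = Γ.1.n * a := by simp
    _ ≤ d * a := Nat.mul_le_mul_right _ h1

theorem sum_legCount_le (Γ : StrutlessDiagram σ W) (A : Finset W) :
    ∑ a ∈ A, Γ.legCount a ≤ Fintype.card Γ.HalfEdge := by
  have h : ∀ a, Γ.legCount a = (Finset.univ.filter fun h => Γ.att h = Sum.inl a).card := fun a => by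
    rw [StrutlessDiagram.legCount, Nat.card_eq_fintype_card, Fintype.card_subtype]
  rw [Finset.sum_congr rfl fun a _ => h a, ← Finset.card_biUnion, ← Finset.card_univ]
  · exact Finset.card_le_card (Finset.subset_univ _)
  · intro a _ b _ hab
    rw [Function.onFun, Finset.disjoint_left]
    intro h ha hb
    simp only [Finset.mem_filter, Finset.mem_univ, true_and] at ha hb
    exact hab (Sum.inl_injective (ha.symm.trans hb))

theorem span_mk_single (d : ℕ) : Submodule.span K (Set.range fun Γ : GradedDiagram σ W d =>
    (Submodule.Quotient.mk (Finsupp.single Γ 1) : R.Space d)) = ⊤ := by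
  rw [← top_le_iff]
  intro v _
  obtain ⟨r, rfl⟩ := Submodule.Quotient.mk_surjective _ v
  induction r using Finsupp.induction_linear with
  | zero => exact zero_mem _
  | add f g hf hg => exact add_mem (hf trivial) (hg trivial)
  | single Γ c =>
    have h : (Submodule.Quotient.mk (Finsupp.single Γ c) : R.Space d) =
        c • Submodule.Quotient.mk (Finsupp.single Γ 1) := by
      rw [← Submodule.Quotient.mk_smul, Finsupp.smul_single_one]
    rw [h]
    exact Submodule.smul_mem _ _ (Submodule.subset_span ⟨Γ, rfl⟩)

theorem relabel_self_mk_single (d : ℕ) (x : W) (Γ : GradedDiagram σ W d) :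
    R.relabel d x x (Submodule.Quotient.mk (Finsupp.single Γ 1)) =
      (Γ.1.legCount x : K) • (Submodule.Quotient.mk (Finsupp.single Γ 1) : R.Space d) := by
  rw [relabel_mk, relabelLeg_self_single, Submodule.Quotient.mk_smul]

theorem sum_relabel_self_mk_single (d : ℕ) (A : Finset W) (Γ : GradedDiagram σ W d) :
    (∑ a ∈ A, R.relabel d a a) (Submodule.Quotient.mk (Finsupp.single Γ 1)) =
      ((∑ a ∈ A, Γ.1.legCount a : ℕ) : K) •
        (Submodule.Quotient.mk (Finsupp.single Γ 1) : R.Space d) := by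
  rw [LinearMap.sum_apply, Nat.cast_sum, Finset.sum_smul]
  exact Finset.sum_congr rfl fun a _ => R.relabel_self_mk_single d a Γ

theorem legAction_isBounded (d : ℕ) : (R.legAction d).IsBounded := by
  intro A
  obtain ⟨b, hb⟩ := exists_card_halfEdge_le σ W d
  refine ⟨b, IsNatDiag.of_span (R.span_mk_single d) ?_⟩
  rintro _ ⟨Γ, rfl⟩
  exact ⟨_, (sum_legCount_le Γ.1 A).trans (hb Γ), R.sum_relabel_self_mk_single d A Γ⟩

variable [Fintype W]

theorem span_single_mk_single (d : ℕ) : Submodule.span K (Set.range fun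
    p : (Sym2 W →₀ ℕ) × GradedDiagram σ W d =>
      (Finsupp.single p.1 (Submodule.Quotient.mk (Finsupp.single p.2 1)) : R.FiniteSum d)) = ⊤ := by
  rw [← top_le_iff]
  intro f _
  induction f using Finsupp.induction_linear with
  | zero => exact zero_mem _
  | add f g hf hg => exact add_mem (hf trivial) (hg trivial)
  | single m u =>
    have h : ⊤ ≤ (Submodule.span K (Set.range fun p : (Sym2 W →₀ ℕ) × GradedDiagram σ W d =>
        (Finsupp.single p.1 (Submodule.Quotient.mk (Finsupp.single p.2 1)) :
          R.FiniteSum d))).comap (Finsupp.lsingle m : R.Space d →ₗ[K] _) := by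
      rw [← R.span_mk_single d, Submodule.span_le]
      rintro _ ⟨Γ, rfl⟩
      exact Submodule.subset_span ⟨(m, Γ), rfl⟩
    exact h (Submodule.mem_top (x := u))

theorem evalZero_single (d : ℕ) (X : Finset W) (m : Sym2 W →₀ ℕ) (Γ : GradedDiagram σ W d) :
    R.evalZero d X (Finsupp.single m (Submodule.Quotient.mk (Finsupp.single Γ 1))) =
      if (∑ a ∈ X, Γ.1.legCount a) + LegAction.strutLegs X m = 0 then
        Finsupp.single m (Submodule.Quotient.mk (Finsupp.single Γ 1)) else 0 := by
  classical
  have h1 : (∑ a ∈ X, Γ.1.legCount a) + LegAction.strutLegs X m = 0 ↔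
      (∀ x ∈ X, Γ.1.legCount x = 0) ∧ ∀ x ∈ X, ∀ w : W, m s(x, w) = 0 := by
    rw [Nat.add_eq_zero_iff, Finset.sum_eq_zero_iff, LegAction.strutLegs, Finset.sum_eq_zero_iff]
    simp only [Finset.sum_eq_zero_iff, Finset.mem_univ, true_imp_iff]
    exact and_congr_right fun _ => forall₂_congr fun x _ => forall_congr' fun w =>
      ⟨fun h => Nat.le_zero.1 (h ▸ le_strutEnds m x w), strutEnds_eq_zero⟩
  have h2 : R.evalZero d X (Finsupp.single m (Submodule.Quotient.mk (Finsupp.single Γ 1))) =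
      if ∀ x ∈ X, ∀ w : W, m s(x, w) = 0 then
        Finsupp.single m (R.kill d X (Submodule.Quotient.mk (Finsupp.single Γ 1))) else 0 := by
    rw [evalZero, Finsupp.lsum_single]
    split_ifs <;> simp
  rw [h2, kill_mk, killLegs, Finsupp.linearCombination_single, one_smul]
  by_cases h3 : ∀ x ∈ X, ∀ w : W, m s(x, w) = 0
  · by_cases h4 : ∀ x ∈ X, Γ.1.legCount x = 0
    · rw [if_pos h3, if_pos h4, if_pos (h1.2 ⟨h4, h3⟩)]
    · rw [if_pos h3, if_neg h4, if_neg fun h => h4 (h1.1 h).1, Submodule.Quotient.mk_zero,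
        Finsupp.single_zero]
  · rw [if_neg h3, if_neg fun h => h3 (h1.1 h).2]

/-- The diagrams that survive are those with no leg in `X`. In this form, commuting `evalZero` with
another operator is a question about degrees. -/
theorem evalZero_isKernelProj (d : ℕ) (X : Finset W) :
    IsKernelProj ((R.legAction d).countLegs X) (R.evalZero d X) := by
  refine IsKernelProj.of_span (R.span_single_mk_single d) ?_
  rintro _ ⟨⟨m, Γ⟩, rfl⟩
  refine ⟨(∑ a ∈ X, Γ.1.legCount a) + LegAction.strutLegs X m, ?_, R.evalZero_single d X m Γ⟩
  rw [LegAction.countLegs_single]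
  have h := R.sum_relabel_self_mk_single d X Γ
  rw [show (∑ a ∈ X, (R.legAction d).relabel a a) = ∑ a ∈ X, R.relabel d a a from rfl, h,
    ← add_smul, Finsupp.smul_single, Nat.cast_add]

theorem evalZero_union (d : ℕ) {X Y : Finset W} (h : Disjoint X Y) :
    R.evalZero d (X ∪ Y) = (R.evalZero d Y * R.evalZero d X : Module.End K (R.FiniteSum d)) := by
  refine LinearMap.ext_on (R.span_single_mk_single d) ?_
  rintro _ ⟨⟨m, Γ⟩, rfl⟩
  simp only [Module.End.mul_apply, evalZero_single]
  rw [LegAction.strutLegs, Finset.sum_union h, Finset.sum_union h]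
  have h1 : (∑ a ∈ X, Γ.1.legCount a + ∑ a ∈ Y, Γ.1.legCount a +
      (∑ a ∈ X, ∑ w : W, strutEnds m a w + ∑ a ∈ Y, ∑ w : W, strutEnds m a w) = 0) ↔
      (∑ a ∈ X, Γ.1.legCount a + LegAction.strutLegs X m = 0 ∧
        ∑ a ∈ Y, Γ.1.legCount a + LegAction.strutLegs Y m = 0) := by
    simp only [LegAction.strutLegs]; omega
  simp only [h1]
  by_cases h2 : ∑ a ∈ X, Γ.1.legCount a + LegAction.strutLegs X m = 0
  · simp only [h2, true_and, if_true, evalZero_single]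
  · simp only [h2, false_and, if_false, map_zero]

end InternalRelations

open Matrix

/-! ### Families of operators indexed by matrices -/

section MatSum

variable {K W M : Type*} [Field K] [Fintype W] [DecidableEq W] [AddCommGroup M] [Module K M]

/-- The linear combination of the members of a family with coefficients from a matrix. -/
noncomputable def matSum (φ : W → W → M) : Matrix W W K →ₗ[K] M :=
  ∑ a, ∑ b, (Matrix.entryLinearMap K K a b).smulRight (φ a b)

theorem matSum_apply (φ : W → W → M) (N : Matrix W W K) :
    matSum φ N = ∑ a, ∑ b, N a b • φ a b := by
  simp [matSum, LinearMap.sum_apply]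

theorem matSum_transpose (φ : W → W → M) (N : Matrix W W K) :
    matSum φ Nᵀ = matSum (fun a b => φ b a) N := by
  rw [matSum_apply, matSum_apply, Finset.sum_comm]
  rfl

theorem matSum_add_apply (φ ψ : W → W → M) (N : Matrix W W K) :
    matSum (fun a b => φ a b + ψ a b) N = matSum φ N + matSum ψ N := by
  simp only [matSum_apply, smul_add, Finset.sum_add_distrib]

theorem matSum_sub_apply (φ ψ : W → W → M) (N : Matrix W W K) :
    matSum (fun a b => φ a b - ψ a b) N = matSum φ N - matSum ψ N := by
  simp only [matSum_apply, smul_sub, Finset.sum_sub_distrib]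

/-- Contraction with a Kronecker delta is matrix multiplication. With its three variants this turns
commutators of matrix-weighted operators into matrix identities. -/
theorem matSum_matSum_delta (φ : W → W → M) (N B : Matrix W W K) :
    matSum (fun x y => matSum (fun a b => delta K x a • φ y b) B) N = matSum φ (Nᵀ * B) := by
  simp only [matSum_apply, delta, ite_smul, smul_ite, one_smul, zero_smul, smul_zero,
    Finset.sum_ite_irrel, Finset.sum_const_zero, Finset.sum_ite_eq, Finset.mem_univ, if_true,
    Matrix.mul_apply, Finset.sum_smul, Matrix.transpose_apply, Finset.smul_sum, smul_smul]
  rw [Finset.sum_comm]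
  exact Finset.sum_congr rfl fun y _ => Finset.sum_comm

theorem matSum_matSum_delta' (φ : W → W → M) (N B : Matrix W W K) :
    matSum (fun x y => matSum (fun a b => delta K x b • φ y a) B) N = matSum φ (Nᵀ * Bᵀ) := by
  rw [← matSum_matSum_delta]
  simp only [matSum_transpose]

theorem matSum_matSum_delta_right (φ : W → W → M) (N B : Matrix W W K) :
    matSum (fun x y => matSum (fun a b => delta K y a • φ x b) B) N = matSum φ (N * B) := by
  have h := matSum_matSum_delta φ Nᵀ B
  rw [matSum_transpose, Matrix.transpose_transpose] at h
  exact h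

theorem matSum_matSum_delta_right' (φ : W → W → M) (N B : Matrix W W K) :
    matSum (fun x y => matSum (fun a b => delta K y b • φ x a) B) N = matSum φ (N * Bᵀ) := by
  rw [← matSum_matSum_delta_right]
  simp only [matSum_transpose]

theorem bracket_matSum {R : Type*} [Ring R] [Algebra K R] (φ ψ : W → W → R) (N B : Matrix W W K) :
    bracket (matSum φ N) (matSum ψ B) =
      matSum (fun x y => matSum (fun a b => bracket (φ x y) (ψ a b)) B) N := by
  simp only [matSum_apply (K := K) φ, matSum_apply (K := K) (fun _ _ => matSum _ _), sum_bracket,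
    smul_bracket]
  simp only [matSum_apply, bracket_sum, bracket_smul]

/-- The matrix of the inclusion of a set of labels. -/
def inclMat (K : Type*) [Field K] {W : Type*} [DecidableEq W] (X : Finset W) : Matrix W X K :=
  Matrix.of fun w x => if w = x then 1 else 0

theorem inclMat_transpose_mul_self (X : Finset W) : (inclMat K X)ᵀ * inclMat K X = 1 := by
  ext x y
  by_cases h : x = y
  · subst h
    simp [inclMat, Matrix.mul_apply]
  · have h' : ¬ (y : W) = x := fun e => h (Subtype.ext e.symm)
    simp [inclMat, Matrix.mul_apply, Matrix.one_apply, h, h']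

theorem inclMat_transpose_mul_of_disjoint {X Y : Finset W} (h : Disjoint X Y) :
    (inclMat K X)ᵀ * inclMat K Y = 0 := by
  ext x y
  have : ¬ (y : W) = x := fun hxy => Finset.disjoint_left.1 h x.2 (hxy ▸ y.2)
  simp [inclMat, Matrix.mul_apply, this]

/-- The projection to the span of a set of labels. -/
def projMat (K : Type*) [Field K] {W : Type*} [DecidableEq W] (A : Finset W) : Matrix W W K :=
  Matrix.diagonal fun w => if w ∈ A then 1 else 0

theorem projMat_mul_inclMat_of_subset {A X : Finset W} (h : X ⊆ A) :
    projMat K A * inclMat K X = inclMat K X := by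
  ext w x
  by_cases hw : w = x
  · simp [projMat, inclMat, Matrix.diagonal_mul, hw, h x.2]
  · simp [projMat, inclMat, Matrix.diagonal_mul, hw]

theorem projMat_mul_inclMat_of_disjoint {A X : Finset W} (h : Disjoint X A) :
    projMat K A * inclMat K X = 0 := by
  ext w x
  by_cases hw : w = x
  · simp [projMat, inclMat, Matrix.diagonal_mul, hw, Finset.disjoint_left.1 h x.2]
  · simp [projMat, inclMat, Matrix.diagonal_mul, hw]

theorem projMat_transpose (A : Finset W) : (projMat K A)ᵀ = projMat K A :=
  Matrix.diagonal_transpose _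

theorem matSum_inclMat (φ : W → W → M) {X Y : Finset W} (N : Matrix X Y K) :
    matSum φ (inclMat K X * N * (inclMat K Y)ᵀ) = ∑ x : X, ∑ y : Y, N x y • φ x y := by
  have h : ∀ a b, (inclMat K X * N * (inclMat K Y)ᵀ) a b =
      ∑ x : X, ∑ y : Y, if a = x then if b = y then N x y else 0 else 0 := fun a b => by
    simp only [Matrix.mul_apply, inclMat, Matrix.of_apply, Matrix.transpose_apply, Finset.sum_mul,
      ite_mul, one_mul, zero_mul, mul_ite, mul_one, mul_zero]
    conv_rhs => rw [Finset.sum_comm]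
    refine Finset.sum_congr rfl fun y _ => ?_
    split_ifs <;> simp
  simp only [matSum_apply, h, Finset.sum_smul]
  rw [Finset.sum_congr rfl fun a _ => Finset.sum_comm, Finset.sum_comm]
  refine Finset.sum_congr rfl fun x _ => ?_
  rw [Finset.sum_congr rfl fun a _ => Finset.sum_comm, Finset.sum_comm]
  refine Finset.sum_congr rfl fun y _ => ?_
  simp [ite_smul]

end MatSum

section StrutMat

variable {K W V : Type*} [Field K] [Fintype W] [DecidableEq W] [AddCommGroup V] [Module K V]

/-- Multiplication by a quadratic. -/
noncomputable def strutMat : Matrix W W K →ₗ[K] Module.End K ((Sym2 W →₀ ℕ) →₀ V) :=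
  matSum (mulStrut K)

theorem strutMat_bracket_strutMat (B C : Matrix W W K) :
    bracket (strutMat (V := V) B) (strutMat C) = 0 := by
  rw [strutMat, bracket_matSum]
  simp only [mulStrut_bracket_mulStrut, matSum_apply, smul_zero, Finset.sum_const_zero]

end StrutMat

namespace LegAction

variable {K W V : Type*} [Field K] [Fintype W] [DecidableEq W] [AddCommGroup V]
  [Module K V] (ρ : LegAction K W V)

/-- The linear combination of the gluing operators with coefficients from a matrix. -/
noncomputable def joinMat : Matrix W W K →ₗ[K] Module.End K ((Sym2 W →₀ ℕ) →₀ V) :=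
  matSum ρ.join

/-- The linear combination of the relabeling operators with coefficients from a matrix. -/
noncomputable def moveMat : Matrix W W K →ₗ[K] Module.End K ((Sym2 W →₀ ℕ) →₀ V) :=
  matSum ρ.moveLeg

theorem joinMat_bracket_strutMat (N B : Matrix W W K) :
    bracket (ρ.joinMat N) (strutMat B) = ρ.moveMat (Nᵀ * B + Nᵀ * Bᵀ + (N * B + N * Bᵀ)) := by
  rw [joinMat, strutMat, bracket_matSum]
  simp only [join_bracket_mulStrut, matSum_add_apply, matSum_matSum_delta, matSum_matSum_delta',
    matSum_matSum_delta_right, matSum_matSum_delta_right', map_add, moveMat]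

theorem joinMat_bracket_moveMat (N M : Matrix W W K) :
    bracket (ρ.joinMat N) (ρ.moveMat M) = ρ.joinMat (M * N + N * Mᵀ) := by
  rw [joinMat, moveMat, bracket_matSum]
  simp only [join_bracket_moveLeg, matSum_add_apply, matSum_matSum_delta_right', map_add]
  congr 1
  have h := matSum_matSum_delta' (fun a b => ρ.join b a) N M
  rw [← matSum_transpose ρ.join, Matrix.transpose_mul, Matrix.transpose_transpose,
    Matrix.transpose_transpose] at h
  exact h

theorem moveMat_bracket_strutMat (M B : Matrix W W K) :
    bracket (ρ.moveMat M) (strutMat B) = strutMat (Mᵀ * B + Mᵀ * Bᵀ) := by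
  rw [moveMat, strutMat, bracket_matSum]
  simp only [moveLeg_bracket_mulStrut, matSum_add_apply, matSum_matSum_delta, matSum_matSum_delta',
    map_add]

theorem moveMat_bracket_moveMat (M N : Matrix W W K) :
    bracket (ρ.moveMat M) (ρ.moveMat N) = ρ.moveMat (N * M - M * N) := by
  rw [moveMat, bracket_matSum]
  simp only [moveLeg_bracket_moveLeg, matSum_sub_apply, matSum_matSum_delta_right, map_sub]
  congr 1
  have h := matSum_matSum_delta' (fun a b => ρ.moveLeg b a) M N
  rw [← matSum_transpose ρ.moveLeg, Matrix.transpose_mul, Matrix.transpose_transpose,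
    Matrix.transpose_transpose] at h
  exact h

theorem joinMat_commute (N N' : Matrix W W K) : Commute (ρ.joinMat N) (ρ.joinMat N') := by
  rw [← bracket_eq_zero_iff, joinMat, bracket_matSum]
  simp only [join_bracket_join, matSum_apply, smul_zero, Finset.sum_const_zero]

theorem countLegs_eq_moveMat (A : Finset W) : ρ.countLegs A = ρ.moveMat (projMat K A) := by
  rw [countLegs, moveMat, matSum_apply]
  simp [projMat, Matrix.diagonal_apply, ite_smul, Finset.sum_ite_mem]

theorem countLegs_bracket_joinMat (A : Finset W) (N : Matrix W W K) :
    bracket (ρ.countLegs A) (ρ.joinMat N) = -ρ.joinMat (projMat K A * N + N * projMat K A) := by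
  have h := ρ.joinMat_bracket_moveMat N (projMat K A)
  rw [projMat_transpose] at h
  rw [countLegs_eq_moveMat, ← h]
  simp [bracket]

theorem countLegs_bracket_moveMat (A : Finset W) (M : Matrix W W K) :
    bracket (ρ.countLegs A) (ρ.moveMat M) = ρ.moveMat (M * projMat K A - projMat K A * M) := by
  rw [countLegs_eq_moveMat, moveMat_bracket_moveMat]

theorem countLegs_bracket_strutMat (A : Finset W) (B : Matrix W W K) :
    bracket (ρ.countLegs A) (strutMat B) = strutMat (projMat K A * B + projMat K A * Bᵀ) := by
  rw [countLegs_eq_moveMat, moveMat_bracket_strutMat, projMat_transpose]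

end LegAction

/-! ### Completing the square, degree by degree -/

section Hermite

variable {K M : Type*} [Field K] [CharZero K] [AddCommGroup M] [Module K M]

/-- The coefficients of the exponential of `e * t ^ 2`. -/
noncomputable def dpowSq (e : Module.End K M) (p : ℕ) : Module.End K M :=
  if Even p then dpow e (p / 2) else 0

/-- The differential equation `F' = 2 t e F` of `F = exp(e t²)`, read off coefficientwise. -/
theorem dpowSq_add_two (e : Module.End K M) (p : ℕ) :
    ((p : K) + 2) • dpowSq e (p + 2) = (2 : K) • (e * dpowSq e p) := by
  by_cases hp : Even p
  · obtain ⟨i, rfl⟩ := hp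
    rw [dpowSq, dpowSq, if_pos (by rw [Nat.even_add]; simp), if_pos ⟨i, rfl⟩,
      show (i + i + 2) / 2 = i + 1 by omega, show (i + i) / 2 = i by omega, mul_dpow]
    push_cast
    module
  · rw [dpowSq, dpowSq, if_neg (by rw [Nat.even_add]; simpa using hp), if_neg hp]
    simp

/-- The coefficient of `t ^ j` in `Ψ exp(tq) = exp(t² e) Ψ exp(tT)`. Both sides solve `F' = F T + 2
t e F` with `F(0) = Ψ`. The identity is kept coefficientwise because multiplication by a strut
quadratic need not be locally nilpotent, so `exp(q)` may fail to be an operator on finite sums. -/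
theorem mul_dpow_hermite {Ψ q T e : Module.End K M} (h₁ : Ψ * q = Ψ * T)
    (h₂ : bracket T q = (2 : K) • e) (h₃ : Commute e q) (h₄ : Commute e Ψ) (j : ℕ) :
    Ψ * dpow q j = ∑ p ∈ Finset.HasAntidiagonal.antidiagonal j,
      dpowSq e p.1 * (Ψ * dpow T p.2) := by
  have hT : ∀ j, T * dpow q (j + 1) = dpow q (j + 1) * T + (2 : K) • (e * dpow q j) := fun j => by
    have h := mul_dpow_of_second_order (T := q) (a₀ := T) (a₁ := (2 : K) • e) (a₂ := 0)
      (by rw [← h₂]; exact mul_eq_add_bracket _ _)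
      (by rw [smul_mul_assoc, mul_smul_comm, h₃.eq, add_zero]) (by simp)
    cases j with
    | zero => simpa [dpow, ← h₂] using mul_eq_add_bracket T q
    | succ j =>
      have h5 : Commute e (dpow q (j + 1)) := by
        unfold dpow
        exact (h₃.pow_right _).smul_right _
      rw [h j, mul_zero, smul_zero, add_zero, mul_smul_comm, h5.eq]
  -- The differential equation for the left-hand side.
  have ha : ∀ j : ℕ, ((j : K) + 2) • (Ψ * dpow q (j + 2)) =
      (Ψ * dpow q (j + 1)) * T + (2 : K) • (e * (Ψ * dpow q j)) := fun j => by
    have h5 : ((j : K) + 2) • (Ψ * dpow q (j + 2)) = Ψ * (q * dpow q (j + 1)) := by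
      rw [mul_dpow, mul_smul_comm]
      push_cast
      module
    rw [h5, ← mul_assoc, h₁, mul_assoc, hT, mul_add, mul_smul_comm, ← mul_assoc e, h₄.eq,
      mul_assoc, mul_assoc]
  -- The same equation for the right-hand side, by the product rule: `j + 2` is split as `p.1 +
  -- p.2`.
  have hb : ∀ j : ℕ, ((j : K) + 2) • (∑ p ∈ Finset.HasAntidiagonal.antidiagonal (j + 2),
        dpowSq e p.1 * (Ψ * dpow T p.2)) =
      (∑ p ∈ Finset.HasAntidiagonal.antidiagonal (j + 1), dpowSq e p.1 * (Ψ * dpow T p.2)) * T +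
        (2 : K) • (e * ∑ p ∈ Finset.HasAntidiagonal.antidiagonal j,
          dpowSq e p.1 * (Ψ * dpow T p.2)) := fun j => by
    have h5 : ((j : K) + 2) • (∑ p ∈ Finset.HasAntidiagonal.antidiagonal (j + 2),
          dpowSq e p.1 * (Ψ * dpow T p.2)) =
        (∑ p ∈ Finset.HasAntidiagonal.antidiagonal (j + 2),
          dpowSq e p.1 * (Ψ * ((p.2 : K) • dpow T p.2))) +
        ∑ p ∈ Finset.HasAntidiagonal.antidiagonal (j + 2),
          ((p.1 : K) • dpowSq e p.1) * (Ψ * dpow T p.2) := by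
      rw [Finset.smul_sum, ← Finset.sum_add_distrib]
      refine Finset.sum_congr rfl fun p hp => ?_
      have : ((p.1 : K) + p.2) = (j : K) + 2 := by
        exact_mod_cast congrArg (Nat.cast (R := K)) (Finset.HasAntidiagonal.mem_antidiagonal.1 hp)
      rw [← this, mul_smul_comm, mul_smul_comm, smul_mul_assoc]
      module
    rw [h5]
    congr 1
    · rw [Finset.Nat.sum_antidiagonal_succ', Finset.sum_mul]
      simp only [Nat.cast_zero, zero_smul, mul_zero, add_zero, zero_add]
      refine Finset.sum_congr rfl fun p _ => ?_
      rw [mul_assoc, mul_assoc, dpow_mul]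
      push_cast
      rfl
    · rw [Finset.Nat.sum_antidiagonal_succ, Finset.Nat.sum_antidiagonal_succ, Finset.mul_sum,
        Finset.smul_sum]
      have h6 : dpowSq e (0 + 1) = 0 := by simp [dpowSq]
      rw [h6, Nat.cast_zero, zero_smul, zero_mul, zero_add, smul_zero, zero_mul, zero_add]
      refine Finset.sum_congr rfl fun p _ => ?_
      rw [← mul_assoc e, ← smul_mul_assoc, ← dpowSq_add_two]
      push_cast
      rw [add_assoc, one_add_one_eq_two]
  have h0 : Ψ * dpow q 0 = ∑ p ∈ Finset.HasAntidiagonal.antidiagonal 0,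
      dpowSq e p.1 * (Ψ * dpow T p.2) := by
    simp [dpowSq, dpow_zero]
  have h1' : Ψ * dpow q 1 = ∑ p ∈ Finset.HasAntidiagonal.antidiagonal 1,
      dpowSq e p.1 * (Ψ * dpow T p.2) := by
    rw [Finset.Nat.sum_antidiagonal_succ]
    simp [dpowSq, dpow, h₁]
  induction j using Nat.twoStepInduction with
  | zero => exact h0
  | one => exact h1'
  | more j ih1 ih2 =>
    have hj : (j : K) + 2 ≠ 0 := by
      have := Nat.cast_add_one_ne_zero (R := K) (j + 1)
      push_cast at this
      rwa [add_assoc, one_add_one_eq_two] at this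
    refine smul_right_injective _ hj ?_
    simp only
    rw [ha, hb, ih1, ih2]

theorem sum_dpowSq {e : Module.End K M} (n : ℕ) :
    ∑ p ∈ Finset.range (2 * n), dpowSq e p = ∑ i ∈ Finset.range n, dpow e i := by
  induction n with
  | zero => simp
  | succ n ih =>
    rw [show 2 * (n + 1) = 2 * n + 1 + 1 by ring, Finset.sum_range_succ, Finset.sum_range_succ, ih,
      Finset.sum_range_succ _ n, dpowSq, dpowSq, if_pos (by simp), if_neg (by simp [Nat.even_add]),
      add_zero]
    simp

theorem mul_lexp_eq_self {T P : Module.End K M} (hT : IsLocNil T) (h : P * T = 0) :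
    P * lexp T = P := by
  ext f
  obtain ⟨n, hn⟩ := hT f
  rw [Module.End.mul_apply, lexp_apply_eq_sum hT (pow_apply_eq_zero_of_le hn (Nat.le_succ n)),
    Finset.sum_range_succ', map_add, map_sum]
  have h1 : ∀ k, P (dpow T (k + 1) f) = 0 := fun k => by
    rw [dpow, LinearMap.smul_apply, map_smul, pow_succ', Module.End.mul_apply,
      ← Module.End.mul_apply P, h, LinearMap.zero_apply, smul_zero]
  simp [h1, dpow_zero]

end Hermite

/-! ### Gaussian operators, infinitesimal substitutions and quadratics -/

namespace LegAction

variable {K W V : Type*} [Field K] [CharZero K] [Fintype W] [DecidableEq W] [AddCommGroup V]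
  [Module K V] (ρ : LegAction K W V)

/-- The second order operator in the variables `X` with coefficients `-N/2`. -/
noncomputable def gaussOp {X : Finset W} (N : Matrix X X K) :
    Module.End K ((Sym2 W →₀ ℕ) →₀ V) :=
  ρ.joinMat (-(2 : K)⁻¹ • (inclMat K X * N * (inclMat K X)ᵀ))

variable {ρ}

/-- Each application uses up two legs labeled in `X`. -/
theorem IsBounded.isLocNil_gaussOp (hρ : ρ.IsBounded) {X : Finset W} (N : Matrix X X K) :
    IsLocNil (ρ.gaussOp N) := by
  refine (hρ.countLegs X).isLocNil (j := 2) two_ne_zero ?_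
  have h1 := projMat_mul_inclMat_of_subset (K := K) (Finset.Subset.refl X)
  have h2 : (inclMat K X)ᵀ * projMat K X = (inclMat K X)ᵀ := by
    have := congrArg Matrix.transpose h1
    rwa [Matrix.transpose_mul, projMat_transpose] at this
  rw [gaussOp, countLegs_bracket_joinMat]
  simp only [Matrix.mul_smul, Matrix.smul_mul, Matrix.mul_assoc, h2]
  simp only [← Matrix.mul_assoc (projMat K X), h1]
  rw [← two_smul K, map_smul]
  push_cast
  module

theorem commute_countLegs_gaussOp {A X : Finset W} (h : Disjoint X A) (N : Matrix X X K) :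
    Commute (ρ.countLegs A) (ρ.gaussOp N) := by
  have h1 := projMat_mul_inclMat_of_disjoint (K := K) h
  have h2 : (inclMat K X)ᵀ * projMat K A = 0 := by
    have := congrArg Matrix.transpose h1
    rwa [Matrix.transpose_mul, projMat_transpose, Matrix.transpose_zero] at this
  rw [← bracket_eq_zero_iff, gaussOp, countLegs_bracket_joinMat, mul_smul_comm, smul_mul_assoc,
    Matrix.mul_assoc _ _ (projMat K A), h2, Matrix.mul_assoc, ← Matrix.mul_assoc (projMat K A), h1]
  simp

section TwoSets

variable {X Y : Finset W}

/-- The operator substituting, to first order, `-M` times the variables `Y` for the variables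
`X`. -/
noncomputable def shiftOp (ρ : LegAction K W V) (M : Matrix X Y K) :
    Module.End K ((Sym2 W →₀ ℕ) →₀ V) :=
  ρ.moveMat (-(inclMat K X * M * (inclMat K Y)ᵀ))

/-- Multiplication by the quadratic with a given matrix. -/
noncomputable def quadOp (V : Type*) [AddCommGroup V] [Module K V] {X Y : Finset W}
    (B : Matrix X Y K) : Module.End K ((Sym2 W →₀ ℕ) →₀ V) :=
  strutMat (inclMat K X * B * (inclMat K Y)ᵀ)

theorem inclMat_relations (hXY : Disjoint X Y) :
    (inclMat K X)ᵀ * inclMat K X = 1 ∧ (inclMat K Y)ᵀ * inclMat K Y = 1 ∧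
      (inclMat K X)ᵀ * inclMat K Y = 0 ∧ (inclMat K Y)ᵀ * inclMat K X = 0 :=
  ⟨inclMat_transpose_mul_self X, inclMat_transpose_mul_self Y,
    inclMat_transpose_mul_of_disjoint hXY, inclMat_transpose_mul_of_disjoint hXY.symm⟩

theorem IsBounded.isLocNil_shiftOp (hXY : Disjoint X Y) (hρ : ρ.IsBounded) (M : Matrix X Y K) :
    IsLocNil (ρ.shiftOp M) := by
  refine (hρ.countLegs X).isLocNil (j := 1) one_ne_zero ?_
  have h1 := projMat_mul_inclMat_of_subset (K := K) (Finset.Subset.refl X)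
  have h2 : (inclMat K Y)ᵀ * projMat K X = 0 := by
    have := congrArg Matrix.transpose (projMat_mul_inclMat_of_disjoint (K := K) hXY.symm)
    rwa [Matrix.transpose_mul, projMat_transpose, Matrix.transpose_zero] at this
  rw [shiftOp, countLegs_bracket_moveMat]
  simp only [Matrix.mul_assoc, Matrix.neg_mul, Matrix.mul_neg, h2]
  simp only [← Matrix.mul_assoc (projMat K X), h1]
  simp

/-- Contracting one end of the additional strut with `xᵀBy` leaves a first order operator, replacing
`x` by `-NBy`: the shift that completes the square. -/
theorem gaussOp_bracket_quadOp (hXY : Disjoint X Y) {N : Matrix X X K} (hN : Nᵀ = N) (B : Matrix X Y K) :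
    bracket (ρ.gaussOp N) (quadOp V B) = ρ.shiftOp (N * B) := by
  obtain ⟨h1, h2, h3, h4⟩ := inclMat_relations (K := K) hXY
  rw [gaussOp, quadOp, joinMat_bracket_strutMat, shiftOp]
  congr 1
  simp only [Matrix.transpose_smul, Matrix.transpose_mul, Matrix.transpose_transpose, hN,
    Matrix.mul_assoc, Matrix.smul_mul, Matrix.mul_smul]
  simp only [← Matrix.mul_assoc (inclMat K X)ᵀ, h1, h2, h3, h4, Matrix.one_mul, Matrix.zero_mul, Matrix.mul_zero]
  module

theorem gaussOp_commute_shiftOp (hXY : Disjoint X Y) {N : Matrix X X K} (M : Matrix X Y K) :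
    Commute (ρ.gaussOp N) (ρ.shiftOp M) := by
  obtain ⟨h1, h2, h3, h4⟩ := inclMat_relations (K := K) hXY
  rw [← bracket_eq_zero_iff, gaussOp, shiftOp, joinMat_bracket_moveMat]
  simp only [Matrix.transpose_neg, Matrix.transpose_mul, Matrix.transpose_transpose, Matrix.mul_assoc, Matrix.smul_mul,
    Matrix.mul_smul, Matrix.neg_mul, Matrix.mul_neg]
  simp only [← Matrix.mul_assoc (inclMat K X)ᵀ, ← Matrix.mul_assoc (inclMat K Y)ᵀ, h1, h2, h3, h4,
    Matrix.one_mul, Matrix.zero_mul, Matrix.mul_zero]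
  simp

/-- Substituting `-My` for `x` in `xᵀBy` gives a quadratic in `Y` alone. With `M = A⁻¹B` this is the
correction term of the Schur complement. -/
theorem shiftOp_bracket_quadOp (hXY : Disjoint X Y) (M B : Matrix X Y K) :
    bracket (ρ.shiftOp M) (quadOp V B) = -quadOp V (Mᵀ * B) := by
  obtain ⟨h1, h2, h3, h4⟩ := inclMat_relations (K := K) hXY
  rw [shiftOp, quadOp, quadOp, moveMat_bracket_strutMat, ← map_neg]
  congr 1
  simp only [Matrix.transpose_neg, Matrix.transpose_mul, Matrix.transpose_transpose, Matrix.mul_assoc, Matrix.smul_mul,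
    Matrix.mul_smul, Matrix.neg_mul, Matrix.mul_neg]
  simp only [← Matrix.mul_assoc (inclMat K X)ᵀ, ← Matrix.mul_assoc (inclMat K Y)ᵀ, h1, h2, h3, h4,
    Matrix.one_mul, Matrix.zero_mul, Matrix.mul_zero]
  simp

theorem gaussOp_commute_quadOp (hXY : Disjoint X Y) (N : Matrix X X K) (C : Matrix Y Y K) :
    Commute (ρ.gaussOp N) (quadOp V C) := by
  obtain ⟨h1, h2, h3, h4⟩ := inclMat_relations (K := K) hXY
  rw [← bracket_eq_zero_iff, gaussOp, quadOp, joinMat_bracket_strutMat]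
  simp only [Matrix.transpose_smul, Matrix.transpose_mul, Matrix.transpose_transpose, Matrix.mul_assoc, Matrix.smul_mul,
    Matrix.mul_smul]
  simp only [← Matrix.mul_assoc (inclMat K X)ᵀ, h1, h2, h3, h4, Matrix.one_mul, Matrix.zero_mul,
    Matrix.mul_zero]
  simp

/-- Every strut of the mixed quadratic has an end in `X`, which evaluation at zero kills. -/
theorem mul_quadOp_eq_zero (hXY : Disjoint X Y) (hρ : ρ.IsBounded) {P : Module.End K ((Sym2 W →₀ ℕ) →₀ V)}
    (hP : IsKernelProj (ρ.countLegs X) P) (B : Matrix X Y K) : P * quadOp V B = 0 := by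
  refine hP.mul_eq_zero (hρ.countLegs X) (j := 1) one_ne_zero ?_
  have h1 := projMat_mul_inclMat_of_subset (K := K) (Finset.Subset.refl X)
  have h2 := projMat_mul_inclMat_of_disjoint (K := K) hXY.symm
  rw [quadOp, countLegs_bracket_strutMat]
  simp only [Matrix.transpose_mul, Matrix.transpose_transpose, Matrix.mul_assoc]
  simp only [← Matrix.mul_assoc (projMat K X), h1, h2, Matrix.zero_mul]
  simp

theorem commute_quadOp (hXY : Disjoint X Y) (hρ : ρ.IsBounded) {P : Module.End K ((Sym2 W →₀ ℕ) →₀ V)}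
    (hP : IsKernelProj (ρ.countLegs X) P) (C : Matrix Y Y K) : Commute P (quadOp V C) := by
  refine hP.commute (hρ.countLegs X) ?_
  have h2 := projMat_mul_inclMat_of_disjoint (K := K) hXY.symm
  rw [← bracket_eq_zero_iff, quadOp, countLegs_bracket_strutMat]
  simp only [Matrix.transpose_mul, Matrix.transpose_transpose, Matrix.mul_assoc]
  simp only [← Matrix.mul_assoc (projMat K X), h2, Matrix.zero_mul]
  simp

/-- The shift always creates a leg labeled in `Y`. -/
theorem mul_shiftOp_eq_zero (hXY : Disjoint X Y) (hρ : ρ.IsBounded) {P : Module.End K ((Sym2 W →₀ ℕ) →₀ V)}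
    (hP : IsKernelProj (ρ.countLegs Y) P) (M : Matrix X Y K) : P * ρ.shiftOp M = 0 := by
  refine hP.mul_eq_zero (hρ.countLegs Y) (j := 1) one_ne_zero ?_
  have h1 : (inclMat K Y)ᵀ * projMat K Y = (inclMat K Y)ᵀ := by
    have := congrArg Matrix.transpose (projMat_mul_inclMat_of_subset (K := K) (Finset.Subset.refl Y))
    rwa [Matrix.transpose_mul, projMat_transpose] at this
  have h2 := projMat_mul_inclMat_of_disjoint (K := K) hXY
  rw [shiftOp, countLegs_bracket_moveMat]
  simp only [Matrix.mul_assoc, Matrix.neg_mul, Matrix.mul_neg, h1]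
  simp only [← Matrix.mul_assoc (projMat K Y), h2, Matrix.zero_mul]
  simp

theorem commute_countLegs_shiftOp {A : Finset W} (hX : Disjoint X A) (hY : Disjoint Y A)
    (M : Matrix X Y K) : Commute (ρ.countLegs A) (ρ.shiftOp M) := by
  have h1 : (inclMat K Y)ᵀ * projMat K A = 0 := by
    have := congrArg Matrix.transpose (projMat_mul_inclMat_of_disjoint (K := K) hY)
    rwa [Matrix.transpose_mul, projMat_transpose, Matrix.transpose_zero] at this
  have h2 := projMat_mul_inclMat_of_disjoint (K := K) hX
  rw [← bracket_eq_zero_iff, shiftOp, countLegs_bracket_moveMat]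
  simp only [Matrix.mul_assoc, Matrix.neg_mul, Matrix.mul_neg, h1]
  simp only [← Matrix.mul_assoc (projMat K A), h2, Matrix.zero_mul]
  simp

end TwoSets

end LegAction

/-! ### Block matrices and the Schur complement -/

section Blocks

variable {K W : Type*} [Field K] [Fintype W] [DecidableEq W]

theorem inclMat_mul_apply_ne_zero {X Y : Finset W} {N : Matrix X Y K} {a b : W}
    (h : (inclMat K X * N * (inclMat K Y)ᵀ) a b ≠ 0) : a ∈ X ∧ b ∈ Y := by
  simp only [Matrix.mul_apply] at h
  obtain ⟨y, -, hy⟩ := Finset.exists_ne_zero_of_sum_ne_zero h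
  obtain ⟨x, -, hx⟩ := Finset.exists_ne_zero_of_sum_ne_zero (left_ne_zero_of_mul hy)
  have h1 := left_ne_zero_of_mul hx
  have h2 := right_ne_zero_of_mul hy
  simp only [inclMat, Matrix.transpose_apply, Matrix.of_apply, ne_eq, ite_eq_right_iff,
    one_ne_zero, imp_false, not_not] at h1 h2
  exact ⟨h1 ▸ x.2, h2 ▸ y.2⟩

theorem inclMat_mul_injective {X : Finset W} {N : Matrix X X K}
    (h : inclMat K X * N * (inclMat K X)ᵀ = 0) : N = 0 := by
  have h1 := inclMat_transpose_mul_self (K := K) X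
  have := congrArg (fun M => (inclMat K X)ᵀ * M * inclMat K X) h
  simp only [Matrix.mul_assoc, h1, Matrix.mul_one, Matrix.mul_zero, Matrix.zero_mul] at this
  rwa [← Matrix.mul_assoc, h1, Matrix.one_mul] at this

/-- The inclusion of a subset, as a matrix. -/
def subsetMat (K : Type*) [Field K] {W : Type*} [DecidableEq W] {X Z : Finset W} (h : X ⊆ Z) :
    Matrix Z X K :=
  (1 : Matrix Z Z K).submatrix id (Set.inclusion h)

theorem inclMat_mul_subsetMat {X Z : Finset W} (h : X ⊆ Z) :
    inclMat K Z * subsetMat K h = inclMat K X := by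
  ext a x
  simp only [subsetMat, Matrix.mul_apply, Matrix.submatrix_apply, Matrix.one_apply, id, mul_ite,
    mul_one, mul_zero, Finset.sum_ite_eq', Finset.mem_univ, if_true]
  rfl

theorem subsetMat_transpose_mul_mul {X Y Z : Finset W} (hX : X ⊆ Z) (hY : Y ⊆ Z)
    (L : Matrix Z Z K) : (subsetMat K hX)ᵀ * L * subsetMat K hY =
      L.submatrix (Set.inclusion hX) (Set.inclusion hY) := by
  ext x y
  simp [subsetMat, Matrix.mul_apply, Matrix.one_apply]

theorem subsetMat_mul_transpose_add {X Y : Finset W} (h : Disjoint X Y) :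
    subsetMat K (Finset.subset_union_left : X ⊆ X ∪ Y) *
        (subsetMat K (Finset.subset_union_left : X ⊆ X ∪ Y))ᵀ +
      subsetMat K (Finset.subset_union_right : Y ⊆ X ∪ Y) *
        (subsetMat K (Finset.subset_union_right : Y ⊆ X ∪ Y))ᵀ = 1 := by
  have key : ∀ {A Z : Finset W} (h : A ⊆ Z) (a b : Z),
      (subsetMat K h * (subsetMat K h)ᵀ) a b = if a = b ∧ (a : W) ∈ A then 1 else 0 := by
    intro A Z h a b
    simp only [subsetMat, Matrix.mul_apply, Matrix.submatrix_apply, Matrix.one_apply, id,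
      Matrix.transpose_apply, ← ite_and, ite_mul, one_mul, zero_mul]
    split_ifs with hab
    · obtain ⟨rfl, ha⟩ := hab
      rw [Finset.sum_eq_single ⟨a, ha⟩]
      · simp [Set.inclusion]
      · intro x _ hx
        rw [if_neg]
        rintro ⟨rfl, -⟩
        exact hx rfl
      · simp
    · refine Finset.sum_eq_zero fun x _ => if_neg ?_
      rintro ⟨h1, h2⟩
      exact hab ⟨h1.trans h2.symm, by rw [h1]; exact x.2⟩
  ext a b
  rw [Matrix.add_apply, key, key, Matrix.one_apply]
  by_cases hab : a = b
  · subst hab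
    rcases Finset.mem_union.1 a.2 with h1 | h1
    · simp [h1, Finset.disjoint_left.1 h h1]
    · simp [h1, Finset.disjoint_right.1 h h1]
  · simp [hab]

theorem inclMat_mul_block {X Y : Finset W} (h : Disjoint X Y) (L : Matrix ↥(X ∪ Y) ↥(X ∪ Y) K) :
    let i := Set.inclusion (Finset.subset_union_left : X ⊆ X ∪ Y)
    let j := Set.inclusion (Finset.subset_union_right : Y ⊆ X ∪ Y)
    inclMat K (X ∪ Y) * L * (inclMat K (X ∪ Y))ᵀ =
      inclMat K X * L.submatrix i i * (inclMat K X)ᵀ +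
      inclMat K X * L.submatrix i j * (inclMat K Y)ᵀ +
      inclMat K Y * L.submatrix j i * (inclMat K X)ᵀ +
      inclMat K Y * L.submatrix j j * (inclMat K Y)ᵀ := by
  intro i j
  have h1 := inclMat_mul_subsetMat (K := K) (Finset.subset_union_left : X ⊆ X ∪ Y)
  have h2 := inclMat_mul_subsetMat (K := K) (Finset.subset_union_right : Y ⊆ X ∪ Y)
  have h3 := subsetMat_mul_transpose_add (K := K) h
  rw [← h1, ← h2, ← subsetMat_transpose_mul_mul, ← subsetMat_transpose_mul_mul,
    ← subsetMat_transpose_mul_mul, ← subsetMat_transpose_mul_mul]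
  conv_lhs => rw [← Matrix.mul_one L, ← Matrix.one_mul L, ← h3]
  simp only [Matrix.mul_add, Matrix.add_mul, Matrix.transpose_mul, Matrix.mul_assoc]
  abel

/-- The inverse of a symmetric block matrix, in terms of the Schur complement. -/
theorem exists_block_inverse {X Y : Finset W} (h : Disjoint X Y)
    {L : Matrix ↥(X ∪ Y) ↥(X ∪ Y) K} (hL : IsUnit L) (hs : L.IsSymm)
    (hA : IsUnit (L.submatrix (Set.inclusion (Finset.subset_union_left : X ⊆ X ∪ Y))
      (Set.inclusion (Finset.subset_union_left : X ⊆ X ∪ Y)))) :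
    let i := Set.inclusion (Finset.subset_union_left : X ⊆ X ∪ Y)
    let j := Set.inclusion (Finset.subset_union_right : Y ⊆ X ∪ Y)
    let N := (L.submatrix i i)⁻¹
    let B := L.submatrix i j
    let S := L.submatrix j j - Bᵀ * N * B
    IsUnit S ∧ inclMat K (X ∪ Y) * L⁻¹ * (inclMat K (X ∪ Y))ᵀ =
      inclMat K X * N * (inclMat K X)ᵀ +
      (inclMat K Y - inclMat K X * (N * B)) * S⁻¹ * (inclMat K Y - inclMat K X * (N * B))ᵀ := by
  intro i j N B S
  have hBt : L.submatrix j i = Bᵀ := by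
    rw [Matrix.transpose_submatrix, hs.eq]
  have hN : Nᵀ = N := by
    rw [Matrix.transpose_nonsing_inv, Matrix.transpose_submatrix, hs.eq]
  have hNA : N * L.submatrix i i = 1 :=
    Matrix.nonsing_inv_mul _ ((Matrix.isUnit_iff_isUnit_det _).1 hA)
  have hS : IsUnit S := by
    let := hA.invertible
    have h1 : L.submatrix (Equiv.Finset.union X Y h) (Equiv.Finset.union X Y h) =
        Matrix.fromBlocks (L.submatrix i i) B Bᵀ (L.submatrix j j) := by
      rw [← hBt]
      ext a b
      rcases a with a | a <;> rcases b with b | b <;> rfl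
    have h2 := (Matrix.isUnit_submatrix_equiv (Equiv.Finset.union X Y h)
      (Equiv.Finset.union X Y h)).2 hL
    rwa [h1, Matrix.isUnit_fromBlocks_iff_of_invertible₁₁, Matrix.invOf_eq_nonsing_inv] at h2
  refine ⟨hS, ?_⟩
  have hSS : S⁻¹ * S = 1 := Matrix.nonsing_inv_mul _ ((Matrix.isUnit_iff_isUnit_det _).1 hS)
  have hLL : L * L⁻¹ = 1 := Matrix.mul_nonsing_inv _ ((Matrix.isUnit_iff_isUnit_det _).1 hL)
  have h1 := inclMat_transpose_mul_self (K := K) X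
  have h2 := inclMat_transpose_mul_self (K := K) Y
  have h3 := inclMat_transpose_mul_of_disjoint (K := K) h
  have h4 := inclMat_transpose_mul_of_disjoint (K := K) h.symm
  have hZ := inclMat_transpose_mul_self (K := K) (X ∪ Y)
  have h5 := inclMat_mul_subsetMat (K := K) (Finset.subset_union_left : X ⊆ X ∪ Y)
  have h6 := inclMat_mul_subsetMat (K := K) (Finset.subset_union_right : Y ⊆ X ∪ Y)
  have hb := inclMat_mul_block h L
  simp only at hb
  rw [show L.submatrix (Set.inclusion (Finset.subset_union_right : Y ⊆ X ∪ Y))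
    (Set.inclusion (Finset.subset_union_left : X ⊆ X ∪ Y)) = Bᵀ from hBt] at hb
  have hJ : (inclMat K X)ᵀ * (inclMat K (X ∪ Y) * L * (inclMat K (X ∪ Y))ᵀ) =
      L.submatrix i i * (inclMat K X)ᵀ + B * (inclMat K Y)ᵀ := by
    rw [hb]
    simp only [Matrix.mul_add, ← Matrix.mul_assoc, h1, h3, Matrix.one_mul, Matrix.zero_mul,
      add_zero]
    rfl
  have hI : (inclMat K Y)ᵀ * (inclMat K (X ∪ Y) * L * (inclMat K (X ∪ Y))ᵀ) =
      Bᵀ * (inclMat K X)ᵀ + L.submatrix j j * (inclMat K Y)ᵀ := by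
    rw [hb]
    simp only [Matrix.mul_add, ← Matrix.mul_assoc, h2, h4, Matrix.one_mul, Matrix.zero_mul,
      zero_add]
    rfl
  have hsum : inclMat K X * (inclMat K X)ᵀ + inclMat K Y * (inclMat K Y)ᵀ =
      inclMat K (X ∪ Y) * (inclMat K (X ∪ Y))ᵀ := by
    have h7 := congrArg (fun M => inclMat K (X ∪ Y) * M * (inclMat K (X ∪ Y))ᵀ)
      (subsetMat_mul_transpose_add (K := K) h)
    simp only [Matrix.mul_one] at h7
    rw [← h7, ← h5, ← h6]
    simp only [Matrix.mul_add, Matrix.add_mul, Matrix.transpose_mul, Matrix.mul_assoc]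
  set R := inclMat K X * N * (inclMat K X)ᵀ +
    (inclMat K Y - inclMat K X * (N * B)) * S⁻¹ * (inclMat K Y - inclMat K X * (N * B))ᵀ with hR
  have hRp : R * (inclMat K (X ∪ Y) * (inclMat K (X ∪ Y))ᵀ) = R := by
    rw [← hsum, hR]
    have h7 : (inclMat K X)ᵀ * (inclMat K X * (inclMat K X)ᵀ + inclMat K Y * (inclMat K Y)ᵀ) =
        (inclMat K X)ᵀ := by
      rw [Matrix.mul_add, ← Matrix.mul_assoc, ← Matrix.mul_assoc, h1, h3]
      simp
    have h8 : (inclMat K Y)ᵀ * (inclMat K X * (inclMat K X)ᵀ + inclMat K Y * (inclMat K Y)ᵀ) =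
        (inclMat K Y)ᵀ := by
      rw [Matrix.mul_add, ← Matrix.mul_assoc, ← Matrix.mul_assoc, h2, h4]
      simp
    simp only [Matrix.transpose_sub, Matrix.transpose_mul, Matrix.add_mul, Matrix.sub_mul,
      Matrix.mul_assoc, h7, h8]
  -- It suffices to check that the claimed matrix is a left inverse on the span of `X ∪ Y`.
  have hRL : R * (inclMat K (X ∪ Y) * L * (inclMat K (X ∪ Y))ᵀ) =
      inclMat K (X ∪ Y) * (inclMat K (X ∪ Y))ᵀ := by
    -- Block elimination: subtracting `BᵀN` times the rows in `X` from the rows in `Y` clears the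
    -- columns in `X` and leaves the Schur complement.
    have h9 : (inclMat K Y - inclMat K X * (N * B))ᵀ *
        (inclMat K (X ∪ Y) * L * (inclMat K (X ∪ Y))ᵀ) = S * (inclMat K Y)ᵀ := by
      rw [Matrix.transpose_sub, Matrix.sub_mul, hI, Matrix.transpose_mul,
        Matrix.mul_assoc _ (inclMat K X)ᵀ, hJ, Matrix.transpose_mul, hN, Matrix.mul_add,
        Matrix.mul_assoc Bᵀ N, Matrix.mul_assoc, ← Matrix.mul_assoc N, hNA, Matrix.one_mul,
        Matrix.sub_mul]
      simp only [Matrix.mul_assoc]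
      abel
    rw [hR, Matrix.add_mul, Matrix.mul_assoc _ (inclMat K X)ᵀ, hJ, Matrix.mul_assoc _ _
      (inclMat K (X ∪ Y) * L * (inclMat K (X ∪ Y))ᵀ), h9, Matrix.mul_assoc _ S⁻¹,
      ← Matrix.mul_assoc S⁻¹, hSS, Matrix.one_mul, ← hsum, Matrix.mul_add,
      Matrix.mul_assoc _ N, ← Matrix.mul_assoc N, hNA, Matrix.one_mul, Matrix.sub_mul]
    simp only [Matrix.mul_assoc]
    abel
  calc inclMat K (X ∪ Y) * L⁻¹ * (inclMat K (X ∪ Y))ᵀ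
      = R * (inclMat K (X ∪ Y) * L * (inclMat K (X ∪ Y))ᵀ) *
          (inclMat K (X ∪ Y) * L⁻¹ * (inclMat K (X ∪ Y))ᵀ) := by
        rw [hRL]
        simp only [Matrix.mul_assoc]
        rw [← Matrix.mul_assoc (inclMat K (X ∪ Y))ᵀ, hZ, Matrix.one_mul]
    _ = R * (inclMat K (X ∪ Y) * (inclMat K (X ∪ Y))ᵀ) := by
        simp only [Matrix.mul_assoc]
        rw [← Matrix.mul_assoc (inclMat K (X ∪ Y))ᵀ, hZ, Matrix.one_mul, ← Matrix.mul_assoc L, hLL,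
          Matrix.one_mul]
    _ = R := hRp

end Blocks

/-! ### Composition of two Gaussian pairings -/

namespace LegAction

variable {K W V : Type*} [Field K] [CharZero K] [Fintype W] [DecidableEq W] [AddCommGroup V]
  [Module K V] {ρ : LegAction K W V}

theorem countLegs_commute_countLegs (A B : Finset W) :
    Commute (ρ.countLegs A) (ρ.countLegs B) := by
  rw [← bracket_eq_zero_iff, countLegs_eq_moveMat ρ B, countLegs_bracket_moveMat, projMat, projMat,
    Matrix.diagonal_mul_diagonal, Matrix.diagonal_mul_diagonal, ← map_zero ρ.moveMat, ← sub_self (Matrix.diagonal _)]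
  congr 3
  ext i
  exact mul_comm _ _

/-- Conjugation by a substitution transforms the coefficients of a second order operator as a
bilinear form. Since `M * M = 0`, the exponential of `M` is `1 + M` and the second commutator is the
last one. -/
theorem joinMat_mul_lexp_moveMat {M : Matrix W W K} (hM : M * M = 0)
    (hT : IsLocNil (ρ.moveMat M)) (N : Matrix W W K) :
    ρ.joinMat N * lexp (ρ.moveMat M) =
      lexp (ρ.moveMat M) * ρ.joinMat ((1 + M) * N * (1 + M)ᵀ) := by
  have hM' : Mᵀ * Mᵀ = 0 := by rw [← Matrix.transpose_mul, hM, Matrix.transpose_zero]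
  have h1 : M * (M * N + N * Mᵀ) + (M * N + N * Mᵀ) * Mᵀ = (2 : K) • (M * N * Mᵀ) := by
    rw [Matrix.mul_add, Matrix.add_mul, ← Matrix.mul_assoc, hM, Matrix.mul_assoc N, hM', two_smul]
    simp [Matrix.mul_assoc]
  have h2 : M * (M * N * Mᵀ) + M * N * Mᵀ * Mᵀ = 0 := by
    rw [Matrix.mul_assoc (M * N), hM', ← Matrix.mul_assoc, ← Matrix.mul_assoc, hM]
    simp
  rw [mul_lexp_of_second_order hT (a₁ := ρ.joinMat (M * N + N * Mᵀ))
    (a₂ := ρ.joinMat ((2 : K) • (M * N * Mᵀ)))]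
  · rw [← map_smul, ← map_add, ← map_add]
    congr 2
    rw [smul_smul, inv_mul_cancel₀ two_ne_zero, one_smul, Matrix.transpose_add,
      Matrix.transpose_one]
    noncomm_ring
  · rw [mul_eq_add_bracket, joinMat_bracket_moveMat]
  · rw [mul_eq_add_bracket, joinMat_bracket_moveMat, h1]
  · rw [mul_eq_add_bracket, joinMat_bracket_moveMat]
    simp only [Matrix.mul_smul, Matrix.smul_mul, ← smul_add, h2]
    simp

theorem IsBounded.isLocNil_joinMat (hρ : ρ.IsBounded) {A : Finset W} {N : Matrix W W K}
    (h1 : projMat K A * N = N) (h2 : N * projMat K A = N) : IsLocNil (ρ.joinMat N) := by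
  refine (hρ.countLegs A).isLocNil (j := 2) two_ne_zero ?_
  rw [countLegs_bracket_joinMat, h1, h2, ← two_smul K, map_smul]
  push_cast
  module

/-- Pairing with the exponential of the second order operator with coefficients `-N/2`, followed
by the projection `P`. -/
noncomputable def gaussPairing (ρ : LegAction K W V) {X : Finset W}
    (P : Module.End K ((Sym2 W →₀ ℕ) →₀ V)) (N : Matrix X X K) :
    Module.End K ((Sym2 W →₀ ℕ) →₀ V) :=
  P * lexp (ρ.gaussOp N)

variable {X Y : Finset W} {P Q : Module.End K ((Sym2 W →₀ ℕ) →₀ V)}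

theorem commute_countLegs_gaussPairing (hρ : ρ.IsBounded) (hP : IsKernelProj (ρ.countLegs X) P)
    {A : Finset W} (h : Disjoint X A) (N : Matrix X X K) :
    Commute (ρ.countLegs A) (ρ.gaussPairing P N) :=
  (hP.commute (hρ.countLegs X) (countLegs_commute_countLegs X A)).symm.mul_right
    (commute_lexp (hρ.isLocNil_gaussOp N) (commute_countLegs_gaussOp h N))

theorem gaussPairing_commute_quadOp (hXY : Disjoint X Y) (hρ : ρ.IsBounded)
    (hP : IsKernelProj (ρ.countLegs X) P) (N : Matrix X X K) (C : Matrix Y Y K) :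
    Commute (ρ.gaussPairing P N) (quadOp V C) :=
  (commute_quadOp hXY hρ hP C).mul_left
    (commute_lexp (hρ.isLocNil_gaussOp N) (gaussOp_commute_quadOp hXY N C).symm).symm

/-- Moving `q = xᵀBy` to the left through the exponential turns it into `q + T`, where `T` is the
shift; evaluation at zero then kills `q`. This is the hypothesis `Ψ * q = Ψ * T` of
`mul_dpow_hermite`. -/
theorem gaussPairing_mul_dpow_quadOp (hXY : Disjoint X Y) (hρ : ρ.IsBounded)
    (hP : IsKernelProj (ρ.countLegs X) P) {N : Matrix X X K} (hN : Nᵀ = N) (B : Matrix X Y K)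
    (j : ℕ) : ρ.gaussPairing P N * dpow (quadOp V B) j =
      ∑ p ∈ Finset.HasAntidiagonal.antidiagonal j,
        dpowSq (quadOp V (-(2 : K)⁻¹ • (Bᵀ * N * B))) p.1 *
          (ρ.gaussPairing P N * dpow (ρ.shiftOp (N * B)) p.2) := by
  have hq : quadOp V (-(2 : K)⁻¹ • (Bᵀ * N * B)) = -(2 : K)⁻¹ • quadOp V (Bᵀ * N * B) := by
    simp only [quadOp, Matrix.mul_smul, Matrix.smul_mul, map_smul]
  refine mul_dpow_hermite ?_ ?_ ?_ (gaussPairing_commute_quadOp hXY hρ hP N _).symm j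
  · rw [gaussPairing, mul_assoc, lexp_mul_of_bracket (hρ.isLocNil_gaussOp N)
      (gaussOp_bracket_quadOp hXY hN B) (gaussOp_commute_shiftOp hXY _), add_mul, mul_add,
      ← mul_assoc, mul_quadOp_eq_zero hXY hρ hP, zero_mul, zero_add, mul_assoc,
      (commute_lexp (hρ.isLocNil_gaussOp N) (gaussOp_commute_shiftOp hXY _).symm).eq]
  · rw [shiftOp_bracket_quadOp hXY, hq, Matrix.transpose_mul, hN, smul_smul, mul_neg,
      mul_inv_cancel₀ two_ne_zero, neg_one_smul]
  · rw [← bracket_eq_zero_iff]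
    exact strutMat_bracket_strutMat _ _

/-- The core of the Fubini theorem. `P` commutes with the Gaussian operator in `Y`, so both Gaussian
operators act before both evaluations. Conjugation by the shift turns the block diagonal form `N ⊕
S` into `L`, and the shift that remains on the left is invisible to `Q * P`. -/
theorem gaussPairing_mul_gaussPairing (hXY : Disjoint X Y) (hρ : ρ.IsBounded)
    (hP : IsKernelProj (ρ.countLegs X) P) (hQ : IsKernelProj (ρ.countLegs Y) Q)
    (N : Matrix X X K) (B : Matrix X Y K) (S : Matrix Y Y K)
    (L : Matrix ↥(X ∪ Y) ↥(X ∪ Y) K)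
    (h : inclMat K (X ∪ Y) * L * (inclMat K (X ∪ Y))ᵀ = inclMat K X * N * (inclMat K X)ᵀ +
      (inclMat K Y - inclMat K X * (N * B)) * S * (inclMat K Y - inclMat K X * (N * B))ᵀ) :
    ρ.gaussPairing Q S * (ρ.gaussPairing P N * lexp (ρ.shiftOp (N * B))) =
      ρ.gaussPairing (Q * P) L := by
  obtain ⟨h1, h2, h3, h4⟩ := inclMat_relations (K := K) hXY
  have hPQ : Commute P Q := hP.commute (hρ.countLegs X)
    (hQ.commute (hρ.countLegs Y) (countLegs_commute_countLegs Y X)).symm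
  have hPS : Commute P (lexp (ρ.gaussOp S)) :=
    commute_lexp (hρ.isLocNil_gaussOp S)
      (hP.commute (hρ.countLegs X) (commute_countLegs_gaussOp hXY.symm S))
  have hadd : ρ.gaussOp S + ρ.gaussOp N = ρ.joinMat (-(2 : K)⁻¹ •
      (inclMat K X * N * (inclMat K X)ᵀ + inclMat K Y * S * (inclMat K Y)ᵀ)) := by
    rw [gaussOp, gaussOp, ← map_add, add_comm, ← smul_add]
  have hnil : IsLocNil (ρ.gaussOp S + ρ.gaussOp N) := by
    have h5 := projMat_mul_inclMat_of_subset (K := K) (Finset.subset_union_left : X ⊆ X ∪ Y)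
    have h6 := projMat_mul_inclMat_of_subset (K := K) (Finset.subset_union_right : Y ⊆ X ∪ Y)
    have h7 := congrArg Matrix.transpose h5
    have h8 := congrArg Matrix.transpose h6
    rw [Matrix.transpose_mul, projMat_transpose] at h7 h8
    rw [hadd]
    refine hρ.isLocNil_joinMat (A := X ∪ Y) ?_ ?_
    · simp only [Matrix.mul_smul, Matrix.mul_add, ← Matrix.mul_assoc, h5, h6]
    · simp only [Matrix.smul_mul, Matrix.add_mul, Matrix.mul_assoc, h7, h8]
  have hM : -(inclMat K X * (N * B) * (inclMat K Y)ᵀ) * -(inclMat K X * (N * B) * (inclMat K Y)ᵀ) =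
      0 := by
    simp only [Matrix.neg_mul, Matrix.mul_neg, Matrix.mul_assoc]
    simp only [← Matrix.mul_assoc (inclMat K Y)ᵀ, h4]
    simp
  have hconj : (ρ.gaussOp S + ρ.gaussOp N) * lexp (ρ.shiftOp (N * B)) =
      lexp (ρ.shiftOp (N * B)) * ρ.gaussOp L := by
    rw [hadd, shiftOp, joinMat_mul_lexp_moveMat hM (hρ.isLocNil_shiftOp hXY _), gaussOp, h]
    congr 2
    rw [Matrix.mul_smul, Matrix.smul_mul]
    congr 1
    have h5 : (1 + -(inclMat K X * (N * B) * (inclMat K Y)ᵀ)) * inclMat K X = inclMat K X := by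
      rw [Matrix.add_mul, Matrix.one_mul, Matrix.neg_mul, Matrix.mul_assoc, h4]
      simp
    have h6 : (1 + -(inclMat K X * (N * B) * (inclMat K Y)ᵀ)) * inclMat K Y =
        inclMat K Y - inclMat K X * (N * B) := by
      rw [Matrix.add_mul, Matrix.one_mul, Matrix.neg_mul, Matrix.mul_assoc, h2, Matrix.mul_one,
        sub_eq_add_neg]
    have h7 : ∀ U : Matrix W W K,
        U * (inclMat K X * N * (inclMat K X)ᵀ + inclMat K Y * S * (inclMat K Y)ᵀ) * Uᵀ =
          U * inclMat K X * N * (U * inclMat K X)ᵀ + U * inclMat K Y * S * (U * inclMat K Y)ᵀ := by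
      intro U
      simp only [Matrix.mul_add, Matrix.add_mul, Matrix.transpose_mul, Matrix.mul_assoc]
    rw [h7, h5, h6]
  have hlexp : lexp (ρ.gaussOp S + ρ.gaussOp N) * lexp (ρ.shiftOp (N * B)) =
      lexp (ρ.shiftOp (N * B)) * lexp (ρ.gaussOp L) :=
    (comp_lexp (hρ.isLocNil_gaussOp L) hnil hconj.symm).symm
  have hT : Q * P * ρ.shiftOp (N * B) = 0 := by
    rw [← hPQ.eq, mul_assoc, mul_shiftOp_eq_zero hXY hρ hQ, mul_zero]
  have hc : Commute (ρ.gaussOp S) (ρ.gaussOp N) := joinMat_commute _ _ _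
  calc ρ.gaussPairing Q S * (ρ.gaussPairing P N * lexp (ρ.shiftOp (N * B)))
      = Q * (lexp (ρ.gaussOp S) * P) * lexp (ρ.gaussOp N) * lexp (ρ.shiftOp (N * B)) := by
        simp only [gaussPairing, mul_assoc]
    _ = Q * P * (lexp (ρ.gaussOp S) * lexp (ρ.gaussOp N) * lexp (ρ.shiftOp (N * B))) := by
        rw [← hPS.eq]
        simp only [mul_assoc]
    _ = Q * P * lexp (ρ.gaussOp L) := by
        rw [← lexp_add (hρ.isLocNil_gaussOp S) (hρ.isLocNil_gaussOp N) hnil hc, hlexp, ← mul_assoc,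
          mul_lexp_eq_self (hρ.isLocNil_shiftOp hXY _) hT]

end LegAction

/-! ### Power series in the struts and their exponentials -/

open MvPowerSeries

theorem sum_range_sum_antidiagonal {M : Type*} [AddCommMonoid M] {g : ℕ → ℕ → M} {a b J : ℕ}
    (ha : ∀ i l, a ≤ i → g i l = 0) (hb : ∀ i l, b ≤ l → g i l = 0) (hJ : a + b ≤ J) :
    ∑ j ∈ Finset.range J, ∑ p ∈ Finset.HasAntidiagonal.antidiagonal j, g p.1 p.2 =
      ∑ i ∈ Finset.range a, ∑ l ∈ Finset.range b, g i l := by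
  rw [Finset.sum_sigma', ← Finset.sum_product' (f := g)]
  symm
  refine Finset.sum_of_injOn (fun x => ⟨x.1 + x.2, x⟩) ?_ ?_ ?_ ?_
  · rintro ⟨a, b⟩ _ ⟨a', b'⟩ _ hab
    simp only [Sigma.mk.injEq] at hab
    exact eq_of_heq hab.2
  · rintro ⟨i, l⟩ hil
    simp only [Finset.coe_product, Finset.coe_range, Set.mem_prod, Set.mem_Iio, Finset.coe_sigma,
      Set.mem_sigma_iff, Finset.mem_coe, Finset.HasAntidiagonal.mem_antidiagonal, and_true] at hil ⊢
    omega
  · rintro ⟨c, i, l⟩ hil hnot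
    by_contra hne
    refine hnot ⟨(i, l), ?_, ?_⟩
    · simp only [Finset.coe_product, Finset.coe_range, Set.mem_prod, Set.mem_Iio]
      exact ⟨not_le.1 fun h => hne (ha _ _ h), not_le.1 fun h => hne (hb _ _ h)⟩
    · have := Finset.HasAntidiagonal.mem_antidiagonal.1 (Finset.mem_sigma.1 hil).2
      simp only at this ⊢
      subst this
      rfl
  · rintro ⟨a, b⟩ _
    rfl

section Series

variable {K W V : Type*} [Field K] [CharZero K] [Fintype W] [DecidableEq W] [AddCommGroup V]
  [Module K V]

/-- The product of a family of coefficients with a power series in the struts. -/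
noncomputable def psmul (a : MvPowerSeries (Sym2 W) K) (p : (Sym2 W →₀ ℕ) → V) :
    (Sym2 W →₀ ℕ) → V :=
  fun m => ∑ x ∈ Finset.HasAntidiagonal.antidiagonal m, coeff x.2 a • p x.1

theorem psmul_smul (c : K) (a : MvPowerSeries (Sym2 W) K) (p : (Sym2 W →₀ ℕ) → V) :
    psmul (c • a) p = c • psmul a p := by
  ext m
  simp only [psmul, map_smul, smul_assoc, Finset.smul_sum, Pi.smul_apply]

theorem psmul_sum {ι : Type*} (s : Finset ι) (a : ι → MvPowerSeries (Sym2 W) K)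
    (p : (Sym2 W →₀ ℕ) → V) : psmul (∑ i ∈ s, a i) p = ∑ i ∈ s, psmul (a i) p := by
  ext m
  simp only [psmul, map_sum, Finset.sum_smul, Finset.sum_apply]
  rw [Finset.sum_comm]

theorem psmul_mul (a b : MvPowerSeries (Sym2 W) K) (p : (Sym2 W →₀ ℕ) → V) :
    psmul (a * b) p = psmul a (psmul b p) := by
  ext m
  simp only [psmul, coeff_mul, Finset.sum_smul, Finset.smul_sum, Finset.sum_sigma', smul_smul]
  symm
  apply Finset.sum_nbij' (fun ⟨⟨_i, j⟩, ⟨k, l⟩⟩ ↦ ⟨(k, j + l), (j, l)⟩)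
    (fun ⟨⟨k, _⟩, ⟨j, l⟩⟩ ↦ ⟨(k + l, j), (k, l)⟩) <;> rintro ⟨⟨i, j⟩, ⟨k, l⟩⟩ h <;>
    simp only [Finset.mem_sigma, Finset.HasAntidiagonal.mem_antidiagonal] at h ⊢ <;>
    obtain ⟨rfl, rfl⟩ := h <;> simp [add_comm, add_left_comm]

theorem psmul_one (p : (Sym2 W →₀ ℕ) → V) : psmul (1 : MvPowerSeries (Sym2 W) K) p = p := by
  ext m
  rw [psmul, Finset.sum_eq_single (m, 0)]
  · simp
  · rintro ⟨i, j⟩ hij hne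
    rw [coeff_one, if_neg, zero_smul]
    rintro rfl
    exact hne (by simpa using hij)
  · simp

theorem psmul_X (a b : W) (f : (Sym2 W →₀ ℕ) →₀ V) :
    psmul (X s(a, b) : MvPowerSeries (Sym2 W) K) f = mulStrut K a b f := by
  ext m
  induction f using Finsupp.induction_linear with
  | zero => simp [psmul]
  | add f g hf hg =>
    rw [map_add, Finsupp.add_apply, ← hf, ← hg]
    simp only [psmul, Finsupp.add_apply, smul_add, Finset.sum_add_distrib]
  | single n u =>
    rw [mulStrut, mulStruts_single, psmul]
    by_cases h : n + Finsupp.single s(a, b) 1 = m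
    · rw [Finset.sum_eq_single (n, Finsupp.single s(a, b) 1)]
      · simp [coeff_X, h]
      · rintro ⟨i, j⟩ _ hne
        rw [coeff_X]
        split_ifs with hj
        · rw [Finsupp.single_eq_of_ne, smul_zero]
          rintro rfl
          exact hne (by rw [← hj])
        · rw [zero_smul]
      · intro h'
        exact absurd (Finset.HasAntidiagonal.mem_antidiagonal.2 h) h'
    · rw [Finsupp.single_eq_of_ne (Ne.symm h)]
      refine Finset.sum_eq_zero ?_
      rintro ⟨i, j⟩ hij
      rw [Finset.HasAntidiagonal.mem_antidiagonal] at hij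
      rw [coeff_X]
      split_ifs with hj
      · rw [Finsupp.single_eq_of_ne, smul_zero]
        rintro rfl
        exact h (by rw [← hij, ← hj])
      · rw [zero_smul]

/-- The quadratic with a given matrix, as a power series. -/
noncomputable def quadSeries : Matrix W W K →ₗ[K] MvPowerSeries (Sym2 W) K :=
  matSum fun a b => X s(a, b)

theorem quadSeries_transpose (N : Matrix W W K) : quadSeries Nᵀ = quadSeries N := by
  rw [quadSeries, matSum_transpose]
  congr 2
  ext a b : 2
  rw [Sym2.eq_swap]

theorem psmul_quadSeries (N : Matrix W W K) (f : (Sym2 W →₀ ℕ) →₀ V) :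
    psmul (quadSeries N) f = strutMat N f := by
  rw [quadSeries, matSum_apply, strutMat, matSum_apply]
  simp only [psmul_sum, psmul_smul, psmul_X]
  ext m
  simp [Finset.sum_apply, LinearMap.sum_apply, Finsupp.finsetSum_apply]

theorem psmul_quadSeries_pow (N : Matrix W W K) (k : ℕ) (f : (Sym2 W →₀ ℕ) →₀ V) :
    psmul (quadSeries N ^ k) f = (strutMat N ^ k) f := by
  induction k generalizing f with
  | zero => rw [pow_zero, pow_zero, psmul_one, Module.End.one_apply]
  | succ k ih => rw [pow_succ, psmul_mul, psmul_quadSeries, ih, pow_succ, Module.End.mul_apply]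

theorem constantCoeff_quadSeries (N : Matrix W W K) : constantCoeff (quadSeries N) = 0 := by
  simp [quadSeries, matSum_apply, map_sum]

theorem coeff_quadSeries_pow_eq_zero (N : Matrix W W K) {m : Sym2 W →₀ ℕ} {k : ℕ}
    (h : m.degree < k) : coeff m (quadSeries N ^ k) = 0 :=
  coeff_eq_zero_of_constantCoeff_nilpotent (m := 1)
    (by rw [pow_one, constantCoeff_quadSeries]) (by omega)

/-- The exponential of a quadratic. -/
noncomputable def expQuad (N : Matrix W W K) : MvPowerSeries (Sym2 W) K :=
  (PowerSeries.exp K).subst (quadSeries N)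

theorem coeff_expQuad (N : Matrix W W K) {m : Sym2 W →₀ ℕ} {J : ℕ} (hJ : m.degree < J) :
    coeff m (expQuad N) =
      ∑ k ∈ Finset.range J, (k.factorial : K)⁻¹ * coeff m (quadSeries N ^ k) := by
  rw [expQuad, PowerSeries.coeff_subst (PowerSeries.HasSubst.of_constantCoeff_zero
    (constantCoeff_quadSeries N)), finsum_eq_sum_of_support_subset (s := Finset.range J)]
  · simp [PowerSeries.coeff_exp]
  · intro k hk
    by_contra h
    refine hk ?_
    simp only [Finset.coe_range, Set.mem_Iio, not_lt] at h
    simp only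
    rw [coeff_quadSeries_pow_eq_zero N (lt_of_lt_of_le hJ h), smul_zero]

theorem strutMat_pow_apply_eq_zero (N : Matrix W W K) (f : (Sym2 W →₀ ℕ) →₀ V)
    {m : Sym2 W →₀ ℕ} {k : ℕ} (h : m.degree < k) : (strutMat N ^ k) f m = 0 := by
  rw [← psmul_quadSeries_pow, psmul]
  refine Finset.sum_eq_zero fun x hx => ?_
  have h1 : x.2 ≤ m := by
    rw [← Finset.HasAntidiagonal.mem_antidiagonal.1 hx]
    exact le_add_self
  rw [coeff_quadSeries_pow_eq_zero N (lt_of_le_of_lt (Finsupp.degree_mono h1) h), zero_smul]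

theorem psmul_expQuad (N : Matrix W W K) (f : (Sym2 W →₀ ℕ) →₀ V) {m : Sym2 W →₀ ℕ} {J : ℕ}
    (hJ : m.degree < J) : psmul (expQuad N) f m =
      (∑ j ∈ Finset.range J, dpow (strutMat N) j f) m := by
  have h : ∀ j, (dpow (strutMat N) j f) m = (j.factorial : K)⁻¹ • psmul (quadSeries N ^ j) f m :=
    fun j => by rw [psmul_quadSeries_pow, dpow]; rfl
  rw [Finsupp.finsetSum_apply]
  simp only [h, psmul, Finset.smul_sum, smul_smul]
  rw [Finset.sum_comm]
  refine Finset.sum_congr rfl fun x hx => ?_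
  have h1 : x.2 ≤ m := by
    rw [← Finset.HasAntidiagonal.mem_antidiagonal.1 hx]
    exact le_add_self
  rw [coeff_expQuad N (lt_of_le_of_lt (Finsupp.degree_mono h1) hJ), Finset.sum_smul]

theorem expQuad_add (N N' : Matrix W W K) : expQuad (N + N') = expQuad N * expQuad N' := by
  ext m
  set J := m.degree + 1
  have hJ : m.degree < J := Nat.lt_succ_self _
  have h1 : ∀ x ∈ Finset.HasAntidiagonal.antidiagonal m, x.1.degree < J ∧ x.2.degree < J := by
    intro x hx
    have h := Finset.HasAntidiagonal.mem_antidiagonal.1 hx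
    have h2 : x.1 ≤ m := by rw [← h]; exact le_self_add
    have h3 : x.2 ≤ m := by rw [← h]; exact le_add_self
    exact ⟨lt_of_le_of_lt (Finsupp.degree_mono h2) hJ, lt_of_le_of_lt (Finsupp.degree_mono h3) hJ⟩
  set g : ℕ → ℕ → K := fun i l => (i.factorial : K)⁻¹ * (l.factorial : K)⁻¹ *
    coeff m (quadSeries N ^ i * quadSeries N' ^ l) with hg
  have h2 : coeff m (expQuad N * expQuad N') =
      ∑ i ∈ Finset.range J, ∑ l ∈ Finset.range J, g i l := by
    rw [coeff_mul, Finset.sum_congr rfl fun x hx => by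
      rw [coeff_expQuad N (h1 x hx).1, coeff_expQuad N' (h1 x hx).2, Finset.sum_mul_sum]]
    rw [Finset.sum_comm]
    refine Finset.sum_congr rfl fun i _ => ?_
    rw [Finset.sum_comm]
    refine Finset.sum_congr rfl fun l _ => ?_
    rw [hg]
    simp only [coeff_mul, Finset.mul_sum]
    refine Finset.sum_congr rfl fun x _ => ?_
    ring
  have h3 : ∀ i l, J ≤ i → g i l = 0 := fun i l hi => by
    simp only [hg, coeff_mul]
    rw [Finset.sum_eq_zero, mul_zero]
    intro x hx
    rw [coeff_quadSeries_pow_eq_zero N (lt_of_lt_of_le (h1 x hx).1 hi), zero_mul]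
  have h4 : ∀ i l, J ≤ l → g i l = 0 := fun i l hi => by
    simp only [hg, coeff_mul]
    rw [Finset.sum_eq_zero, mul_zero]
    intro x hx
    rw [coeff_quadSeries_pow_eq_zero N' (lt_of_lt_of_le (h1 x hx).2 hi), mul_zero]
  -- Truncating at `J + J` makes the antidiagonals cover the whole square of indices below `J`.
  rw [h2, ← sum_range_sum_antidiagonal h3 h4 le_rfl, coeff_expQuad _ (hJ.trans_le (Nat.le_add_left J J))]
  refine Finset.sum_congr rfl fun k _ => ?_
  rw [map_add, Commute.add_pow' (Commute.all _ _), map_sum, Finset.mul_sum]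
  refine Finset.sum_congr rfl fun p hp => ?_
  have hk := Finset.HasAntidiagonal.mem_antidiagonal.1 hp
  have hc : ((p.1 + p.2).choose p.1 : K) * p.1.factorial * p.2.factorial =
      (p.1 + p.2).factorial := by
    rw [Nat.choose_symm_add]
    exact_mod_cast Nat.add_choose_mul_factorial_mul_factorial p.1 p.2
  have h5 := Nat.cast_ne_zero (R := K).2 (Nat.factorial_ne_zero (p.1 + p.2))
  have h6 := Nat.cast_ne_zero (R := K).2 (Nat.factorial_ne_zero p.1)
  have h7 := Nat.cast_ne_zero (R := K).2 (Nat.factorial_ne_zero p.2)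
  rw [hg, map_nsmul, nsmul_eq_mul, ← mul_assoc, ← hk]
  simp only
  congr 1
  field_simp
  rw [← hc]

theorem expQuad_zero : expQuad (0 : Matrix W W K) = 1 := by
  ext m
  rw [coeff_expQuad _ (Nat.lt_succ_self _), Finset.sum_range_succ', map_zero]
  simp

/-- Power series in a given set of struts. -/
def IsSupportedOn (E : Set (Sym2 W)) (a : MvPowerSeries (Sym2 W) K) : Prop :=
  ∀ m, coeff m a ≠ 0 → ∀ e, m e ≠ 0 → e ∈ E

variable {E : Set (Sym2 W)}

theorem IsSupportedOn.mul {a b : MvPowerSeries (Sym2 W) K} (ha : IsSupportedOn E a)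
    (hb : IsSupportedOn E b) : IsSupportedOn E (a * b) := by
  intro m hm e he
  rw [coeff_mul] at hm
  obtain ⟨x, hx, hne⟩ := Finset.exists_ne_zero_of_sum_ne_zero hm
  rw [← Finset.HasAntidiagonal.mem_antidiagonal.1 hx, Finsupp.add_apply] at he
  rcases (by omega : x.1 e ≠ 0 ∨ x.2 e ≠ 0) with h | h
  · exact ha _ (left_ne_zero_of_mul hne) e h
  · exact hb _ (right_ne_zero_of_mul hne) e h

theorem IsSupportedOn.pow {a : MvPowerSeries (Sym2 W) K} (ha : IsSupportedOn E a) (k : ℕ) :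
    IsSupportedOn E (a ^ k) := by
  induction k with
  | zero =>
    intro m hm e he
    rw [pow_zero, coeff_one] at hm
    have : m = 0 := by by_contra h; exact hm (if_neg h)
    simp [this] at he
  | succ k ih => rw [pow_succ]; exact ih.mul ha

theorem isSupportedOn_quadSeries {N : Matrix W W K} (h : ∀ a b, N a b ≠ 0 → s(a, b) ∈ E) :
    IsSupportedOn E (quadSeries N) := by
  intro m hm e he
  rw [quadSeries, matSum_apply, map_sum] at hm
  obtain ⟨a, -, ha⟩ := Finset.exists_ne_zero_of_sum_ne_zero hm
  rw [map_sum] at ha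
  obtain ⟨b, -, hb⟩ := Finset.exists_ne_zero_of_sum_ne_zero ha
  rw [map_smul, smul_eq_mul] at hb
  have hm' : m = Finsupp.single s(a, b) 1 := by
    by_contra h'
    rw [coeff_X, if_neg h', mul_zero] at hb
    exact hb rfl
  have he' : e = s(a, b) := by
    by_contra h'
    rw [hm', Finsupp.single_eq_of_ne h'] at he
    exact he rfl
  rw [he']
  exact h a b (left_ne_zero_of_mul hb)

theorem IsSupportedOn.expQuad {N : Matrix W W K} (h : IsSupportedOn E (quadSeries N)) :
    IsSupportedOn E (expQuad N) := by
  intro m hm e he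
  rw [coeff_expQuad _ (Nat.lt_succ_self _)] at hm
  obtain ⟨k, -, hk⟩ := Finset.exists_ne_zero_of_sum_ne_zero hm
  exact h.pow k m (right_ne_zero_of_mul hk) e he

theorem coeff_zero_expQuad (N : Matrix W W K) : coeff 0 (expQuad N) = 1 := by
  rw [coeff_expQuad (J := 1) _ (by simp)]
  simp

/-- Only the linear term of the exponential contributes: the coefficient is `N a b + N b a` off the
diagonal and `N a a` on it. So the exponential determines the symmetric matrix. -/
theorem coeff_single_expQuad {N : Matrix W W K} (hN : Nᵀ = N) {a b : W}
    (h : coeff (Finsupp.single s(a, b) 1) (expQuad N) = 0) : N a b = 0 := by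
  rw [coeff_expQuad (J := 2) _ (by simp), Finset.sum_range_succ, Finset.sum_range_one] at h
  simp only [pow_zero, pow_one, coeff_one, Finsupp.single_eq_zero, one_ne_zero, if_false, mul_zero,
    zero_add, Nat.factorial_one, Nat.cast_one, inv_one, one_mul] at h
  rw [quadSeries, matSum_apply] at h
  simp only [map_sum, map_smul, coeff_X, smul_eq_mul, mul_ite, mul_one, mul_zero] at h
  have h1 : ∀ a' b' : W, (if Finsupp.single s(a, b) 1 = Finsupp.single s(a', b') 1 then N a' b'
      else 0) = (if a = a' then if b = b' then N a' b' else 0 else 0) +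
        if a = b then 0 else if b = a' then if a = b' then N a' b' else 0 else 0 := by
    intro a' b'
    simp only [Finsupp.single_left_inj one_ne_zero, Sym2.eq_iff]
    split_ifs <;> simp_all
  have h2 : N b a = N a b := congrFun (congrFun hN a) b
  simp only [h1, Finset.sum_add_distrib] at h
  by_cases hab : a = b
  · subst hab
    simpa using h
  · simpa [hab, h2] using h

end Series

open Filter LegAction

/-! ### From finite to infinite sums -/

section Extension

variable {K W V : Type*} [Field K] [CharZero K] [Fintype W] [DecidableEq W] [AddCommGroup V]
  [Module K V]

/-- No strut in the support has both ends labeled in `A`. -/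
def IsSubstantialFamily (A : Finset W) (p : (Sym2 W →₀ ℕ) → V) : Prop :=
  ∀ m, ¬ IsSubstantialExponent A m → p m = 0

/-- Each coefficient of a value of `T` depends on finitely many substantial coefficients of the
argument. -/
def IsLocal (A : Finset W) (T : Module.End K ((Sym2 W →₀ ℕ) →₀ V)) : Prop :=
  ∀ m, ∃ s : Finset (Sym2 W →₀ ℕ), ∀ m', IsSubstantialExponent A m' → ∀ u,
    T (Finsupp.single m' u) m ≠ 0 → m' ∈ s

/-- The extension of an operator from finite to infinite sums. -/
noncomputable def extend (T : Module.End K ((Sym2 W →₀ ℕ) →₀ V)) (p : (Sym2 W →₀ ℕ) → V) :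
    (Sym2 W →₀ ℕ) → V :=
  fun m => ∑ᶠ m', T (Finsupp.single m' (p m')) m

/-- A finite part of an infinite sum. -/
noncomputable def truncate (s : Finset (Sym2 W →₀ ℕ)) (p : (Sym2 W →₀ ℕ) → V) :
    (Sym2 W →₀ ℕ) →₀ V :=
  ∑ m ∈ s, Finsupp.single m (p m)

theorem truncate_apply_of_mem {s : Finset (Sym2 W →₀ ℕ)} {m : Sym2 W →₀ ℕ} (h : m ∈ s)
    (p : (Sym2 W →₀ ℕ) → V) : truncate s p m = p m := by
  rw [truncate, Finsupp.finsetSum_apply, Finset.sum_eq_single m, Finsupp.single_eq_same]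
  · exact fun m' _ hm' => Finsupp.single_eq_of_ne hm'.symm
  · exact fun h' => absurd h h'

theorem truncate_congr {s : Finset (Sym2 W →₀ ℕ)} {p q : (Sym2 W →₀ ℕ) → V}
    (h : ∀ m ∈ s, p m = q m) : truncate s p = truncate s q :=
  Finset.sum_congr rfl fun m hm => by rw [h m hm]

variable {A X : Finset W}

theorem IsSubstantialFamily.truncate {p : (Sym2 W →₀ ℕ) → V} (hp : IsSubstantialFamily A p)
    (s : Finset (Sym2 W →₀ ℕ)) : IsSubstantialFamily A (truncate s p) := by
  intro m hm
  rw [FormalGaussian.truncate, Finsupp.finsetSum_apply]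
  refine Finset.sum_eq_zero fun m' _ => ?_
  by_cases h : m = m'
  · rw [← h, hp m hm, Finsupp.single_zero, Finsupp.zero_apply]
  · exact Finsupp.single_eq_of_ne h

theorem eventually_truncate_apply (p : (Sym2 W →₀ ℕ) → V) (m : Sym2 W →₀ ℕ) :
    ∀ᶠ s in atTop, truncate s p m = p m := by
  filter_upwards [eventually_ge_atTop {m}] with s hs
  exact truncate_apply_of_mem (hs (Finset.mem_singleton_self m)) p

theorem eventually_psmul_truncate (a : MvPowerSeries (Sym2 W) K) (p : (Sym2 W →₀ ℕ) → V)
    (m : Sym2 W →₀ ℕ) : ∀ᶠ s in atTop, psmul a (truncate s p) m = psmul a p m := by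
  have h : ∀ᶠ s in atTop, ∀ x ∈ Finset.HasAntidiagonal.antidiagonal m,
      truncate s p x.1 = p x.1 :=
    (Finset.eventually_all _).2 fun x _ => eventually_truncate_apply p x.1
  filter_upwards [h] with s hs
  exact Finset.sum_congr rfl fun x hx => by rw [hs x hx]

/-- The finite set depends on `m` but not on the family `p`; this uniformity allows extensions to be
composed. -/
theorem IsLocal.exists_extend_eq {T : Module.End K ((Sym2 W →₀ ℕ) →₀ V)} (hT : IsLocal A T)
    (m : Sym2 W →₀ ℕ) : ∃ s : Finset (Sym2 W →₀ ℕ), ∀ s', s ⊆ s' → ∀ p : (Sym2 W →₀ ℕ) → V,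
      IsSubstantialFamily A p → extend T p m = T (truncate s' p) m := by
  obtain ⟨s, hs⟩ := hT m
  refine ⟨s, fun s' hs' p hp => ?_⟩
  rw [extend, truncate, map_sum, Finsupp.finsetSum_apply, finsum_eq_sum_of_support_subset]
  intro m' hm'
  by_cases h : IsSubstantialExponent A m'
  · exact hs' (hs m' h _ hm')
  · refine absurd ?_ hm'
    simp only
    rw [hp m' h, Finsupp.single_zero, map_zero, Finsupp.zero_apply]

theorem IsLocal.eventually_extend_eq {T : Module.End K ((Sym2 W →₀ ℕ) →₀ V)} (hT : IsLocal A T)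
    {p : (Sym2 W →₀ ℕ) → V} (hp : IsSubstantialFamily A p) (m : Sym2 W →₀ ℕ) :
    ∀ᶠ s in atTop, T (truncate s p) m = extend T p m := by
  obtain ⟨s, hs⟩ := hT.exists_extend_eq m
  filter_upwards [eventually_ge_atTop s] with s' hs'
  exact (hs s' hs' p hp).symm

theorem extend_coe (T : Module.End K ((Sym2 W →₀ ℕ) →₀ V)) (f : (Sym2 W →₀ ℕ) →₀ V) :
    extend T f = T f := by
  ext m
  conv_rhs => rw [← Finsupp.sum_single f]
  rw [extend, Finsupp.sum, map_sum, Finsupp.finsetSum_apply, finsum_eq_sum_of_support_subset]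
  intro m' hm'
  by_contra h
  refine hm' ?_
  rw [Finset.mem_coe, Finsupp.mem_support_iff, not_not] at h
  simp only
  rw [h, Finsupp.single_zero, map_zero, Finsupp.zero_apply]

theorem extend_zero (T : Module.End K ((Sym2 W →₀ ℕ) →₀ V)) : extend T 0 = 0 :=
  extend_coe T 0 |>.trans (by rw [map_zero]; rfl)

theorem IsSubstantialFamily.extend {T : Module.End K ((Sym2 W →₀ ℕ) →₀ V)} (hT : IsLocal A T)
    (h : ∀ f : (Sym2 W →₀ ℕ) →₀ V, IsSubstantialFamily A f → IsSubstantialFamily A (T f))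
    {p : (Sym2 W →₀ ℕ) → V} (hp : IsSubstantialFamily A p) :
    IsSubstantialFamily A (extend T p) := by
  intro m hm
  obtain ⟨s, hs⟩ := hT.exists_extend_eq m
  rw [hs s subset_rfl p hp]
  exact h _ (hp.truncate s) m hm

/-- A coefficient of the left side reads finitely many coefficients of `extend U p`, and each of
these finitely many of `p`. A large truncation of `p` agrees with all of them, which reduces the
claim to finite sums. -/
theorem extend_extend {T U : Module.End K ((Sym2 W →₀ ℕ) →₀ V)} (hT : IsLocal A T)
    (hU : IsLocal A U) (hTU : IsLocal A (T * U))
    (h : ∀ f : (Sym2 W →₀ ℕ) →₀ V, IsSubstantialFamily A f → IsSubstantialFamily A (U f))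
    {p : (Sym2 W →₀ ℕ) → V} (hp : IsSubstantialFamily A p) :
    extend T (extend U p) = extend (T * U) p := by
  ext m
  obtain ⟨s, hs⟩ := hT.exists_extend_eq m
  have h1 : ∀ᶠ s' in atTop, ∀ m' ∈ s, U (truncate s' p) m' = extend U p m' :=
    (Finset.eventually_all _).2 fun m' _ => hU.eventually_extend_eq hp m'
  obtain ⟨s', h2, h3⟩ := (h1.and (hTU.eventually_extend_eq hp m)).exists
  rw [hs s subset_rfl _ (hp.extend hU h), ← truncate_congr h2,
    ← hs s subset_rfl _ (h _ (hp.truncate s')), extend_coe, ← h3, Module.End.mul_apply]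

/-- Multiplication by `a` is the sum of the operators `α j`. -/
def IsExpansion (a : MvPowerSeries (Sym2 W) K)
    (α : ℕ → Module.End K ((Sym2 W →₀ ℕ) →₀ V)) : Prop :=
  ∀ m, ∃ n : ℕ, ∀ f, (∀ j, n ≤ j → α j f m = 0) ∧
    psmul a f m = (∑ j ∈ Finset.range n, α j f) m

theorem IsExpansion.exists_eq {a : MvPowerSeries (Sym2 W) K}
    {α : ℕ → Module.End K ((Sym2 W →₀ ℕ) →₀ V)} (h : IsExpansion a α) (m : Sym2 W →₀ ℕ) :
    ∃ n : ℕ, ∀ J, n ≤ J → ∀ f : (Sym2 W →₀ ℕ) →₀ V,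
      psmul a f m = (∑ j ∈ Finset.range J, α j f) m := by
  obtain ⟨n, hn⟩ := h m
  refine ⟨n, fun J hJ f => ?_⟩
  rw [(hn f).2, Finsupp.finsetSum_apply, Finsupp.finsetSum_apply]
  refine Finset.sum_subset (Finset.range_mono hJ) fun j _ hj => (hn f).1 j ?_
  simpa using hj

theorem isExpansion_expQuad (N : Matrix W W K) :
    IsExpansion (expQuad N) (dpow (strutMat (V := V) N)) := by
  refine fun m => ⟨m.degree + 1, fun f => ⟨fun j hj => ?_, psmul_expQuad N f (Nat.lt_succ_self _)⟩⟩
  rw [dpow, LinearMap.smul_apply, Finsupp.smul_apply, strutMat_pow_apply_eq_zero N f hj, smul_zero]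

theorem isExpansion_expQuad_dpowSq (N : Matrix W W K) :
    IsExpansion (expQuad N) (dpowSq (strutMat (V := V) N)) := by
  refine fun m => ⟨2 * (m.degree + 1), fun f => ⟨fun j hj => ?_, ?_⟩⟩
  · rw [dpowSq]
    split_ifs
    · rw [dpow, LinearMap.smul_apply, Finsupp.smul_apply,
        strutMat_pow_apply_eq_zero N f (by omega), smul_zero]
    · rfl
  · rw [← LinearMap.sum_apply, sum_dpowSq, LinearMap.sum_apply]
    exact psmul_expQuad N f (Nat.lt_succ_self _)

/-- The operator form of `Ψ ∘ a = b ∘ U`, assembled from its homogeneous parts `h`. Near a given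
coefficient, `p` may be truncated and the expansion of `a` cut off, both far enough not to matter;
then only a finite double sum has to be rearranged. -/
theorem extend_psmul {a b : MvPowerSeries (Sym2 W) K}
    {α β τ : ℕ → Module.End K ((Sym2 W →₀ ℕ) →₀ V)} {Ψ U : Module.End K ((Sym2 W →₀ ℕ) →₀ V)}
    (ha : IsExpansion a α) (hb : IsExpansion b β)
    (hτ : ∀ f, ∃ n : ℕ, (∀ l, n ≤ l → τ l f = 0) ∧ U f = ∑ l ∈ Finset.range n, Ψ (τ l f))
    (h : ∀ j, Ψ * α j = ∑ p ∈ Finset.HasAntidiagonal.antidiagonal j, β p.1 * (Ψ * τ p.2))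
    (hΨ : IsLocal X Ψ) (hU : IsLocal A U)
    (hα : ∀ j (f : (Sym2 W →₀ ℕ) →₀ V), IsSubstantialFamily A f → IsSubstantialFamily X (α j f))
    (haX : ∀ p : (Sym2 W →₀ ℕ) → V, IsSubstantialFamily A p → IsSubstantialFamily X (psmul a p))
    {p : (Sym2 W →₀ ℕ) → V} (hp : IsSubstantialFamily A p) :
    extend Ψ (psmul a p) = psmul b (extend U p) := by
  ext m
  obtain ⟨s, hs⟩ := hΨ.exists_extend_eq m
  have h1 : ∀ᶠ s' in atTop, ∀ m' ∈ s, psmul a (truncate s' p) m' = psmul a p m' :=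
    (Finset.eventually_all _).2 fun m' _ => eventually_psmul_truncate a p m'
  have h2 : ∀ᶠ s' in atTop, ∀ x ∈ Finset.HasAntidiagonal.antidiagonal m,
      U (truncate s' p) x.1 = extend U p x.1 :=
    (Finset.eventually_all _).2 fun x _ => hU.eventually_extend_eq hp x.1
  obtain ⟨s', h3, h4⟩ := (h1.and h2).exists
  set g := truncate s' p with hg
  have hgA : IsSubstantialFamily A g := hp.truncate s'
  choose n₁ hn₁ using fun m' => ha.exists_eq m'
  obtain ⟨n₂, hn₂⟩ := hb m
  obtain ⟨n₃, hn₃, hn₄⟩ := hτ g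
  -- The first bound makes the expansion of `a` exact at all coefficients in `s`; the second makes
  -- the antidiagonals cover all nonzero terms on the right.
  set J := max (s.sup n₁) (n₂ + n₃) with hJ
  have h5 : ∀ m' ∈ s, psmul a g m' = (∑ j ∈ Finset.range J, α j g) m' := fun m' hm' =>
    hn₁ m' J ((Finset.le_sup hm').trans (le_max_left _ _)) g
  have h6 : IsSubstantialFamily X (∑ j ∈ Finset.range J, α j g : (Sym2 W →₀ ℕ) →₀ V) := by
    intro m' hm'
    rw [Finsupp.finsetSum_apply]
    exact Finset.sum_eq_zero fun j _ => hα j g hgA m' hm'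
  have h7 : psmul b (extend U p) m = psmul b (U g) m :=
    Finset.sum_congr rfl fun x hx => by rw [h4 x hx]
  rw [hs s subset_rfl _ (haX p hp), ← truncate_congr h3, truncate_congr h5, ← hs s subset_rfl _ h6,
    extend_coe, h7, (hn₂ _).2, map_sum, Finsupp.finsetSum_apply]
  have h8 : ∀ j, Ψ (α j g) m = ∑ x ∈ Finset.HasAntidiagonal.antidiagonal j,
      (β x.1 (Ψ (τ x.2 g))) m := fun j => by
    rw [← Module.End.mul_apply, h, LinearMap.sum_apply, Finsupp.finsetSum_apply]
    rfl
  simp only [h8]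
  rw [sum_range_sum_antidiagonal (g := fun i l => (β i (Ψ (τ l g))) m) (a := n₂) (b := n₃)
    (fun i l hi => (hn₂ _).1 i hi) (fun i l hl => by simp only [hn₃ l hl, map_zero, Finsupp.zero_apply])
    (le_max_right _ _), Finsupp.finsetSum_apply]
  refine Finset.sum_congr rfl fun i _ => ?_
  rw [hn₄, map_sum, Finsupp.finsetSum_apply]

theorem IsSubstantialFamily.psmul {E : Set (Sym2 W)} {a : MvPowerSeries (Sym2 W) K}
    (ha : IsSupportedOn E a) (hE : ∀ x ∈ X, ∀ y ∈ X, s(x, y) ∉ E) {p : (Sym2 W →₀ ℕ) → V}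
    (hp : IsSubstantialFamily X p) : IsSubstantialFamily X (psmul a p) := by
  intro m hm
  refine Finset.sum_eq_zero fun z hz => ?_
  rw [IsSubstantialExponent] at hm
  push Not at hm
  obtain ⟨x, hx, y, hy, hxy⟩ := hm
  rw [← Finset.HasAntidiagonal.mem_antidiagonal.1 hz, Finsupp.add_apply] at hxy
  rcases (by omega : z.1 s(x, y) ≠ 0 ∨ z.2 s(x, y) ≠ 0) with h | h
  · rw [hp z.1 fun h' => h (h' x hx y hy), smul_zero]
  · have : coeff z.2 a = 0 := by
      by_contra h'
      exact hE x hx y hy (ha z.2 h' _ h)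
    rw [this, zero_smul]

theorem IsSubstantialFamily.dpow_strutMat {E : Set (Sym2 W)} {N : Matrix W W K}
    (hN : IsSupportedOn E (quadSeries N)) (hE : ∀ x ∈ X, ∀ y ∈ X, s(x, y) ∉ E) (j : ℕ)
    {f : (Sym2 W →₀ ℕ) →₀ V} (hf : IsSubstantialFamily X f) :
    IsSubstantialFamily X (dpow (strutMat N) j f) := by
  intro m hm
  rw [dpow, LinearMap.smul_apply, Finsupp.smul_apply, ← psmul_quadSeries_pow,
    hf.psmul (hN.pow j) hE m hm, smul_zero]

theorem IsSubstantialFamily.mono (h : X ⊆ A) {p : (Sym2 W →₀ ℕ) → V}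
    (hp : IsSubstantialFamily A p) : IsSubstantialFamily X p :=
  fun m hm => hp m fun h' => hm fun x hx y hy => h' x (h hx) y (h hy)

end Extension

/-! ### Operators that create no strut inside a set of labels -/

section Preserve

variable {K W V : Type*} [Field K] [CharZero K] [Fintype W] [DecidableEq W] [AddCommGroup V]
  [Module K V]

/-- The finite sums of diagrams without struts with both ends labeled in `A`. -/
def substantial (K V : Type*) [Field K] [AddCommGroup V] [Module K V] (A : Finset W) :
    Submodule K ((Sym2 W →₀ ℕ) →₀ V) :=
  Finsupp.supported V K {m | IsSubstantialExponent A m}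

variable {A : Finset W}

theorem mem_substantial_iff {f : (Sym2 W →₀ ℕ) →₀ V} :
    f ∈ substantial K V A ↔ IsSubstantialFamily A f := by
  rw [substantial, Finsupp.mem_supported]
  refine ⟨fun h m hm => ?_, fun h m hm => ?_⟩
  · by_contra h'
    exact hm (h (Finsupp.mem_support_iff.2 h'))
  · by_contra h'
    exact Finsupp.mem_support_iff.1 hm (h m h')

theorem single_mem_substantial {m : Sym2 W →₀ ℕ} (hm : IsSubstantialExponent A m) (u : V) :
    Finsupp.single m u ∈ substantial K V A :=
  Finsupp.single_mem_supported K u hm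

theorem substantial_le_comap {T : Module.End K ((Sym2 W →₀ ℕ) →₀ V)}
    (h : ∀ m, IsSubstantialExponent A m → ∀ u, T (Finsupp.single m u) ∈ substantial K V A) :
    substantial K V A ≤ (substantial K V A).comap T := by
  intro f hf
  rw [Submodule.mem_comap, ← Finsupp.sum_single f, Finsupp.sum, map_sum]
  exact Submodule.sum_mem _ fun m hm => h m ((Finsupp.mem_supported K f).1 hf hm) _

theorem LegAction.IsSubstantialExponent.sub {m : Sym2 W →₀ ℕ} (hm : IsSubstantialExponent A m)
    (n : Sym2 W →₀ ℕ) : IsSubstantialExponent A (m - n) := fun x hx y hy => by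
  rw [Finsupp.tsub_apply, hm x hx y hy, Nat.zero_sub]

theorem LegAction.IsSubstantialExponent.add_single {m : Sym2 W →₀ ℕ} (hm : IsSubstantialExponent A m)
    {a b : W} (h : b ∉ A) : IsSubstantialExponent A (m + Finsupp.single s(a, b) 1) := by
  intro x hx y hy
  rw [Finsupp.add_apply, hm x hx y hy, Finsupp.single_eq_of_ne, zero_add]
  intro h'
  rcases Sym2.eq_iff.1 h' with ⟨-, rfl⟩ | ⟨rfl, -⟩
  · exact h hy
  · exact h hx

theorem removeStrut_single_mem {m : Sym2 W →₀ ℕ} (hm : IsSubstantialExponent A m) (x w : W)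
    (u : V) : removeStrut K x w (Finsupp.single m u) ∈ substantial K V A := by
  rw [removeStrut_single]
  exact Submodule.smul_of_tower_mem _ _ (single_mem_substantial (hm.sub _) u)

/-- The removed strut has its end `x` in `A`, so its other end lies outside `A`; the new strut
inherits this end. -/
theorem mulStrut_removeStrut_single_mem {m : Sym2 W →₀ ℕ} (hm : IsSubstantialExponent A m)
    {x : W} (hx : x ∈ A) (a w : W) (u : V) :
    mulStrut K a w (removeStrut K x w (Finsupp.single m u)) ∈ substantial K V A := by
  rw [removeStrut_single]
  by_cases hw : w ∈ A
  · rw [strutEnds_eq_zero (hm x hx w hw), zero_smul, map_zero]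
    exact zero_mem _
  · rw [map_nsmul, mulStrut_single]
    exact Submodule.smul_of_tower_mem _ _ (single_mem_substantial ((hm.sub _).add_single hw) u)

theorem substantial_le_comap_coeffwise (T : Module.End K V) :
    substantial K V A ≤ (substantial K V A).comap (coeffwise (W := W) T) :=
  substantial_le_comap fun m hm u => by
    rw [coeffwise_single]
    exact single_mem_substantial hm _

theorem LegAction.substantial_le_comap_moveLeg (ρ : LegAction K W V) {x : W} (hx : x ∈ A) (w : W) :
    substantial K V A ≤ (substantial K V A).comap (ρ.moveLeg x w) :=
  substantial_le_comap fun m hm u => by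
    rw [moveLeg, LinearMap.add_apply, LinearMap.sum_apply]
    refine add_mem (substantial_le_comap_coeffwise _ (single_mem_substantial hm u))
      (Submodule.sum_mem _ fun w' _ => mulStrut_removeStrut_single_mem hm hx _ _ _)

theorem LegAction.substantial_le_comap_join (ρ : LegAction K W V) (x : W) {y : W}
    (hy : y ∈ A) : substantial K V A ≤ (substantial K V A).comap (ρ.join x y) :=
  substantial_le_comap fun m hm u => by
    simp only [join, LinearMap.add_apply, LinearMap.sum_apply, Module.End.mul_apply]
    refine add_mem (add_mem (add_mem ?_ ?_) ?_) ?_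
    · exact substantial_le_comap_coeffwise _ (single_mem_substantial hm u)
    · exact Submodule.sum_mem _ fun w _ =>
        substantial_le_comap_coeffwise _ (removeStrut_single_mem hm _ _ _)
    · exact Submodule.sum_mem _ fun w _ =>
        substantial_le_comap_coeffwise _ (removeStrut_single_mem hm _ _ _)
    · refine Submodule.sum_mem _ fun w _ => Submodule.sum_mem _ fun w' _ => ?_
      rw [removeStrut_single x w, map_nsmul, map_nsmul]
      exact Submodule.smul_of_tower_mem _ _ (mulStrut_removeStrut_single_mem (hm.sub _) hy _ _ _)

theorem matSum_inclMat_le_comap {M : Type*} [AddCommGroup M] [Module K M] {S : Submodule K M}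
    {φ : W → W → Module.End K M} {X Y : Finset W} (N : Matrix X Y K)
    (h : ∀ x ∈ X, ∀ y ∈ Y, S ≤ S.comap (φ x y)) :
    S ≤ S.comap (matSum φ (inclMat K X * N * (inclMat K Y)ᵀ)) := by
  intro f hf
  rw [matSum_inclMat, Submodule.mem_comap, LinearMap.sum_apply]
  refine Submodule.sum_mem _ fun x _ => ?_
  rw [LinearMap.sum_apply]
  exact Submodule.sum_mem _ fun y _ => S.smul_mem _ (h x x.2 y y.2 hf)

theorem le_comap_lexp {M : Type*} [AddCommGroup M] [Module K M] {S : Submodule K M}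
    {T : Module.End K M} (hT : IsLocNil T) (h : S ≤ S.comap T) : S ≤ S.comap (lexp T) := by
  intro f hf
  obtain ⟨n, hn⟩ := hT f
  rw [Submodule.mem_comap, lexp_apply_eq_sum hT hn]
  refine Submodule.sum_mem _ fun k hk => S.smul_mem _ ?_
  clear hn hk
  induction k with
  | zero => exact hf
  | succ k ih =>
    rw [pow_succ', Module.End.mul_apply]
    exact h ih

variable {X Y : Finset W} {ρ : LegAction K W V}

theorem LegAction.substantial_le_comap_gaussOp (h : X ⊆ A) (N : Matrix X X K) :
    substantial K V A ≤ (substantial K V A).comap (ρ.gaussOp N) := by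
  have h1 : substantial K V A ≤
      (substantial K V A).comap (ρ.joinMat (inclMat K X * N * (inclMat K X)ᵀ)) :=
    matSum_inclMat_le_comap N fun x _ y hy => ρ.substantial_le_comap_join x (h hy)
  intro f hf
  rw [gaussOp, map_smul, Submodule.mem_comap, LinearMap.smul_apply]
  exact Submodule.smul_mem _ _ (h1 hf)

theorem LegAction.substantial_le_comap_shiftOp (h : X ⊆ A) (M : Matrix X Y K) :
    substantial K V A ≤ (substantial K V A).comap (ρ.shiftOp M) := by
  have h1 : substantial K V A ≤
      (substantial K V A).comap (ρ.moveMat (inclMat K X * M * (inclMat K Y)ᵀ)) :=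
    matSum_inclMat_le_comap M fun x hx y _ => ρ.substantial_le_comap_moveLeg (h hx) y
  intro f hf
  rw [shiftOp, map_neg, Submodule.mem_comap, LinearMap.neg_apply]
  exact Submodule.neg_mem _ (h1 hf)

theorem LegAction.substantial_le_comap_gaussPairing (hρ : ρ.IsBounded) (h : X ⊆ A)
    {P : Module.End K ((Sym2 W →₀ ℕ) →₀ V)}
    (hP : substantial K V A ≤ (substantial K V A).comap P) (N : Matrix X X K) :
    substantial K V A ≤ (substantial K V A).comap (ρ.gaussPairing P N) := fun _ hf =>
  hP (le_comap_lexp (hρ.isLocNil_gaussOp N) (substantial_le_comap_gaussOp h N) hf)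

end Preserve

/-! ### The integral is well defined -/

namespace InternalRelations

variable {K : Type*} [Field K] [CharZero K] {σ : VertexSignature} {W : Type*} [Fintype W]
  [DecidableEq W] (R : InternalRelations K σ W)

theorem isSubstantial_iff {X : Finset W} {P : R.FormalSum} :
    R.IsSubstantial X P ↔ ∀ d, IsSubstantialFamily X (P d) := by
  refine forall_congr' fun d => forall_congr' fun m => ?_
  rw [IsSubstantialExponent]
  push Not
  rfl

theorem expHalf_eq_expQuad {X : Finset W} (L : Matrix X X K) :
    expHalf L = expQuad ((2 : K)⁻¹ • (inclMat K X * L * (inclMat K X)ᵀ)) := by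
  rw [expHalf, expQuad, map_smul, quadSeries, matSum_inclMat, quadratic, one_div]

theorem negHalfInverse_eq_gaussOp (d : ℕ) {X : Finset W} (L : Matrix X X K) :
    R.negHalfInverse d L = (R.legAction d).gaussOp L⁻¹ := by
  rw [negHalfInverse, gaussOp, map_smul, joinMat, matSum_inclMat, one_div]
  simp only [strutAct_eq_join]

theorem isLocal_of_commute {d : ℕ} {A : Finset W} {T : Module.End K (R.FiniteSum d)}
    (h : Commute T ((R.legAction d).countLegs Aᶜ)) : IsLocal A T := fun m => by
  obtain ⟨s, hs⟩ := (R.legAction_isBounded d).exists_finset A m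
  exact ⟨s, hs T h⟩

/-- The operator computing the formal Gaussian integral in doubled degree `d`. -/
noncomputable def integralOp (d : ℕ) {X : Finset W} (L : Matrix X X K) :
    Module.End K (R.FiniteSum d) :=
  (R.legAction d).gaussPairing (R.evalZero d X) L⁻¹

theorem isLocal_integralOp (d : ℕ) {X A : Finset W} (h : X ⊆ A) (L : Matrix X X K) :
    IsLocal A (R.integralOp d L) :=
  R.isLocal_of_commute (commute_countLegs_gaussPairing (R.legAction_isBounded d)
    (R.evalZero_isKernelProj d X) (disjoint_compl_right.mono_left h) _).symm

/-- The pairing of `P` with `exp (-Q⁻¹/2)`, where `Q` is the quadratic with matrix `L`. -/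
noncomputable def integral {X : Finset W} (L : Matrix X X K) (P : R.FormalSum) : R.FormalSum :=
  fun d => extend (R.integralOp d L) (P d)

/-- For a fixed coefficient, only finitely many `m'` matter, uniformly in the order of the
exponential series, and for these the series stops at a common order. So all nonzero terms lie in a
finite rectangle. -/
theorem isPairing_iff {X : Finset W} {L : Matrix X X K} {P I : R.FormalSum}
    (hP : R.IsSubstantial X P) : R.IsPairing L P I ↔ I = R.integral L P := by
  rw [isSubstantial_iff] at hP
  have key : ∀ d m, {p : ℕ × (Sym2 W →₀ ℕ) | R.pairingTerm L P d m p.1 p.2 ≠ 0}.Finite ∧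
      R.integral L P d m = ∑ᶠ p : ℕ × (Sym2 W →₀ ℕ), R.pairingTerm L P d m p.1 p.2 := by
    classical
    intro d m
    have hρ := R.legAction_isBounded d
    have hev := R.evalZero_isKernelProj d X
    have hnil := hρ.isLocNil_gaussOp (L⁻¹)
    have hc : Commute ((R.legAction d).countLegs Xᶜ) ((R.legAction d).gaussOp L⁻¹) :=
      commute_countLegs_gaussOp disjoint_compl_right _
    have hcev : Commute (R.evalZero d X : Module.End K (R.FiniteSum d))
        ((R.legAction d).countLegs Xᶜ) :=
      hev.commute (hρ.countLegs X) (countLegs_commute_countLegs _ _)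
    obtain ⟨s, hs⟩ := hρ.exists_finset X m
    obtain ⟨n, hn⟩ := hnil.exists_pow_eq_zero (s.image fun m' => Finsupp.single m' (P d m'))
    have hterm : ∀ k m', R.pairingTerm L P d m k m' =
        R.evalZero d X (dpow ((R.legAction d).gaussOp L⁻¹) k (Finsupp.single m' (P d m'))) m := by
      intro k m'
      rw [pairingTerm, negHalfInverse_eq_gaussOp, dpow, LinearMap.smul_apply, map_smul,
        Finsupp.smul_apply]
    have hsupp : ∀ k m', R.pairingTerm L P d m k m' ≠ 0 → m' ∈ s ∧ k < n := by
      intro k m' h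
      have hm' : m' ∈ s := by
        by_cases hsub : IsSubstantialExponent X m'
        · refine hs (R.evalZero d X * dpow ((R.legAction d).gaussOp L⁻¹) k)
            (hcev.mul_left ?_) m' hsub (P d m') (by rwa [hterm] at h)
          exact ((hc.pow_right k).smul_right _).symm
        · refine absurd ?_ h
          rw [hterm, hP d m' hsub, Finsupp.single_zero, map_zero, map_zero, Finsupp.zero_apply]
      refine ⟨hm', not_le.1 fun hk => h ?_⟩
      rw [hterm, dpow_apply_eq_zero_of_le (hn _ (Finset.mem_image_of_mem _ hm')) hk, map_zero,
        Finsupp.zero_apply]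
    have hsub : {p : ℕ × (Sym2 W →₀ ℕ) | R.pairingTerm L P d m p.1 p.2 ≠ 0} ⊆
        ↑(Finset.range n ×ˢ s) := by
      rintro ⟨k, m'⟩ h
      simp only [Finset.coe_product, Set.mem_prod, Finset.mem_coe, Finset.mem_range]
      exact (hsupp k m' h).symm
    refine ⟨(Finset.finite_toSet _).subset hsub, ?_⟩
    rw [finsum_eq_sum_of_support_subset _ hsub, Finset.sum_product_right, integral, extend,
      finsum_eq_sum_of_support_subset (s := s)]
    · refine Finset.sum_congr rfl fun m' hm' => ?_
      rw [integralOp, gaussPairing, Module.End.mul_apply,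
        lexp_apply_eq_sum hnil (hn _ (Finset.mem_image_of_mem _ hm')), map_sum,
        Finsupp.finsetSum_apply]
      simp only [hterm]
    · intro m' h
      by_cases hsub : IsSubstantialExponent X m'
      · exact hs _ (commute_countLegs_gaussPairing hρ hev disjoint_compl_right _).symm m' hsub _ h
      · refine absurd ?_ h
        simp only
        rw [hP d m' hsub, Finsupp.single_zero, map_zero, Finsupp.zero_apply]
  constructor
  · intro h
    ext d m
    rw [(h d m).2, (key d m).2]
  · rintro rfl
    exact key

theorem mulExp_apply {X : Finset W} (P : R.FormalSum) (L : Matrix X X K) (d : ℕ) :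
    R.mulExp P L d = psmul (expQuad ((2 : K)⁻¹ • (inclMat K X * L * (inclMat K X)ᵀ))) (P d) := by
  rw [← expHalf_eq_expQuad]
  rfl

/-- The presentation of a non-degenerate Gaussian is unique, except for the covariance matrix
of the Gaussian `0`. -/
theorem IsNondegenerateGaussianWith.unique {X : Finset W} {G P₁ P₂ : R.FormalSum}
    {L₁ L₂ : Matrix X X K} (h₁ : R.IsNondegenerateGaussianWith X G P₁ L₁)
    (h₂ : R.IsNondegenerateGaussianWith X G P₂ L₂) : P₁ = P₂ ∧ (L₁ = L₂ ∨ P₁ = 0) := by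
  obtain ⟨hs₁, -, hP₁, rfl⟩ := h₁
  obtain ⟨hs₂, -, hP₂, h⟩ := h₂
  rw [isSubstantial_iff] at hP₁ hP₂
  set D : Matrix W W K := (2 : K)⁻¹ • (inclMat K X * (L₂ - L₁) * (inclMat K X)ᵀ) with hD
  have hDs : Dᵀ = D := by
    rw [hD]
    simp only [Matrix.transpose_smul, Matrix.transpose_mul, Matrix.transpose_transpose,
      Matrix.transpose_sub, hs₁.eq, hs₂.eq, Matrix.mul_assoc]
  have hsupp : IsSupportedOn {e | ∃ a ∈ X, ∃ b ∈ X, e = s(a, b)} (expQuad D) := by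
    refine (isSupportedOn_quadSeries fun a b hab => ?_).expQuad
    obtain ⟨ha, hb⟩ := inclMat_mul_apply_ne_zero (right_ne_zero_of_mul hab)
    exact ⟨a, ha, b, hb, rfl⟩
  -- The two presentations differ by the exponential of half the difference of the quadratics.
  have hP : ∀ d, P₁ d = psmul (expQuad D) (P₂ d) := by
    intro d
    have h1 := congrFun h d
    rw [mulExp_apply, mulExp_apply] at h1
    have h2 := congrArg (psmul (expQuad (-((2 : K)⁻¹ • (inclMat K X * L₁ * (inclMat K X)ᵀ))))) h1
    rw [← psmul_mul, ← psmul_mul, ← expQuad_add, ← expQuad_add, neg_add_cancel, expQuad_zero,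
      psmul_one] at h2
    rw [h2, hD, Matrix.mul_sub, Matrix.sub_mul, smul_sub, neg_add_eq_sub]
  -- A collection of struts splits uniquely into struts inside `X` and the others; since `P₂` is
  -- substantial, only this splitting contributes to the product.
  have hcoeff : ∀ d m n, IsSubstantialExponent X m →
      (∀ e, n e ≠ 0 → ∃ a ∈ X, ∃ b ∈ X, e = s(a, b)) →
      P₁ d (m + n) = coeff n (expQuad D) • P₂ d m := by
    intro d m n hm hn
    rw [hP, psmul, Finset.sum_eq_single (m, n)]
    · rintro ⟨i, j⟩ hij hne
      rw [Finset.HasAntidiagonal.mem_antidiagonal] at hij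
      by_contra hne'
      have hi : IsSubstantialExponent X i := by
        by_contra hi
        rw [hP₂ d i hi, smul_zero] at hne'
        exact hne' rfl
      have hj := hsupp j fun h0 => hne' (by rw [h0, zero_smul])
      have him : i = m := by
        ext e
        by_cases he : ∃ a ∈ X, ∃ b ∈ X, e = s(a, b)
        · obtain ⟨a, ha, b, hb, rfl⟩ := he
          rw [hi a ha b hb, hm a ha b hb]
        · have h1 : j e = 0 := by_contra fun h' => he (hj e h')
          have h2 : n e = 0 := by_contra fun h' => he (hn e h')
          have := DFunLike.congr_fun hij e
          simp only [Finsupp.add_apply, h1, h2] at this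
          omega
      subst him
      exact hne (Prod.ext rfl (add_left_cancel hij))
    · intro h'
      rw [Finset.HasAntidiagonal.mem_antidiagonal] at h'
      exact absurd rfl h'
  have h12 : P₁ = P₂ := by
    ext d m
    by_cases hm : IsSubstantialExponent X m
    · have := hcoeff d m 0 hm (by simp)
      rwa [add_zero, coeff_zero_expQuad, one_smul] at this
    · rw [hP₁ d m hm, hP₂ d m hm]
  refine ⟨h12, or_iff_not_imp_right.2 fun hne => ?_⟩
  obtain ⟨d, hd⟩ := Function.ne_iff.1 hne
  obtain ⟨m, hm⟩ := Function.ne_iff.1 hd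
  have hsub : IsSubstantialExponent X m := by_contra fun h' => hm (hP₁ d m h')
  -- At a nonzero coefficient `m` of `P₁`, adding one strut inside `X` gives coefficient zero,
  -- because `P₁` is substantial; so the linear coefficients of the exponential vanish.
  have hD0 : D = 0 := by
    ext a b
    by_contra hab
    obtain ⟨ha, hb⟩ := inclMat_mul_apply_ne_zero (right_ne_zero_of_mul hab)
    have h1 := hcoeff d m (Finsupp.single s(a, b) 1) hsub (fun e he => by
      refine ⟨a, ha, b, hb, ?_⟩
      by_contra h'
      exact he (Finsupp.single_eq_of_ne h'))
    rw [hP₁ d _ fun h' => by simpa using h' a ha b hb, ← h12] at h1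
    rcases smul_eq_zero.1 h1.symm with h2 | h2
    · exact hab (coeff_single_expQuad hDs h2)
    · exact hm h2
  have h3 := inclMat_mul_injective ((smul_eq_zero.1 hD0).resolve_left (inv_ne_zero two_ne_zero))
  exact (sub_eq_zero.1 h3).symm

/-- By uniqueness, two presentations can differ only when the series is zero, and then the integral
is zero for every covariance matrix. -/
theorem isFGIntegral_iff {X : Finset W} {G P : R.FormalSum} {L : Matrix X X K}
    (h : R.IsNondegenerateGaussianWith X G P L) (J : R.FormalSum) :
    R.IsFGIntegral X G J ↔ J = R.integral L P := by
  constructor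
  · rintro ⟨P', L', h', hJ⟩
    rw [isPairing_iff R h'.2.2.1] at hJ
    obtain ⟨rfl, rfl | rfl⟩ := h.unique R h'
    · exact hJ
    · rw [hJ]
      ext d m
      rw [integral, integral, Pi.zero_apply, extend_zero, extend_zero]
  · intro hJ
    exact ⟨P, L, h, (isPairing_iff R h.2.2.1).2 hJ⟩

end InternalRelations

theorem expQuad_congr {K W : Type*} [Field K] [CharZero K] [Fintype W] [DecidableEq W]
    {N N' : Matrix W W K} (h : quadSeries N = quadSeries N') : expQuad N = expQuad N' := by
  rw [expQuad, expQuad, h]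

/-! ### Iterated integration -/

namespace InternalRelations

variable {K : Type*} [Field K] [CharZero K] {σ : VertexSignature} {W : Type*} [Fintype W]
  [DecidableEq W] (R : InternalRelations K σ W) {X Y : Finset W}

theorem isSupportedOn_inclMat (N : Matrix X Y K) :
    IsSupportedOn {e | ∃ a ∈ X, ∃ b ∈ Y, e = s(a, b)}
      (quadSeries (inclMat K X * N * (inclMat K Y)ᵀ)) :=
  isSupportedOn_quadSeries fun a b hab =>
    ⟨a, (inclMat_mul_apply_ne_zero hab).1, b, (inclMat_mul_apply_ne_zero hab).2, rfl⟩

theorem not_mem_of_disjoint (hXY : Disjoint X Y) (A : Finset W) :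
    ∀ x ∈ X, ∀ y ∈ X, s(x, y) ∉ {e | ∃ a ∈ A, ∃ b ∈ Y, e = s(a, b)} := by
  rintro x hx y hy ⟨a, -, b, hb, h⟩
  rcases Sym2.eq_iff.1 h with ⟨-, rfl⟩ | ⟨rfl, -⟩
  · exact Finset.disjoint_left.1 hXY hy hb
  · exact Finset.disjoint_left.1 hXY hx hb

theorem substantial_le_comap_evalZero (d : ℕ) (X A : Finset W) :
    substantial K (R.Space d) A ≤ (substantial K (R.Space d) A).comap (R.evalZero d X) :=
  substantial_le_comap (T := R.evalZero d X) fun m hm u => by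
    classical
    rw [evalZero, Finsupp.lsum_single]
    split_ifs
    · exact single_mem_substantial hm _
    · exact zero_mem _

/-- The operator computing the formal Gaussian integral over `X` of a sum multiplied by the
exponential of a quadratic in `X` and `Y`. -/
noncomputable def shiftedOp (d : ℕ) (L : Matrix X X K) (B : Matrix X Y K) :
    Module.End K (R.FiniteSum d) :=
  R.integralOp d L * lexp ((R.legAction d).shiftOp (L⁻¹ * B))

theorem isLocal_shiftedOp (hXY : Disjoint X Y) (d : ℕ) (L : Matrix X X K) (B : Matrix X Y K) :
    IsLocal (X ∪ Y) (R.shiftedOp d L B) := by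
  have hρ := R.legAction_isBounded d
  have hX : Disjoint X (X ∪ Y)ᶜ := disjoint_compl_right.mono_left Finset.subset_union_left
  have hY : Disjoint Y (X ∪ Y)ᶜ := disjoint_compl_right.mono_left Finset.subset_union_right
  exact R.isLocal_of_commute
    ((commute_countLegs_gaussPairing hρ (R.evalZero_isKernelProj d X) hX _).mul_right
      (commute_lexp (hρ.isLocNil_shiftOp hXY _) (commute_countLegs_shiftOp hX hY _))).symm

theorem isSubstantialFamily_shiftedOp (hXY : Disjoint X Y) (d : ℕ) (L : Matrix X X K)
    (B : Matrix X Y K) (f : R.FiniteSum d) (hf : IsSubstantialFamily (X ∪ Y) f) :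
    IsSubstantialFamily (X ∪ Y) (R.shiftedOp d L B f) := by
  have hρ := R.legAction_isBounded d
  rw [← mem_substantial_iff (K := K)] at hf ⊢
  exact substantial_le_comap_gaussPairing hρ Finset.subset_union_left
    (R.substantial_le_comap_evalZero d X _) _ (le_comap_lexp (hρ.isLocNil_shiftOp hXY _)
      (substantial_le_comap_shiftOp Finset.subset_union_left _) hf)

/-- Struts with both ends in `Y` are constants for the integration over `X`. The family `τ` is
concentrated in degree zero because no shift is needed. -/
theorem extend_integralOp_psmul_of_disjoint (hXY : Disjoint X Y) (d : ℕ) (L : Matrix X X K)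
    (C : Matrix Y Y K) {p : (Sym2 W →₀ ℕ) → R.Space d} (hp : IsSubstantialFamily X p) :
    extend (R.integralOp d L) (psmul (expQuad (inclMat K Y * C * (inclMat K Y)ᵀ)) p) =
      psmul (expQuad (inclMat K Y * C * (inclMat K Y)ᵀ)) (extend (R.integralOp d L) p) := by
  have hc : Commute (R.integralOp d L) (quadOp (R.Space d) C) :=
    gaussPairing_commute_quadOp hXY (R.legAction_isBounded d) (R.evalZero_isKernelProj d X) _ C
  have hE := not_mem_of_disjoint hXY Y
  refine extend_psmul (A := X) (τ := fun l => if l = 0 then 1 else 0) (isExpansion_expQuad _)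
    (isExpansion_expQuad _) (fun f => ⟨1, fun l hl => ?_, ?_⟩) (fun j => ?_)
    (R.isLocal_integralOp d subset_rfl L) (R.isLocal_integralOp d subset_rfl L)
    (fun j f hf => hf.dpow_strutMat (isSupportedOn_inclMat C) hE j)
    (fun q hq => hq.psmul (isSupportedOn_inclMat C).expQuad hE) hp
  · rw [if_neg (by omega), LinearMap.zero_apply]
  · simp
  · rw [Finset.sum_eq_single (j, 0)]
    · rw [if_pos rfl, mul_one]
      exact ((hc.pow_right j).smul_right _).eq
    · rintro ⟨a, b⟩ hab hne
      rw [Finset.HasAntidiagonal.mem_antidiagonal] at hab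
      have hb : b ≠ 0 := by
        rintro rfl
        exact hne (Prod.ext hab rfl)
      rw [if_neg hb, mul_zero, mul_zero]
    · intro h
      rw [Finset.HasAntidiagonal.mem_antidiagonal] at h
      exact absurd rfl h

/-- Completing the square for infinite sums: the linear term `xᵀBy` of the exponent becomes the
factor `exp(-½ yᵀBᵀL⁻¹By)` and a shift of `x` in the remaining integrand. -/
theorem extend_integralOp_psmul (hXY : Disjoint X Y) (d : ℕ) {L : Matrix X X K} (hL : L.IsSymm)
    (B : Matrix X Y K) {p : (Sym2 W →₀ ℕ) → R.Space d} (hp : IsSubstantialFamily (X ∪ Y) p) :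
    extend (R.integralOp d L) (psmul (expQuad (inclMat K X * B * (inclMat K Y)ᵀ)) p) =
      psmul (expQuad (inclMat K Y * (-(2 : K)⁻¹ • (Bᵀ * L⁻¹ * B)) * (inclMat K Y)ᵀ))
        (extend (R.shiftedOp d L B) p) := by
  have hρ := R.legAction_isBounded d
  have hN : (L⁻¹)ᵀ = L⁻¹ := by rw [Matrix.transpose_nonsing_inv, hL.eq]
  have hE := not_mem_of_disjoint hXY X
  have hT := hρ.isLocNil_shiftOp hXY (L⁻¹ * B)
  refine extend_psmul (A := X ∪ Y) (τ := dpow ((R.legAction d).shiftOp (L⁻¹ * B)))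
    (isExpansion_expQuad _) (isExpansion_expQuad_dpowSq _) (fun f => ?_)
    (fun j => gaussPairing_mul_dpow_quadOp hXY hρ (R.evalZero_isKernelProj d X) hN B j)
    (R.isLocal_integralOp d subset_rfl L) (R.isLocal_shiftedOp hXY d L B)
    (fun j f hf => (hf.mono Finset.subset_union_left).dpow_strutMat (isSupportedOn_inclMat B) hE j)
    (fun q hq => (hq.mono Finset.subset_union_left).psmul (isSupportedOn_inclMat B).expQuad hE) hp
  obtain ⟨n, hn⟩ := hT f
  refine ⟨n, fun l hl => dpow_apply_eq_zero_of_le hn hl, ?_⟩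
  rw [shiftedOp, Module.End.mul_apply, lexp_apply_eq_sum hT hn, map_sum]
  rfl

/-- Integration over `X` of a Gaussian with respect to `X ∪ Y`, and integration over `Y` of the
result. -/
theorem IsNondegenerateGaussianWith.fubini (hXY : Disjoint X Y) {G P : R.FormalSum}
    {L : Matrix ↥(X ∪ Y) ↥(X ∪ Y) K} (hG : R.IsNondegenerateGaussianWith (X ∪ Y) G P L)
    (hA : IsUnit (L.submatrix (Set.inclusion (Finset.subset_union_left : X ⊆ X ∪ Y))
      (Set.inclusion (Finset.subset_union_left : X ⊆ X ∪ Y)))) :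
    ∃ (A : Matrix X X K) (S : Matrix Y Y K) (P₁ P₂ : R.FormalSum),
      R.IsNondegenerateGaussianWith X G P₁ A ∧
      R.IsNondegenerateGaussianWith Y (R.integral A P₁) P₂ S ∧
      R.integral S P₂ = R.integral L P := by
  obtain ⟨hs, hL, hP, rfl⟩ := hG
  rw [isSubstantial_iff] at hP
  obtain ⟨hS, hinv⟩ := exists_block_inverse hXY hL hs hA
  have hblock := inclMat_mul_block hXY L
  simp only at hS hinv hblock
  set i := Set.inclusion (Finset.subset_union_left : X ⊆ X ∪ Y)
  set j := Set.inclusion (Finset.subset_union_right : Y ⊆ X ∪ Y)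
  set A : Matrix X X K := L.submatrix i i with hAdef
  set B : Matrix X Y K := L.submatrix i j with hB
  set C : Matrix Y Y K := L.submatrix j j with hC
  have hBt : L.submatrix j i = Bᵀ := by rw [hB, Matrix.transpose_submatrix, hs.eq]
  have hAs : A.IsSymm := by rw [Matrix.IsSymm, hAdef, Matrix.transpose_submatrix, hs.eq]
  have hCs : Cᵀ = C := by rw [hC, Matrix.transpose_submatrix, hs.eq]
  have hN : (A⁻¹)ᵀ = A⁻¹ := by rw [Matrix.transpose_nonsing_inv, hAs.eq]
  rw [hBt] at hblock
  -- Struts are unoriented, so the blocks `B` and `Bᵀ` give the same series and the factor one half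
  -- disappears from the mixed term.
  have hquad : expQuad ((2 : K)⁻¹ • (inclMat K (X ∪ Y) * L * (inclMat K (X ∪ Y))ᵀ)) =
      expQuad ((2 : K)⁻¹ • (inclMat K X * A * (inclMat K X)ᵀ) +
        (inclMat K Y * ((2 : K)⁻¹ • C) * (inclMat K Y)ᵀ + inclMat K X * B * (inclMat K Y)ᵀ)) := by
    refine expQuad_congr ?_
    have h1 : quadSeries (inclMat K Y * Bᵀ * (inclMat K X)ᵀ) =
        quadSeries (inclMat K X * B * (inclMat K Y)ᵀ) := by
      rw [← quadSeries_transpose]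
      simp only [Matrix.transpose_mul, Matrix.transpose_transpose, Matrix.mul_assoc]
    rw [hblock]
    simp only [map_add, map_smul, h1, Matrix.mul_smul, Matrix.smul_mul, smul_add]
    have h2 : ∀ v : MvPowerSeries (Sym2 W) K, (2 : K)⁻¹ • v + (2 : K)⁻¹ • v = v := fun v => by
      rw [← add_smul, ← two_mul, mul_inv_cancel₀ two_ne_zero, one_smul]
    conv_rhs => rw [← h2 (quadSeries (inclMat K X * B * (inclMat K Y)ᵀ))]
    abel
  set P₁ : R.FormalSum := fun d => psmul (expQuad (inclMat K Y * ((2 : K)⁻¹ • C) * (inclMat K Y)ᵀ))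
    (psmul (expQuad (inclMat K X * B * (inclMat K Y)ᵀ)) (P d)) with hP₁
  set P₂ : R.FormalSum := fun d => extend (R.shiftedOp d A B) (P d) with hP₂
  have hPB : ∀ d, IsSubstantialFamily X
      (psmul (expQuad (inclMat K X * B * (inclMat K Y)ᵀ)) (P d)) := fun d =>
    ((hP d).mono Finset.subset_union_left).psmul (isSupportedOn_inclMat B).expQuad
      (not_mem_of_disjoint hXY X)
  have hP₂s : ∀ d, IsSubstantialFamily (X ∪ Y) (P₂ d) := fun d =>
    (hP d).extend (R.isLocal_shiftedOp hXY d A B) (R.isSubstantialFamily_shiftedOp hXY d A B)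
  -- `P₁` absorbs the mixed quadratic and the one in `Y`; `P₂` is the shifted integrand after
  -- integration over `X`, and the covariance matrix left in `Y` is the Schur complement.
  refine ⟨A, C - Bᵀ * A⁻¹ * B, P₁, P₂, ⟨hAs, hA, ?_, ?_⟩, ⟨?_, hS, ?_, ?_⟩, ?_⟩
  · rw [isSubstantial_iff]
    exact fun d => (hPB d).psmul (isSupportedOn_inclMat _).expQuad (not_mem_of_disjoint hXY Y)
  · ext d : 1
    rw [mulExp_apply, mulExp_apply, hquad, expQuad_add, expQuad_add, psmul_mul, psmul_mul]
  · rw [Matrix.IsSymm, Matrix.transpose_sub, hCs]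
    simp only [Matrix.transpose_mul, Matrix.transpose_transpose, hN, Matrix.mul_assoc]
  · rw [isSubstantial_iff]
    exact fun d => (hP₂s d).mono Finset.subset_union_right
  · ext d : 1
    rw [mulExp_apply, integral, hP₁]
    simp only
    rw [R.extend_integralOp_psmul_of_disjoint hXY d A _ (hPB d),
      R.extend_integralOp_psmul hXY d hAs B (hP d), ← psmul_mul, ← expQuad_add]
    congr 2
    rw [← Matrix.add_mul, ← Matrix.mul_add, neg_smul, ← sub_eq_add_neg, ← smul_sub,
      Matrix.mul_smul, Matrix.smul_mul]
  · ext d : 1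
    have hρ := R.legAction_isBounded d
    have hmul : R.integralOp d (C - Bᵀ * A⁻¹ * B) * R.shiftedOp d A B = R.integralOp d L := by
      have := gaussPairing_mul_gaussPairing hXY hρ (R.evalZero_isKernelProj d X)
        (R.evalZero_isKernelProj d Y) A⁻¹ B (C - Bᵀ * A⁻¹ * B)⁻¹ L⁻¹ hinv
      rw [integralOp, shiftedOp, integralOp, this, integralOp, R.evalZero_union d hXY]
    have hloc := R.isLocal_integralOp d (subset_rfl : X ∪ Y ⊆ X ∪ Y) L
    rw [integral, integral, hP₂]
    simp only
    rw [extend_extend (R.isLocal_integralOp d Finset.subset_union_right _)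
      (R.isLocal_shiftedOp hXY d A B) (by rw [hmul]; exact hloc)
      (R.isSubstantialFamily_shiftedOp hXY d A B) (hP d), hmul]

end InternalRelations

end FormalGaussian

/-- Each equivalence `↔ J = _` expresses existence of the integral, finiteness of its coefficients
and independence of the presentation at once; the common value `I` is the Fubini identity. -/
theorem mainTheorem1 {K : Type*} [Field K] [CharZero K] {σ : FormalGaussian.VertexSignature}
    {W : Type*} [Fintype W] [DecidableEq W] (R : FormalGaussian.InternalRelations K σ W)
    (X Y : Finset W) (hXY : Disjoint X Y)
    (G P : R.FormalSum) (L : Matrix ↥(X ∪ Y) ↥(X ∪ Y) K)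
    (hG : R.IsNondegenerateGaussianWith (X ∪ Y) G P L)
    (hA : IsUnit (L.submatrix (Set.inclusion (Finset.subset_union_left : X ⊆ X ∪ Y))
      (Set.inclusion (Finset.subset_union_left : X ⊆ X ∪ Y)))) :
    R.IsNondegenerateGaussian X G ∧
    ∃ G' I : R.FormalSum,
      (∀ J, R.IsFGIntegral X G J ↔ J = G') ∧
      R.IsNondegenerateGaussian Y G' ∧
      (∀ J, R.IsFGIntegral (X ∪ Y) G J ↔ J = I) ∧
      (∀ J, R.IsFGIntegral Y G' J ↔ J = I) := by
  obtain ⟨A, S, P₁, P₂, h₁, h₂, h⟩ := hG.fubini R hXY hA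
  exact ⟨⟨P₁, A, h₁⟩, R.integral A P₁, R.integral L P, R.isFGIntegral_iff h₁, ⟨P₂, S, h₂⟩,
    R.isFGIntegral_iff hG, fun J => by rw [R.isFGIntegral_iff h₂, h]⟩
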